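/- Let $G$ be an abelian group with a complete, translation-invariant metric, and write $|g|$ for the distance from $g$ to $0$. Regard $\mathbb R^3$ as the hyperplane $\{x_4=0\}$ of $\mathbb R^4$, and let $e_4=(0,0,0,1)$. *Cells and polyhedral chains.* For $k\ge 0$, a $k$-cell $\sigma$ is a nonempty bounded subset of an affine $k$-plane in $\mathbb R^4$ that is a finite intersection of open half-spaces of that plane, together with an orientation of the plane (a $0$-cell is a point, with no orientation). $M(\sigma)$ denotes its $k$-dimensional Hausdorff measure, normalized to agree with Lebesgue measure on $k$-planes ($M=1$ for a point). Finite formal integer combinations of $k$-cells are identified when they have the same integrals over all smooth differential $k$-forms on $\mathbb R^4$; the resulting group is $\mathbf P_k(\mathbb Z)$. The boundary $\partial$ is characterized by $\int_{\partial P}\omega=\int_P d\omega$, with $\partial P=0$ for $k=0$. A family of $k$-cells is nonoverlapping if the pairwise intersections have $k$-dimensional measure $0$, and $M(\sum a_i\sigma_i)=\sum|a_i|M(\sigma_i)$ for nonoverlapping $\sigma_i$. The $1$-natural norm $|P|^{\natural_1}$ of $P\in\mathbf P_k(\mathbb Z)$ is the infimum of $\sum_i|a_i|M(\sigma_i)+\sum_j|b_j|M(\sigma'_j)\|v_j\|+M(C)$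 over all representations $P=\sum_i a_i\sigma_i+\sum_j b_j(\sigma'_j-T_{v_j}\sigma'_j)+\partial C$, where $a_i,b_j\in\mathbb Z$, the $\sigma_i,\sigma'_j$ are $k$-cells, $T_v$ is translation through $v$, and $C\in\mathbf P_{k+1}(\mathbb Z)$. *Mass and dipole cells.* For a $k$-cell $\tau\subset\mathbb R^3$ let $\tau\times t e_4=\{x+se_4:x\in\tau,\,0\le s\le t\}$, oriented by $e_4$ followed by the orientation of $\tau$. The mass cell of $\tau$ is the $(k+1)$-dimensional object $$\mu\tau=\lim_{j\to\infty}2^j(\tau\times 2^{-j}e_4),$$ the limit being taken in the $1$-natural norm and regarded as a functional on smooth $(k+1)$-forms; $\mu$ is extended additively to polyhedral chains in $\mathbb R^3$. The dipole cell of a $k$-cell $\sigma\subset\mathbb R^3$ is the $k$-dimensional object $\delta\sigma=\mu\partial\sigma+\partial\mu\sigma$, where $(\partial A)(\omega)=A(d\omega)$. Let $S_k(\mathbb Z)$ be the group generated by the dipole cells $\delta\sigma$ of $k$-cells $\sigma\subset\mathbb R^3$, and $T_k(\mathbb Z)$ the group generated by the mass cells $\mu\tau$ of $(k-1)$-cells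 $\tau\subset\mathbb R^3$ (so $T_0(\mathbb Z)=0$). *Dipolyhedra.* Put $S_k(G)=G\otimes S_k(\mathbb Z)$, $T_k(G)=G\otimes T_k(\mathbb Z)$ and $D_k(G)=S_k(G)\oplus T_k(G)$; the boundary operator $\partial:D_{k+1}(G)\to D_k(G)$ is the one induced by $\partial$ on integral chains. For nonoverlapping cells put $W(\sum g_i\,\delta\sigma_i)=\sum|g_i|M(\sigma_i)$ and $M(\sum g_i\,\mu\tau_i)=\sum|g_i|M(\tau_i)$. The energy of $D=S+T$ with $S\in S_k(G)$, $T\in T_k(G)$ is $E(D)=W(S)+M(T)$, and its flat energy is $$E_\flat(D)=\inf\{E(B)+E(C): D=B+\partial C,\ B\in D_k(G),\ C\in D_{k+1}(G)\}.$$ **Theorem.** For every $k\ge 0$, $E_\flat$ is a norm on the group $D_k(G)$: it is real-valued and nonnegative, $E_\flat(0)=0$, $E_\flat(-D)=E_\flat(D)$, $E_\flat(D+D')\le E_\flat(D)+E_\flat(D')$, and $E_\flat(D)=0$ implies $D=0$. -/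

import Mathlib

noncomputable section

namespace Dipolyhedra

open MeasureTheory Filter Topology
open scoped TensorProduct

/-- The ambient space `ℝ⁴`; the space `ℝ³` is the hyperplane on which the last coordinate is `0`. -/
abbrev R4 : Type := EuclideanSpace ℝ (Fin 4)

/-- The unit vector `e₄ = (0, 0, 0, 1)`, normal to `ℝ³`. -/
def e4 : R4 := EuclideanSpace.single 3 1

/-! ### Smooth forms and currents -/

/-- Smooth differential `k`-forms on `ℝ⁴`. -/
def Form (k : ℕ) : Type := {ω : R4 → R4 [⋀^Fin k]→L[ℝ] ℝ // ContDiff ℝ (⊤ : ℕ∞) ω}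

/-- The exterior derivative of a smooth form. -/
def Form.d {k : ℕ} (ω : Form k) : Form (k + 1) :=
  ⟨extDeriv ω.1, by
    have h : ContDiff ℝ (⊤ : ℕ∞) (fderiv ℝ ω.1) := ω.2.fderiv_right (by simp)
    exact (ContinuousAlternatingMap.alternatizeUncurryFinCLM ℝ R4 ℝ).contDiff.comp h⟩

/-- The pull-back of a form by the translation through `v`. -/
def Form.translate {k : ℕ} (v : R4) (ω : Form k) : Form k :=
  ⟨fun x => ω.1 (x + v), ω.2.comp (contDiff_id.add contDiff_const)⟩

/-- Functionals on smooth `k`-forms. Chains are identified when they have the same integrals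
over smooth forms, so a chain is recorded as the functional "integrate over the chain". -/
abbrev Current (k : ℕ) : Type := Form k → ℝ

/-- The boundary of a functional on forms: `(∂A)(ω) = A(dω)`. -/
def bdry {k : ℕ} (A : Current (k + 1)) : Current k := fun ω => A ω.d

/-- The translation `T_v A` of a functional on forms. -/
def translate {k : ℕ} (v : R4) (A : Current k) : Current k := fun ω => A (ω.translate v)

/-- Integration over a `k`-dimensional set `s` oriented by an orthonormal frame `b`. -/
def integrate {k : ℕ} (s : Set R4) (b : Fin k → R4) : Current k :=
  fun ω => ∫ x in s, ω.1 x b ∂μHE[k]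

/-! ### Cells and polyhedral chains -/

/-- An oriented (bounded, nonempty) `k`-cell in `ℝ⁴`: a subset of a `k`-plane, in which it is a
finite intersection of open half spaces; the orientation is given by an orthonormal basis of the
direction of the plane. A `0`-cell is a point. -/
structure Cell (k : ℕ) where
  /-- the underlying set -/
  carrier : Set R4
  /-- an oriented orthonormal basis of the direction of the plane of the cell -/
  frame : Fin k → R4
  orthonormal : Orthonormal ℝ frame
  halfSpaces : ∃ (p : R4) (H : Finset (R4 × ℝ)), carrier =
    {x | x - p ∈ Submodule.span ℝ (Set.range frame) ∧ ∀ h ∈ H, inner ℝ h.1 x < h.2}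
  nonempty : carrier.Nonempty
  bounded : Bornology.IsBounded carrier

/-- `M(σ)`, the `k`-dimensional Hausdorff measure of a `k`-cell (equal to `1` for a point). -/
def Cell.mass {k : ℕ} (σ : Cell k) : ℝ := (μHE[k] σ.carrier).toReal

/-- The polyhedral chain of an oriented cell. -/
def Cell.toCurrent {k : ℕ} (σ : Cell k) : Current k := integrate σ.carrier σ.frame

/-- The cell lies in `ℝ³ ⊆ ℝ⁴`. -/
def Cell.InR3 {k : ℕ} (σ : Cell k) : Prop := ∀ x ∈ σ.carrier, x 3 = 0

/-- A family of `k`-cells is nonoverlapping if any two of them meet in a set of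
`k`-dimensional measure zero. -/
def NonOverlapping {k N : ℕ} (σ : Fin N → Cell k) : Prop :=
  Pairwise fun i j => μHE[k] ((σ i).carrier ∩ (σ j).carrier) = 0

/-- The group `P_k(ℤ)` of polyhedral `k`-chains in `ℝ⁴` with integer coefficients. -/
def polyChains (k : ℕ) : AddSubgroup (Current k) :=
  AddSubgroup.closure (Set.range Cell.toCurrent)

/-- The mass `∑ |aᵢ| M(σᵢ)` of a polyhedral chain `∑ aᵢ σᵢ` with nonoverlapping `σᵢ`
(the value does not depend on the nonoverlapping representation). -/
def polyMass {k : ℕ} (P : Current k) : ℝ :=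
  sInf {w | ∃ (N : ℕ) (a : Fin N → ℤ) (σ : Fin N → Cell k), NonOverlapping σ ∧
    P = ∑ i, a i • (σ i).toCurrent ∧ w = ∑ i, |(a i : ℝ)| * (σ i).mass}

/-! ### Natural norms -/

/-- The `2^j`-multicell generated by a chain `A` and `j` vectors: `A^j = A^{j-1} - T_{v_j} A^{j-1}`. -/
def multicell {k : ℕ} (A : Current k) : List R4 → Current k
  | [] => A
  | v :: l => multicell A l - translate v (multicell A l)

/-- The `r`-natural norm on polyhedral chains: `|P|^{♮0} = M(P)`, and `|P|^{♮r}` is the infimum of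
`∑_{j ≤ r} ‖S^j‖_j + |C|^{♮(r-1)}` over all `P = ∑_{j ≤ r} [S^j] + ∂C`, with `S^j` an integral
`2^j`-multicellular chain and `C` a polyhedral `(k+1)`-chain. Here `S⁰, …, S^r` are listed together
as one formal sum of multicells `a i • (σ i; v i)` with at most `r` generating vectors each. -/
def natNorm : (r : ℕ) → {k : ℕ} → Current k → ℝ
  | 0, _, P => polyMass P
  | r + 1, k, P =>
    sInf {w | ∃ (N : ℕ) (a : Fin N → ℤ) (σ : Fin N → Cell k) (v : Fin N → List R4),
      ∃ C ∈ polyChains (k + 1), (∀ i, (v i).length ≤ r + 1) ∧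
        P = ∑ i, a i • multicell (σ i).toCurrent (v i) + bdry C ∧
        w = ∑ i, |(a i : ℝ)| * ((σ i).mass * ((v i).map fun u => ‖u‖).prod) + natNorm r C}

/-- The sequence `P` of polyhedral chains defines a chainlet of class `N^r` (it is Cauchy in the
`r`-natural norm), and `A` is the limit, as a functional on forms. -/
def IsChainletLimit {k : ℕ} (r : ℕ) (P : ℕ → Current k) (A : Current k) : Prop :=
  (∀ ε > 0, ∃ j₀, ∀ i ≥ j₀, ∀ j ≥ j₀, natNorm r (P i - P j) < ε) ∧
    ∀ ω, Tendsto (fun j => P j ω) atTop (𝓝 (A ω))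

/-! ### Mass cells and dipole cells -/

/-- `τ × t e₄`: the orbit of `τ` under the flow of `e₄` for times in `[0, t]`, oriented by `e₄`
followed by the orientation of `τ`. -/
def prism {k : ℕ} (τ : Cell k) (t : ℝ) : Current (k + 1) :=
  integrate {y | ∃ x ∈ τ.carrier, ∃ s ∈ Set.Icc 0 t, y = x + s • e4} (Fin.cons e4 τ.frame)

/-- `m` is the mass cell `μτ = lim 2^j (τ × 2^{-j} e₄)` of a cell `τ` in `ℝ³`, the limit being
taken in the `1`-natural norm. -/
def IsMassCell {k : ℕ} (τ : Cell k) (m : Current (k + 1)) : Prop :=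
  τ.InR3 ∧ IsChainletLimit 1 (fun j => (2 ^ j : ℤ) • prism τ ((2 : ℝ) ^ j)⁻¹) m

/-- The graph of the additive extension `∑ aᵢ τᵢ ↦ ∑ aᵢ μτᵢ` of `μ` to polyhedral chains
in `ℝ³`. -/
def massGraph (k : ℕ) : AddSubgroup (Current k × Current (k + 1)) :=
  AddSubgroup.closure {p | ∃ τ : Cell k, p.1 = τ.toCurrent ∧ IsMassCell τ p.2}

/-- `s` is the dipole cell `δσ = μ∂σ + ∂μσ` of a `k`-cell `σ` in `ℝ³`
(with `∂σ = 0` for a `0`-cell). -/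
def IsDipoleCell : {k : ℕ} → Cell k → Current k → Prop
  | 0, σ, s => ∃ m, IsMassCell σ m ∧ s = bdry m
  | k + 1, σ, s => ∃ m q, IsMassCell σ m ∧ (bdry σ.toCurrent, q) ∈ massGraph k ∧ s = q + bdry m

/-- The group `S_k(ℤ)` of integral dipole chains of dimension `k`. -/
def dipoleChains (k : ℕ) : AddSubgroup (Current k) :=
  AddSubgroup.closure {s | ∃ σ : Cell k, IsDipoleCell σ s}

/-- The group `T_k(ℤ)` of integral mass chains of dimension `k`, generated by the mass cells
`μτ` with `τ` of dimension `k - 1`. -/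
def massChains : (k : ℕ) → AddSubgroup (Current k)
  | 0 => ⊥
  | k + 1 => AddSubgroup.closure {m | ∃ τ : Cell k, IsMassCell τ m}

/-! ### Dipolyhedra with coefficients in `G` -/

/-- `S_k(G) = G ⊗ S_k(ℤ)`. -/
abbrev DipoleChain (G : Type*) [NormedAddCommGroup G] (k : ℕ) := G ⊗[ℤ] (dipoleChains k)

/-- `T_k(G) = G ⊗ T_k(ℤ)`. -/
abbrev MassChain (G : Type*) [NormedAddCommGroup G] (k : ℕ) := G ⊗[ℤ] (massChains k)

/-- The group of dipolyhedra `D_k(G) = S_k(G) ⊕ T_k(G)`. -/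
abbrev Dipolyhedron (G : Type*) [NormedAddCommGroup G] (k : ℕ) := DipoleChain G k × MassChain G k

variable {G : Type*} [NormedAddCommGroup G]

/-- The weight `W(S) = ∑ |gᵢ| M(σᵢ)` of a dipole chain `S = ∑ gᵢ δσᵢ` with nonoverlapping `σᵢ`
(the value does not depend on the nonoverlapping representation). -/
def weight {k : ℕ} (S : DipoleChain G k) : ℝ :=
  sInf {w | ∃ (N : ℕ) (g : Fin N → G) (σ : Fin N → Cell k) (s : Fin N → dipoleChains k),
    (∀ i, IsDipoleCell (σ i) (s i : Current k)) ∧ NonOverlapping σ ∧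
      S = ∑ i, g i ⊗ₜ[ℤ] s i ∧ w = ∑ i, ‖g i‖ * (σ i).mass}

/-- The mass `M(T) = ∑ |gᵢ| M(τᵢ)` of a mass chain `T = ∑ gᵢ μτᵢ` with nonoverlapping `τᵢ`
(the value does not depend on the nonoverlapping representation). -/
def mass : {k : ℕ} → MassChain G k → ℝ
  | 0, _ => 0
  | k + 1, T =>
    sInf {w | ∃ (N : ℕ) (g : Fin N → G) (τ : Fin N → Cell k) (m : Fin N → massChains (k + 1)),
      (∀ i, IsMassCell (τ i) (m i : Current (k + 1))) ∧ NonOverlapping τ ∧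
        T = ∑ i, g i ⊗ₜ[ℤ] m i ∧ w = ∑ i, ‖g i‖ * (τ i).mass}

/-- The energy `E(D) = W(S) + M(T)` of a dipolyhedron `D = S + T`. -/
def energy {k : ℕ} (D : Dipolyhedron G k) : ℝ := weight D.1 + mass D.2

/-- The graph of the boundary operator `∂ : D_{k+1}(G) → D_k(G)`, that is, of the extension to
coefficients in `G` of the boundary operator `s + t ↦ ∂(s + t) = s' + t'` of integral
dipolyhedra. -/
def boundaryGraph (G : Type*) [NormedAddCommGroup G] (k : ℕ) :
    AddSubgroup (Dipolyhedron G (k + 1) × Dipolyhedron G k) :=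
  AddSubgroup.closure {p | ∃ (g : G) (s : dipoleChains (k + 1)) (t : massChains (k + 1))
    (s' : dipoleChains k) (t' : massChains k),
      bdry ((s : Current (k + 1)) + (t : Current (k + 1))) = (s' : Current k) + (t' : Current k) ∧
        p = ((g ⊗ₜ[ℤ] s, g ⊗ₜ[ℤ] t), (g ⊗ₜ[ℤ] s', g ⊗ₜ[ℤ] t'))}

/-- `D' = ∂C`. -/
def IsBoundary {k : ℕ} (C : Dipolyhedron G (k + 1)) (D' : Dipolyhedron G k) : Prop :=
  (C, D') ∈ boundaryGraph G k

/-- The flat energy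
`E_♭(D) = inf {E(B) + E(C) : D = B + ∂C, B ∈ D_k(G), C ∈ D_{k+1}(G)}`. -/
def flatEnergy {k : ℕ} (D : Dipolyhedron G k) : ℝ :=
  sInf {e | ∃ (B : Dipolyhedron G k) (C : Dipolyhedron G (k + 1)) (D' : Dipolyhedron G k),
    IsBoundary C D' ∧ D = B + D' ∧ e = energy B + energy C}

end Dipolyhedra

end

noncomputable section

namespace Dipolyhedra

open MeasureTheory Filter Topology
open scoped TensorProduct

/-! Everything except definiteness is formal once the infima behave; definiteness comes from turning
dipolyhedra into ordinary polyhedral chains.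

Write `i` and `L` for contraction with and Lie derivative along `e₄`. The limit defining a mass cell
exists and is `μτ(ω) = τ(iω)`; by Cartan's formula `δσ(ω) = σ(Lω)` (`isMassCell_iff`,
`isDipoleCell_iff`). On `x₄ = 0` one has `L(x₄ω) = ω`, `i(x₄ω) = 0`, and `i d(x₄ω) = ω` along cells
of `ℝ³`. So testing with `x₄ω` recovers `σ` from `δσ` and annihilates mass cells, while testing with
`d(x₄ω)` recovers `τ` from `μτ`. This gives homomorphisms `δσ ↦ σ` and `μτ ↦ τ` into polyhedral
chains (`dipoleToPoly`, `massToPoly`).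

If `(s', t')` is the boundary of `(s, t)`, the same test forms give for the associated polyhedral
chains `s' = ∂s + t` and `t' = -∂s'`, hence `t' = -∂t` (`IsBoundary.dipole_part`,
`IsBoundary.mass_part`). Consequently, if `E_♭(D) = 0`, each component of `D` maps to a polyhedral
chain with coefficients in `G` that is `Y + ∂Z` with `Y` and `Z` of arbitrarily small mass
(`FlatNull`).

It remains to see that a flat null chain `∑ gᵢσᵢ` with nonoverlapping `σᵢ` has all `gᵢ = 0`
(`FlatNull.eq_zero_of_nonOverlapping`). The homotopy formula shows that sweeping along a vector
preserves flat nullity and raises the dimension by one. Localize at a point of `σᵢ` in a ball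
missing the other cells and sweep in normal directions until dimension `4` is reached. There no
`5`-cells exist, the flat norm is the mass, and the multiplicity function has zero `L¹` norm,
although it is `±gᵢ` on a nonempty open set.

Common refinements (`exists_refinement`) supply nonoverlapping representations, and with them
subadditivity of `W` and `M`. The Stokes theorem on cells (`Cell.bdry_mem`) makes `∂` an operator on
polyhedral chains and makes `μ∂σ` available in the definition of `δσ`. -/

/-! ### Euclidean measure on affine planes -/

/-- The parametrization of the plane through `p` with frame `b`. -/
def param {k : ℕ} (p : R4) (b : Fin k → R4) (u : Fin k → ℝ) : R4 := p + ∑ i, u i • b i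

lemma continuous_param {k : ℕ} (p : R4) (b : Fin k → R4) : Continuous (param p b) := by
  unfold param; fun_prop

lemma param_sub_mem_span {k : ℕ} (p : R4) (b : Fin k → R4) (u : Fin k → ℝ) :
    param p b u - p ∈ Submodule.span ℝ (Set.range b) := by
  simp only [param, add_sub_cancel_left]
  exact Submodule.sum_mem _ fun i _ =>
    Submodule.smul_mem _ _ (Submodule.subset_span ⟨i, rfl⟩)

lemma mem_range_param {k : ℕ} {p : R4} {b : Fin k → R4} {x : R4} :
    x ∈ Set.range (param p b) ↔ x - p ∈ Submodule.span ℝ (Set.range b) := by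
  constructor
  · rintro ⟨u, rfl⟩
    exact param_sub_mem_span p b u
  · intro h
    obtain ⟨u, hu⟩ := (Submodule.mem_span_range_iff_exists_fun ℝ).1 h
    exact ⟨u, by simp [param, hu]⟩

/-- The parametrization of a plane by an orthonormal frame, as an isometry. -/
lemma isometry_param {k : ℕ} (p : R4) {b : Fin k → R4} (hb : Orthonormal ℝ b) :
    Isometry fun u : EuclideanSpace ℝ (Fin k) => param p b u := by
  refine Isometry.of_dist_eq fun u v => ?_
  rw [dist_eq_norm, EuclideanSpace.dist_eq, ← Real.sqrt_sq (norm_nonneg _)]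
  congr 1
  have : param p b u - param p b v = ∑ i, (u i - v i) • b i := by
    simp [param, sub_smul, Finset.sum_sub_distrib]
  rw [this, ← real_inner_self_eq_norm_sq, hb.inner_sum]
  simp [Real.dist_eq, sq]

lemma param_injective {k : ℕ} (p : R4) {b : Fin k → R4} (hb : Orthonormal ℝ b) :
    Function.Injective (param p b) := fun u v h => by
  have := (isometry_param p hb).injective (a₁ := WithLp.toLp 2 u) (a₂ := WithLp.toLp 2 v) h
  simpa using this

lemma isClosedEmbedding_param {k : ℕ} (p : R4) {b : Fin k → R4} (hb : Orthonormal ℝ b) :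
    IsClosedEmbedding (param p b) := by
  have h := (isometry_param p hb).isClosedEmbedding
  exact h.comp (PiLp.homeomorph 2 fun _ : Fin k => ℝ).symm.isClosedEmbedding

/-- Isometries carry normalized Hausdorff measure to its restriction to the range, and on
`EuclideanSpace` that measure is Lebesgue measure. This converts integrals over cells into Lebesgue
integrals on `ℝᵏ`. -/
lemma map_param {k : ℕ} (p : R4) {b : Fin k → R4} (hb : Orthonormal ℝ b) :
    Measure.map (param p b) volume = (μHE[k]).restrict (Set.range (param p b)) := by
  have h := (isometry_param p hb).map_euclideanHausdorffMeasure (d := k)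
  rw [EuclideanSpace.euclideanHausdorffMeasure_eq_volume] at h
  have h2 := (PiLp.volume_preserving_toLp (Fin k))
  rw [← h2.map_eq, Measure.map_map (isometry_param p hb).continuous.measurable h2.measurable] at h
  have hr : Set.range (param p b) =
      Set.range fun u : EuclideanSpace ℝ (Fin k) => param p b u :=
    Set.Subset.antisymm (by rintro _ ⟨u, rfl⟩; exact ⟨WithLp.toLp 2 u, rfl⟩)
      (by rintro _ ⟨u, rfl⟩; exact ⟨u, rfl⟩)
  rw [hr]
  exact h

lemma measure_param {k : ℕ} {p : R4} {b : Fin k → R4} (hb : Orthonormal ℝ b) {s : Set R4}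
    (hs : s ⊆ Set.range (param p b)) : μHE[k] s = volume (param p b ⁻¹' s) := by
  have h := (isClosedEmbedding_param p hb).measurableEmbedding
  rw [← h.map_apply, map_param p hb, Measure.restrict_eq_self _ hs]

lemma restrict_eq_map_param {k : ℕ} {p : R4} {b : Fin k → R4} (hb : Orthonormal ℝ b) {s : Set R4}
    (hs : s ⊆ Set.range (param p b)) :
    (μHE[k]).restrict s = (volume.restrict (param p b ⁻¹' s)).map (param p b) := by
  have h := (isClosedEmbedding_param p hb)
  rw [← h.measurableEmbedding.restrict_map, map_param p hb,
    Measure.restrict_restrict_of_subset hs]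

lemma setIntegral_param {k : ℕ} {p : R4} {b : Fin k → R4} (hb : Orthonormal ℝ b) {s : Set R4}
    (hs : s ⊆ Set.range (param p b)) (F : R4 → ℝ) :
    ∫ x in s, F x ∂μHE[k] = ∫ u in param p b ⁻¹' s, F (param p b u) := by
  rw [restrict_eq_map_param hb hs,
    (isClosedEmbedding_param p hb).measurableEmbedding.integral_map]

lemma param_cons {k : ℕ} (p n : R4) (b : Fin k → R4) (s : ℝ) (u : Fin k → ℝ) :
    param p (Fin.cons n b : Fin (k + 1) → R4) (Fin.cons s u : Fin (k + 1) → ℝ) =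
      param p b u + s • n := by
  simp [param, Fin.sum_univ_succ, add_comm, add_left_comm]

lemma volume_preserving_cons (k : ℕ) :
    MeasurePreserving (fun q : ℝ × (Fin k → ℝ) => (Fin.cons q.1 q.2 : Fin (k + 1) → ℝ)) := by
  have := (volume_preserving_piFinSuccAbove (fun _ : Fin (k + 1) => ℝ) 0).symm
  convert this using 1
  funext q
  simp [MeasurableEquiv.piFinSuccAbove, Fin.insertNth_zero', Fin.insertNthEquiv]

lemma measurableEmbedding_cons (k : ℕ) :
    MeasurableEmbedding (fun q : ℝ × (Fin k → ℝ) => (Fin.cons q.1 q.2 : Fin (k + 1) → ℝ)) := by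
  have := ((MeasurableEquiv.piFinSuccAbove (fun _ : Fin (k + 1) => ℝ) 0).symm).measurableEmbedding
  convert this using 1
  funext q
  simp [MeasurableEquiv.piFinSuccAbove, Fin.insertNth_zero', Fin.insertNthEquiv]

lemma isBounded_preimage_param {k : ℕ} (p : R4) {b : Fin k → R4} (hb : Orthonormal ℝ b)
    {S : Set R4} (hS : Bornology.IsBounded S) : Bornology.IsBounded (param p b ⁻¹' S) := by
  obtain ⟨R, hR⟩ := (Metric.isBounded_iff_subset_closedBall p).1 hS
  refine (Metric.isBounded_iff_subset_closedBall 0).2 ⟨R, fun u hu => ?_⟩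
  have h2 := hR hu
  rw [Metric.mem_closedBall] at h2 ⊢
  have h3 := (isometry_param p hb).dist_eq (WithLp.toLp 2 u) (WithLp.toLp 2 0)
  have h4 : param p b (WithLp.toLp 2 (0 : Fin k → ℝ)) = p := by simp [param]
  rw [h4] at h3
  have hR0 : 0 ≤ R := dist_nonneg.trans h2
  refine (dist_pi_le_iff hR0).2 fun i => ?_
  have h5 : dist (WithLp.toLp 2 u) (WithLp.toLp 2 (0 : Fin k → ℝ)) ≤ R := by
    rw [← h3]; exact h2
  refine le_trans ?_ h5
  have := PiLp.norm_apply_le (p := 2) (WithLp.toLp 2 u - WithLp.toLp 2 (0 : Fin k → ℝ)) i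
  simpa [dist_eq_norm] using this

/-! ### Cells -/

namespace Cell

variable {k : ℕ} (σ : Cell k)

/-- The base point of the plane can be moved within the plane, so it may be taken inside the cell.
-/
lemma exists_halfSpaces {p : R4} (hp : p ∈ σ.carrier) : ∃ H : Finset (R4 × ℝ), σ.carrier =
    {x | x - p ∈ Submodule.span ℝ (Set.range σ.frame) ∧ ∀ h ∈ H, inner ℝ h.1 x < h.2} := by
  obtain ⟨q, H, h⟩ := σ.halfSpaces
  refine ⟨H, ?_⟩
  rw [h] at hp ⊢
  ext x
  simp only [Set.mem_ofPred_eq]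
  refine and_congr_left fun _ => ?_
  have : x - q = (x - p) + (p - q) := by abel
  rw [this, Submodule.add_mem_iff_left _ hp.1]

lemma subset_range {p : R4} (hp : p ∈ σ.carrier) : σ.carrier ⊆ Set.range (param p σ.frame) := by
  obtain ⟨H, h⟩ := σ.exists_halfSpaces hp
  intro x hx
  rw [h] at hx
  exact mem_range_param.2 hx.1

lemma isOpen_preimage {p : R4} (hp : p ∈ σ.carrier) :
    IsOpen (param p σ.frame ⁻¹' σ.carrier) := by
  obtain ⟨H, h⟩ := σ.exists_halfSpaces hp
  have : param p σ.frame ⁻¹' σ.carrier =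
      ⋂ h ∈ H, {u | inner ℝ h.1 (param p σ.frame u) < h.2} := by
    ext u
    rw [h]
    simp [param_sub_mem_span]
  rw [this]
  refine isOpen_biInter_finset fun h _ => isOpen_lt ?_ continuous_const
  exact continuous_const.inner (continuous_param _ _)

lemma convex : Convex ℝ σ.carrier := by
  obtain ⟨p, hp⟩ := σ.nonempty
  obtain ⟨H, h⟩ := σ.exists_halfSpaces hp
  rw [h]
  intro x hx y hy a c ha hc hac
  refine ⟨?_, fun h hh => ?_⟩
  · have : a • x + c • y - p = a • (x - p) + c • (y - p) := by
      rw [smul_sub, smul_sub, sub_add_sub_comm, ← add_smul, hac, one_smul]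
    rw [this]
    exact Submodule.add_mem _ (Submodule.smul_mem _ _ hx.1) (Submodule.smul_mem _ _ hy.1)
  · rw [inner_add_right, inner_smul_right, inner_smul_right]
    have h1 := hx.2 h hh
    have h2 := hy.2 h hh
    rcases ha.eq_or_lt with rfl | ha
    · have : c = 1 := by linarith
      subst this; linarith
    · calc _ < a * h.2 + c * h.2 := add_lt_add_of_lt_of_le (mul_lt_mul_of_pos_left h1 ha)
            (mul_le_mul_of_nonneg_left h2.le hc)
        _ = h.2 := by rw [← add_mul, hac, one_mul]

lemma measurableSet : MeasurableSet σ.carrier := by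
  obtain ⟨p, hp⟩ := σ.nonempty
  have h := (isClosedEmbedding_param p σ.orthonormal).measurableEmbedding
  rw [← Set.inter_eq_left.2 (σ.subset_range hp), ← Set.image_preimage_eq_inter_range]
  exact h.measurableSet_image.2 (σ.isOpen_preimage hp).measurableSet

lemma measure_lt_top : μHE[k] σ.carrier < ⊤ := by
  obtain ⟨p, hp⟩ := σ.nonempty
  rw [measure_param σ.orthonormal (σ.subset_range hp)]
  exact (isBounded_preimage_param p σ.orthonormal σ.bounded).measure_lt_top

lemma measure_pos : 0 < μHE[k] σ.carrier := by
  obtain ⟨p, hp⟩ := σ.nonempty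
  rw [measure_param σ.orthonormal (σ.subset_range hp)]
  exact (σ.isOpen_preimage hp).measure_pos _ ⟨0, by simpa [param] using hp⟩

lemma mass_nonneg : 0 ≤ σ.mass := ENNReal.toReal_nonneg

lemma ofReal_mass : ENNReal.ofReal σ.mass = μHE[k] σ.carrier :=
  ENNReal.ofReal_toReal σ.measure_lt_top.ne

lemma integrableOn {F : R4 → ℝ} (hF : Continuous F) : IntegrableOn F σ.carrier μHE[k] := by
  have hc : IsCompact (closure σ.carrier) := σ.bounded.isCompact_closure
  obtain ⟨C, hC⟩ := hc.exists_bound_of_continuousOn hF.continuousOn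
  refine Measure.integrableOn_of_bounded (M := C) σ.measure_lt_top.ne hF.aestronglyMeasurable ?_
  refine (ae_restrict_iff' σ.measurableSet).2 (Eventually.of_forall fun x hx => ?_)
  exact hC x (subset_closure hx)

lemma toCurrent_apply (ω : Form k) :
    σ.toCurrent ω = ∫ x in σ.carrier, ω.1 x σ.frame ∂μHE[k] := rfl

end Cell

lemma Form.continuous_apply {k : ℕ} (ω : Form k) (b : Fin k → R4) :
    Continuous fun x => ω.1 x b :=
  (ContinuousAlternatingMap.apply ℝ R4 ℝ b).continuous.comp ω.2.continuous

lemma Cell.integrableOn_form {k : ℕ} (σ : Cell k) (ω : Form k) (b : Fin k → R4) :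
    IntegrableOn (fun x => ω.1 x b) σ.carrier μHE[k] :=
  σ.integrableOn (ω.continuous_apply b)

/-! ### Operations on forms -/

/-- Differentiation under the integral sign; the dominating function is constant because the
derivative is bounded on a compact ball times `[0, 1]`. -/
lemma hasFDerivAt_lineAverage {V : Type} [NormedAddCommGroup V] [NormedSpace ℝ V]
    {f : R4 → V} (hf : ContDiff ℝ 1 f) (w x : R4) :
    HasFDerivAt (fun x => ∫ t in (0 : ℝ)..1, f (x + t • w))
      (∫ t in (0 : ℝ)..1, fderiv ℝ f (x + t • w)) x := by
  have hc : Continuous fun q : R4 × ℝ => fderiv ℝ f (q.1 + q.2 • w) :=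
    (hf.continuous_fderiv one_ne_zero).comp (by fun_prop)
  obtain ⟨C, hC⟩ := ((isCompact_closedBall x 1).prod
    (isCompact_Icc (a := (0 : ℝ)) (b := 1))).exists_bound_of_continuousOn hc.continuousOn
  refine intervalIntegral.hasFDerivAt_integral_of_dominated_of_fderiv_le
    (F := fun x t => f (x + t • w)) (F' := fun x t => fderiv ℝ f (x + t • w))
    (bound := fun _ => C) (Metric.closedBall_mem_nhds x one_pos) ?_ ?_ ?_ ?_ ?_ ?_
  · refine Eventually.of_forall fun y => Continuous.aestronglyMeasurable ?_
    exact hf.continuous.comp (by fun_prop)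
  · exact (hf.continuous.comp (by fun_prop)).intervalIntegrable _ _
  · exact (hc.comp (by fun_prop : Continuous fun t : ℝ => (x, t))).aestronglyMeasurable
  · refine Eventually.of_forall fun t ht y hy => hC (y, t) ⟨hy, ?_⟩
    rw [Set.uIoc_of_le zero_le_one] at ht
    exact ⟨ht.1.le, ht.2⟩
  · simp
  · refine Eventually.of_forall fun t _ y _ => ?_
    have h1 := (hf.differentiable one_ne_zero (y + t • w)).hasFDerivAt
    exact (hasFDerivAt_comp_add_right (t • w)).2 h1

/-- The derivative of an average is the average of the derivative, so smoothness follows by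
induction on the order. The target space varies in the induction because the derivative takes values
in a space of linear maps. -/
lemma contDiff_lineAverage {V : Type} [NormedAddCommGroup V] [NormedSpace ℝ V]
    {f : R4 → V} (hf : ContDiff ℝ (⊤ : ℕ∞) f) (w : R4) :
    ContDiff ℝ (⊤ : ℕ∞) fun x => ∫ t in (0 : ℝ)..1, f (x + t • w) := by
  refine contDiff_infty.2 fun n => ?_
  induction n generalizing V with
  | zero =>
    have hf1 : ContDiff ℝ 1 f := hf.of_le (by exact_mod_cast le_top)
    refine contDiff_zero.2 (continuous_iff_continuousAt.2 fun x => ?_)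
    exact (hasFDerivAt_lineAverage hf1 w x).continuousAt
  | succ n ih =>
    have hf1 : ContDiff ℝ 1 f := hf.of_le (by exact_mod_cast le_top)
    push_cast
    refine contDiff_succ_iff_fderiv.2
      ⟨fun x => (hasFDerivAt_lineAverage hf1 w x).differentiableAt, by simp, ?_⟩
    have : fderiv ℝ (fun x => ∫ t in (0 : ℝ)..1, f (x + t • w)) =
        fun x => ∫ t in (0 : ℝ)..1, fderiv ℝ f (x + t • w) :=
      funext fun x => (hasFDerivAt_lineAverage hf1 w x).fderiv
    rw [this]
    exact ih (hf.fderiv_right (by simp))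

namespace Form

variable {k : ℕ}

lemma differentiable (ω : Form k) : Differentiable ℝ ω.1 := ω.2.differentiable (by simp)

lemma contDiff_one (ω : Form k) : ContDiff ℝ 1 ω.1 := ω.2.of_le (by exact_mod_cast le_top)

/-- Contraction with a constant vector, as a continuous linear map on alternating maps. -/
def contract (k : ℕ) (w : R4) : (R4 [⋀^Fin (k + 1)]→L[ℝ] ℝ) →L[ℝ] (R4 [⋀^Fin k]→L[ℝ] ℝ) :=
  (ContinuousLinearMap.apply ℝ _ w).comp
    (ContinuousAlternatingMap.curryLeftLI (𝕜 := ℝ) (E := R4) (F := ℝ)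
      (n := k)).toContinuousLinearMap

@[simp]
lemma contract_apply (w : R4) (f : R4 [⋀^Fin (k + 1)]→L[ℝ] ℝ) (v : Fin k → R4) :
    contract k w f v = f (Fin.cons w v : Fin (k + 1) → R4) := rfl

/-- The interior product of a form with a constant vector field. -/
def interior (w : R4) (ω : Form (k + 1)) : Form k :=
  ⟨fun x => contract k w (ω.1 x), (contract k w).contDiff.comp ω.2⟩

@[simp]
lemma interior_apply (w : R4) (ω : Form (k + 1)) (x : R4) (v : Fin k → R4) :
    (ω.interior w).1 x v = ω.1 x (Fin.cons w v : Fin (k + 1) → R4) := rfl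

/-- The Lie derivative of a form along a constant vector field. -/
def lie (w : R4) (ω : Form k) : Form k :=
  ⟨fun x => fderiv ℝ ω.1 x w, (ω.2.fderiv_right (by simp)).clm_apply contDiff_const⟩

lemma lie_val (w : R4) (ω : Form k) (x : R4) : (ω.lie w).1 x = fderiv ℝ ω.1 x w := rfl

/-- The product of a form with the last coordinate function. -/
def mulCoord (ω : Form k) : Form k :=
  ⟨fun x => (x 3) • ω.1 x, by
    have : ContDiff ℝ (⊤ : ℕ∞) fun x : R4 => x 3 :=
      (EuclideanSpace.proj (𝕜 := ℝ) (3 : Fin 4)).contDiff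
    exact this.smul ω.2⟩

/-- The average of the translates of a form through `t • w`, `0 ≤ t ≤ 1`. -/
def average (w : R4) (ω : Form k) : Form k :=
  ⟨fun x => ∫ t in (0 : ℝ)..1, ω.1 (x + t • w), contDiff_lineAverage ω.2 w⟩

lemma average_apply (w : R4) (ω : Form k) (x : R4) (v : Fin k → R4) :
    (ω.average w).1 x v = ∫ t in (0 : ℝ)..1, ω.1 (x + t • w) v := by
  have := (ContinuousAlternatingMap.apply ℝ R4 ℝ v).intervalIntegral_comp_comm
    (μ := volume) (a := (0 : ℝ)) (b := 1) (f := fun t => ω.1 (x + t • w))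
    ((ω.2.continuous.comp (by fun_prop)).intervalIntegrable _ _)
  exact this.symm

lemma average_val (w : R4) (ω : Form k) (x : R4) :
    (ω.average w).1 x = ∫ t in (0 : ℝ)..1, ω.1 (x + t • w) := rfl

lemma d_val (ω : Form k) (x : R4) :
    ω.d.1 x = ContinuousAlternatingMap.alternatizeUncurryFin (fderiv ℝ ω.1 x) := rfl

lemma d_average (w : R4) (ω : Form k) : (ω.average w).d = ω.d.average w := by
  refine Subtype.ext (funext fun x => ?_)
  rw [d_val, average_val]
  have h : fderiv ℝ (ω.average w).1 x = ∫ t in (0 : ℝ)..1, fderiv ℝ ω.1 (x + t • w) :=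
    (hasFDerivAt_lineAverage ω.contDiff_one w x).fderiv
  rw [h]
  refine (ContinuousLinearMap.intervalIntegral_comp_comm (𝕜 := ℝ)
    (ContinuousAlternatingMap.alternatizeUncurryFinCLM (n := k) ℝ R4 ℝ)
    (μ := volume) (a := (0 : ℝ)) (b := 1) (f := fun t => fderiv ℝ ω.1 (x + t • w)) ?_).symm
  exact ((ω.contDiff_one.continuous_fderiv one_ne_zero).comp (by fun_prop)).intervalIntegrable _ _

/-- The fundamental theorem of calculus along the segment from `x` to `x + w`. -/
lemma average_lie (w : R4) (ω : Form k) (x : R4) :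
    ((ω.lie w).average w).1 x = ω.1 (x + w) - ω.1 x := by
  rw [average_val]
  have h : ∀ t ∈ Set.uIcc (0 : ℝ) 1,
      HasDerivAt (fun t : ℝ => ω.1 (x + t • w)) ((ω.lie w).1 (x + t • w)) t := fun t _ => by
    have h1 := (ω.differentiable (x + t • w)).hasFDerivAt
    have h2 : HasDerivAt (fun t : ℝ => x + t • w) w t := by
      simpa using ((hasDerivAt_id t).smul_const w).const_add x
    exact h1.comp_hasDerivAt t h2
  rw [intervalIntegral.integral_eq_sub_of_hasDerivAt h]
  · simp
  · exact (((ω.lie w).2.continuous).comp (by fun_prop)).intervalIntegrable _ _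

/-- The Cartan formula for a constant vector field. -/
lemma cartan (w : R4) (ω : Form (k + 1)) (x : R4) :
    (ω.d.interior w).1 x + (ω.interior w).d.1 x = (ω.lie w).1 x := by
  have h : fderiv ℝ (ω.interior w).1 x = (contract k w).comp (fderiv ℝ ω.1 x) :=
    ((contract k w).hasFDerivAt.comp x (ω.differentiable x).hasFDerivAt).fderiv
  ext v
  rw [ContinuousAlternatingMap.add_apply, interior_apply, d_val, d_val, h, lie_val,
    ContinuousAlternatingMap.alternatizeUncurryFin_apply,
    ContinuousAlternatingMap.alternatizeUncurryFin_apply, Fin.sum_univ_succ, add_assoc,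
    ← Finset.sum_add_distrib]
  simp only [Fin.val_zero, pow_zero, one_smul, Fin.cons_zero, Fin.val_succ, Fin.cons_succ]
  have h0 : Fin.removeNth 0 (Fin.cons w v : Fin (k + 2) → R4) = v := by
    ext i; simp [Fin.removeNth]
  rw [h0]
  -- Only the zeroth term, the derivative along `w`, survives. The others cancel in pairs: deleting
  -- slot `i + 1` of `(w, v)` leaves `w` followed by `v` without slot `i`, with the opposite sign.
  refine add_eq_left.2 (Finset.sum_eq_zero fun i _ => ?_)
  have h1 : Fin.removeNth i.succ (Fin.cons w v : Fin (k + 2) → R4) =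
      Fin.cons w (Fin.removeNth i v) := by
    ext j
    refine Fin.cases ?_ (fun j => ?_) j <;> simp [Fin.removeNth]
  rw [h1, ContinuousLinearMap.comp_apply, contract_apply, pow_succ]
  simp

/-- The Cartan formula for a constant vector field on `0`-forms. -/
lemma cartan_zero (w : R4) (ω : Form 0) (x : R4) :
    (ω.d.interior w).1 x = (ω.lie w).1 x := by
  ext v
  rw [interior_apply, d_val, lie_val, ContinuousAlternatingMap.alternatizeUncurryFin_apply]
  refine (Fin.sum_univ_one _).trans ?_
  change (-1 : ℤ) ^ (0 : ℕ) • fderiv ℝ ω.1 x w _ = _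
  rw [pow_zero, one_smul]
  congr 1

lemma d_d (ω : Form k) (x : R4) : ω.d.d.1 x = 0 := by
  have := extDeriv_extDeriv (𝕜 := ℝ) (ω := ω.1) (r := (⊤ : ℕ∞)) ω.2 (by
    rw [minSmoothness_of_isRCLikeNormedField]; exact WithTop.coe_le_coe.2 (le_top : (2 : ℕ∞) ≤ ⊤))
  exact congrFun this x

/-- The operator on forms dual to sweeping a chain along the segment `[0, w]`. -/
def sweep (w : R4) (ω : Form (k + 1)) : Form k := (ω.interior w).average w

lemma sweep_apply (w : R4) (ω : Form (k + 1)) (x : R4) (v : Fin k → R4) :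
    (ω.sweep w).1 x v = ∫ t in (0 : ℝ)..1, ω.1 (x + t • w) (Fin.cons w v : Fin (k + 1) → R4) :=
  average_apply _ _ _ _

lemma average_add_apply (w : R4) (ω₁ ω₂ : Form k) (x : R4) :
    (ω₁.average w).1 x + (ω₂.average w).1 x = ∫ t in (0 : ℝ)..1,
      (ω₁.1 (x + t • w) + ω₂.1 (x + t • w)) := by
  rw [average_val, average_val, ← intervalIntegral.integral_add]
  · exact (ω₁.2.continuous.comp (by fun_prop)).intervalIntegrable _ _
  · exact (ω₂.2.continuous.comp (by fun_prop)).intervalIntegrable _ _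

/-- The homotopy formula. -/
lemma sweep_homotopy (w : R4) (ω : Form (k + 1)) (x : R4) :
    (ω.d.sweep w).1 x + (ω.sweep w).d.1 x = ω.1 (x + w) - ω.1 x := by
  -- Cartan's formula averaged along the segment, followed by the fundamental theorem of calculus.
  rw [sweep, sweep, d_average, average_add_apply]
  simp_rw [cartan]
  exact average_lie w ω x

/-- Cartan's formula used twice: contracting `ddω = 0` gives `L dω = d(i dω)`, and `Lω` differs from
`i dω` by the closed form `d(iω)`, a term absent in degree `0`. -/
lemma lie_d (w : R4) (ω : Form k) (x : R4) : (ω.d.lie w).1 x = (ω.lie w).d.1 x := by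
  have h0 : (ω.d.d.interior w).1 x = 0 := by
    change contract (k + 1) w (ω.d.d.1 x) = 0
    rw [d_d, map_zero]
  rw [← cartan, h0, zero_add]
  cases k with
  | zero =>
    have : ω.d.interior w = ω.lie w := Subtype.ext (funext fun y => cartan_zero w ω y)
    rw [this]
  | succ k =>
    have h1 : (ω.lie w).1 = (ω.d.interior w).1 + (ω.interior w).d.1 :=
      funext fun y => (cartan w ω y).symm
    have h2 : (ω.lie w).d.1 x = extDeriv ((ω.d.interior w).1 + (ω.interior w).d.1) x := by
      rw [← h1]; rfl
    rw [h2, extDeriv_add ((ω.d.interior w).differentiable x) ((ω.interior w).d.differentiable x)]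
    have h3 : extDeriv (ω.interior w).d.1 x = 0 := (ω.interior w).d_d x
    rw [h3, add_zero]
    rfl

/-- The Leibniz rule with `∂x₄/∂e₄ = 1`. At points of `ℝ³` the second term vanishes, which is what
recovers a cell from its dipole cell. -/
lemma lie_mulCoord (ω : Form k) (x : R4) :
    (ω.mulCoord.lie e4).1 x = ω.1 x + x 3 • (ω.lie e4).1 x := by
  have h1 : HasFDerivAt (fun x : R4 => x 3) (EuclideanSpace.proj (𝕜 := ℝ) (3 : Fin 4)) x :=
    (EuclideanSpace.proj (𝕜 := ℝ) (3 : Fin 4)).hasFDerivAt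
  have h2 := (ω.differentiable x).hasFDerivAt
  have h3 : fderiv ℝ ω.mulCoord.1 x = _ := (h1.smul h2).fderiv
  rw [lie_val, h3]
  simp [e4, lie_val, add_comm]

end Form

/-! ### Sweeping cells along segments -/

lemma param_add {k : ℕ} (p : R4) (b : Fin k → R4) (u v : Fin k → ℝ) :
    param p b (u + v) = param p b u + ∑ i, v i • b i := by
  simp [param, add_smul, Finset.sum_add_distrib, add_assoc]

lemma orthonormal_tail {k : ℕ} {n : R4} {b : Fin k → R4}
    (h : Orthonormal ℝ (Fin.cons n b : Fin (k + 1) → R4)) : Orthonormal ℝ b := by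
  have := h.comp Fin.succ (Fin.succ_injective k)
  simpa [Function.comp_def] using this

/-- The set swept out by `s` along the multiples `r • v`, `r ∈ I`. -/
def sweptSet (s : Set R4) (I : Set ℝ) (v : R4) : Set R4 := {y | ∃ x ∈ s, ∃ r ∈ I, y = x + r • v}

/-- Fubini for oblique prisms. Moving in direction `n + c`, with `n` a unit normal and `c` tangent,
is in coordinates the shear `(r, u) ↦ (r, u + r β)` followed by the orthonormal parametrization. The
shear preserves volume, so no Jacobian appears. -/
lemma map_sweep {k : ℕ} {p n c : R4} {b : Fin k → R4}
    (hb : Orthonormal ℝ (Fin.cons n b : Fin (k + 1) → R4))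
    (hc : c ∈ Submodule.span ℝ (Set.range b)) {s : Set R4}
    (hs : s ⊆ Set.range (param p b)) (I : Set ℝ) :
    Measure.map (fun q : ℝ × R4 => q.2 + q.1 • (n + c))
      ((volume.restrict I).prod ((μHE[k]).restrict s)) =
      (μHE[k + 1]).restrict (sweptSet s I (n + c)) := by
  have hb' := orthonormal_tail hb
  obtain ⟨β, hβ⟩ := (Submodule.mem_span_range_iff_exists_fun ℝ).1 hc
  let θ : ℝ × (Fin k → ℝ) → ℝ × (Fin k → ℝ) := fun q => (q.1, q.2 + q.1 • β)
  have hθ : MeasurePreserving θ (volume.prod volume) (volume.prod volume) := by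
    refine (MeasurePreserving.id volume).skew_product (g := fun r u => u + r • β) (by fun_prop) ?_
    exact Eventually.of_forall fun r => (measurePreserving_add_right volume (r • β)).map_eq
  let ψ : ℝ × (Fin k → ℝ) → R4 := fun q => param p b q.2 + q.1 • (n + c)
  have hψ : ψ = fun q => param p (Fin.cons n b : Fin (k + 1) → R4)
      ((Fin.cons (θ q).1 (θ q).2 : Fin (k + 1) → ℝ)) := by
    funext q
    rw [param_cons, param_add]
    simp only [ψ, θ, Pi.smul_apply, smul_eq_mul, mul_smul, ← Finset.smul_sum, hβ]
    rw [smul_add]; abel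
  have hψc : Continuous ψ := ((continuous_param p b).comp continuous_snd).add (by fun_prop)
  have hψi : Function.Injective ψ := by
    rw [hψ]
    intro q q' h
    have h1 := param_injective p hb h
    have h2 : (θ q).1 = (θ q').1 ∧ (θ q).2 = (θ q').2 := Fin.cons_inj.1 h1
    have h3 : q.1 = q'.1 := h2.1
    have h4 : q.2 + q.1 • β = q'.2 + q'.1 • β := h2.2
    rw [h3] at h4
    exact Prod.ext h3 (add_right_cancel h4)
  have hψe : MeasurableEmbedding ψ := hψc.measurableEmbedding hψi
  have hmap : Measure.map ψ (volume.prod volume) =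
      (μHE[k + 1]).restrict (Set.range (param p (Fin.cons n b : Fin (k + 1) → R4))) := by
    rw [← map_param p hb, ← (volume_preserving_cons k).map_eq,
      Measure.map_map (continuous_param _ _).measurable (volume_preserving_cons k).measurable, hψ]
    have h := Measure.map_map (μ := volume.prod volume) (f := θ)
      (g := fun q : ℝ × (Fin k → ℝ) =>
        param p (Fin.cons n b : Fin (k + 1) → R4) (Fin.cons q.1 q.2 : Fin (k + 1) → ℝ))
      ((continuous_param _ _).measurable.comp (volume_preserving_cons k).measurable)
      hθ.measurable
    rw [hθ.map_eq] at h
    exact h.symm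
  have himg : sweptSet s I (n + c) = ψ '' (I ×ˢ (param p b ⁻¹' s)) := by
    ext y
    constructor
    · rintro ⟨x, hx, r, hr, rfl⟩
      obtain ⟨u, rfl⟩ := hs hx
      exact ⟨(r, u), ⟨hr, hx⟩, rfl⟩
    · rintro ⟨⟨r, u⟩, ⟨hr, hu⟩, rfl⟩
      exact ⟨_, hu, r, hr, rfl⟩
  have hsub : sweptSet s I (n + c) ⊆ Set.range (param p (Fin.cons n b : Fin (k + 1) → R4)) := by
    rw [himg, hψ]
    rintro _ ⟨q, _, rfl⟩
    exact ⟨_, rfl⟩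
  rw [← Measure.restrict_restrict_of_subset hsub, ← hmap, hψe.restrict_map, himg,
    hψi.preimage_image, ← Measure.prod_restrict, restrict_eq_map_param hb' hs]
  have h1 : (volume.restrict I) = Measure.map id (volume.restrict I) := by simp
  conv_lhs => rw [h1]
  rw [Measure.map_prod_map _ _ measurable_id (continuous_param p b).measurable,
    Measure.map_map (by fun_prop) (measurable_id.prodMap (continuous_param p b).measurable)]
  rfl

lemma measure_sweptSet {k : ℕ} {p n c : R4} {b : Fin k → R4}
    (hb : Orthonormal ℝ (Fin.cons n b : Fin (k + 1) → R4))
    (hc : c ∈ Submodule.span ℝ (Set.range b)) {s : Set R4}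
    (hs : s ⊆ Set.range (param p b)) (I : Set ℝ) :
    μHE[k + 1] (sweptSet s I (n + c)) = volume I * μHE[k] s := by
  have h := congrArg (fun μ => μ Set.univ) (map_sweep hb hc hs I)
  simp only at h
  rw [Measure.map_apply (by fun_prop) MeasurableSet.univ, Set.preimage_univ, ← Set.univ_prod_univ,
    restrict_eq_map_param (orthonormal_tail hb) hs, Measure.prod_prod] at h
  simp only [Measure.restrict_apply_univ] at h
  rw [← h, Measure.map_apply (continuous_param _ _).measurable MeasurableSet.univ,
    measure_param (orthonormal_tail hb) hs]
  simp

instance Cell.isFiniteMeasure_restrict {k : ℕ} (σ : Cell k) :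
    IsFiniteMeasure ((μHE[k]).restrict σ.carrier) := ⟨by simpa using σ.measure_lt_top⟩

lemma Cell.integrable_prod {k : ℕ} (σ : Cell k) {I : Set ℝ} (hI : Bornology.IsBounded I)
    (hIm : MeasurableSet I) {F : ℝ × R4 → ℝ} (hF : Continuous F) :
    Integrable F ((volume.restrict I).prod ((μHE[k]).restrict σ.carrier)) := by
  have : IsFiniteMeasure (volume.restrict I) := ⟨by simpa using hI.measure_lt_top⟩
  obtain ⟨C, hC⟩ := (hI.isCompact_closure.prod
    σ.bounded.isCompact_closure).exists_bound_of_continuousOn hF.continuousOn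
  refine Integrable.of_bound hF.aestronglyMeasurable C ?_
  have h1 : ∀ᵐ q ∂((volume.restrict I).prod ((μHE[k]).restrict σ.carrier)), q.1 ∈ I :=
    Measure.quasiMeasurePreserving_fst.ae (ae_restrict_mem hIm)
  have h2 : ∀ᵐ q ∂((volume.restrict I).prod ((μHE[k]).restrict σ.carrier)), q.2 ∈ σ.carrier :=
    Measure.quasiMeasurePreserving_snd.ae (ae_restrict_mem σ.measurableSet)
  filter_upwards [h1, h2] with q hq1 hq2
  exact hC q ⟨subset_closure hq1, subset_closure hq2⟩

lemma integral_sweptSet {k : ℕ} {n c : R4} (σ : Cell k)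
    (hb : Orthonormal ℝ (Fin.cons n σ.frame : Fin (k + 1) → R4))
    (hc : c ∈ Submodule.span ℝ (Set.range σ.frame)) {I : Set ℝ} (hI : Bornology.IsBounded I)
    (hIm : MeasurableSet I) {F : R4 → ℝ} (hF : Continuous F) :
    ∫ y in sweptSet σ.carrier I (n + c), F y ∂μHE[k + 1] =
      ∫ x in σ.carrier, (∫ r in I, F (x + r • (n + c))) ∂μHE[k] := by
  obtain ⟨p, hp⟩ := σ.nonempty
  have hm : Continuous fun q : ℝ × R4 => q.2 + q.1 • (n + c) := by fun_prop
  rw [← map_sweep hb hc (σ.subset_range hp) I, integral_map hm.aemeasurable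
    hF.aestronglyMeasurable, integral_prod_symm]
  exact σ.integrable_prod hI hIm (hF.comp hm)

lemma inner_eq_zero_of_mem_span {k : ℕ} {n c : R4} {b : Fin k → R4}
    (hb : Orthonormal ℝ (Fin.cons n b : Fin (k + 1) → R4))
    (hc : c ∈ Submodule.span ℝ (Set.range b)) : inner ℝ n c = 0 := by
  have h := (orthonormal_vecCons_iff.1 hb).2.1
  induction hc using Submodule.span_induction with
  | mem x hx => obtain ⟨i, rfl⟩ := hx; exact h i
  | zero => simp
  | add x y _ _ hx hy => rw [inner_add_right, hx, hy, add_zero]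
  | smul a x _ hx => rw [inner_smul_right, hx, mul_zero]

lemma span_range_cons {k : ℕ} (n : R4) (b : Fin k → R4) :
    Submodule.span ℝ (Set.range (Fin.cons n b : Fin (k + 1) → R4)) =
      Submodule.span ℝ {n} ⊔ Submodule.span ℝ (Set.range b) := by
  rw [Fin.range_cons, Submodule.span_insert]

/-- The oblique prism swept out by a cell. -/
def Cell.swept {k : ℕ} (σ : Cell k) (n c : R4)
    (hb : Orthonormal ℝ (Fin.cons n σ.frame : Fin (k + 1) → R4))
    (hc : c ∈ Submodule.span ℝ (Set.range σ.frame)) (α : ℝ) (hα : 0 < α) : Cell (k + 1) where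
  carrier := sweptSet σ.carrier (Set.Ioo 0 α) (n + c)
  frame := Fin.cons n σ.frame
  orthonormal := hb
  halfSpaces := by
    classical
    obtain ⟨p, H, hH⟩ := σ.halfSpaces
    have hn : inner ℝ n n = (1 : ℝ) := by
      rw [real_inner_self_eq_norm_sq, (orthonormal_vecCons_iff.1 hb).1, one_pow]
    have hnc : inner ℝ n c = 0 := inner_eq_zero_of_mem_span hb hc
    -- The first two half spaces confine the height `⟪n, y - p⟫` to `(0, α)`. Each old half space is
    -- transported along `n + c`: it holds at `y` when the original holds at the foot `y - ⟪n, y -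
    -- p⟫ (n + c)`.
    refine ⟨p, insert (-n, -inner ℝ n p) (insert (n, inner ℝ n p + α)
      (H.image fun h => (h.1 - (inner ℝ h.1 (n + c) : ℝ) • n,
        h.2 - inner ℝ h.1 (n + c) * inner ℝ n p))), ?_⟩
    have key : ∀ (h : R4 × ℝ) (y : R4), (inner ℝ (h.1 - (inner ℝ h.1 (n + c) : ℝ) • n) y <
        h.2 - inner ℝ h.1 (n + c) * inner ℝ n p ↔
        inner ℝ h.1 (y - (inner ℝ n (y - p) : ℝ) • (n + c)) < h.2) := fun h y => by
      rw [inner_sub_left, inner_smul_left, inner_sub_right (h.1) y, inner_smul_right,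
        inner_sub_right n]
      simp only [conj_trivial]
      constructor <;> intro h <;> nlinarith
    ext y
    simp only [Finset.forall_mem_insert, Finset.forall_mem_image, Set.mem_ofPred_eq, key]
    constructor
    · rintro ⟨x, hx, r, hr, rfl⟩
      rw [hH] at hx
      have hx0 : inner ℝ n (x - p) = 0 := inner_eq_zero_of_mem_span hb hx.1
      have hr' : inner ℝ n (x + r • (n + c) - p) = r := by
        rw [add_sub_right_comm, inner_add_right, inner_smul_right, inner_add_right, hx0, hn, hnc]
        ring
      refine ⟨?_, ?_, ?_, ?_⟩
      · rw [span_range_cons, add_sub_right_comm, smul_add, add_left_comm]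
        refine Submodule.add_mem_sup (Submodule.smul_mem _ _ (Submodule.mem_span_singleton_self n))
          (Submodule.add_mem _ hx.1 (Submodule.smul_mem _ _ hc))
      · rw [inner_neg_left]
        rw [inner_sub_right] at hr'
        linarith [hr.1]
      · rw [inner_sub_right] at hr'
        linarith [hr.2]
      · intro h hh
        rw [hr', add_sub_cancel_right]
        exact hx.2 h hh
    · rintro ⟨h1, h2, h3, h4⟩
      refine ⟨y - (inner ℝ n (y - p) : ℝ) • (n + c), ?_, inner ℝ n (y - p), ?_, by abel⟩
      · rw [hH]
        refine ⟨?_, h4⟩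
        rw [span_range_cons] at h1
        obtain ⟨_, hs, z, hz, hsz⟩ := Submodule.mem_sup.1 h1
        obtain ⟨s, rfl⟩ := Submodule.mem_span_singleton.1 hs
        have hz0 : inner ℝ n z = 0 := inner_eq_zero_of_mem_span hb hz
        have h5 : inner ℝ n (y - p) = s := by
          rw [← hsz, inner_add_right, inner_smul_right, hn, hz0]; ring
        have h6 : y - (inner ℝ n (y - p) : ℝ) • (n + c) - p = z - s • c := by
          rw [h5, sub_right_comm, ← hsz, smul_add]; abel
        rw [h6]
        exact Submodule.sub_mem _ hz (Submodule.smul_mem _ _ hc)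
      · rw [inner_neg_left] at h2
        rw [inner_sub_right]
        exact ⟨by linarith, by linarith⟩
  nonempty := by
    obtain ⟨x, hx⟩ := σ.nonempty
    exact ⟨_, x, hx, α / 2, ⟨by positivity, by linarith⟩, rfl⟩
  bounded := by
    have h : IsCompact ((fun q : R4 × ℝ => q.1 + q.2 • (n + c)) ''
        (closure σ.carrier ×ˢ Set.Icc 0 α)) :=
      (σ.bounded.isCompact_closure.prod isCompact_Icc).image (by fun_prop)
    refine h.isBounded.subset ?_
    rintro _ ⟨x, hx, r, hr, rfl⟩
    exact ⟨(x, r), ⟨subset_closure hx, Set.Ioo_subset_Icc_self hr⟩, rfl⟩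

lemma Cell.mass_swept {k : ℕ} (σ : Cell k) {n c : R4}
    (hb : Orthonormal ℝ (Fin.cons n σ.frame : Fin (k + 1) → R4))
    (hc : c ∈ Submodule.span ℝ (Set.range σ.frame)) {α : ℝ} (hα : 0 < α) :
    (σ.swept n c hb hc α hα).mass = α * σ.mass := by
  obtain ⟨p, hp⟩ := σ.nonempty
  change (μHE[k + 1] (sweptSet σ.carrier (Set.Ioo 0 α) (n + c))).toReal = _
  rw [measure_sweptSet hb hc (σ.subset_range hp), ENNReal.toReal_mul]
  simp [Cell.mass, hα.le]

lemma apply_cons_smul {k : ℕ} (f : R4 [⋀^Fin (k + 1)]→L[ℝ] ℝ) (r : ℝ) (w : R4)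
    (b : Fin k → R4) : f (Fin.cons (r • w) b : Fin (k + 1) → R4) =
      r * f (Fin.cons w b : Fin (k + 1) → R4) := by
  have := congrArg (fun g => g b) (f.curryLeft.map_smul r w)
  exact this

lemma apply_cons_add {k : ℕ} (f : R4 [⋀^Fin (k + 1)]→L[ℝ] ℝ) (v w : R4)
    (b : Fin k → R4) : f (Fin.cons (v + w) b : Fin (k + 1) → R4) =
      f (Fin.cons v b : Fin (k + 1) → R4) + f (Fin.cons w b : Fin (k + 1) → R4) := by
  have := congrArg (fun g => g b) (f.curryLeft.map_add v w)
  exact this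

/-- An alternating map vanishes on dependent vectors; hence only the normal part of a sweeping
direction contributes to the swept chain. -/
lemma apply_cons_of_mem_span {k : ℕ} (f : R4 [⋀^Fin (k + 1)]→L[ℝ] ℝ) {c : R4}
    {b : Fin k → R4} (hc : c ∈ Submodule.span ℝ (Set.range b)) :
    f (Fin.cons c b : Fin (k + 1) → R4) = 0 := by
  refine f.toAlternatingMap.map_linearDependent _ fun h => ?_
  exact (linearIndependent_finCons.1 h).2 hc

lemma Form.sweep_smul_apply {k : ℕ} (ω : Form (k + 1)) (r : ℝ) (w x : R4) (b : Fin k → R4) :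
    (ω.sweep (r • w)).1 x b =
      ∫ s in (0 : ℝ)..r, ω.1 (x + s • w) (Fin.cons w b : Fin (k + 1) → R4) := by
  rw [Form.sweep_apply]
  simp_rw [apply_cons_smul, smul_smul]
  rw [intervalIntegral.integral_const_mul]
  refine (intervalIntegral.mul_integral_comp_mul_right
    (f := fun s => ω.1 (x + s • w) (Fin.cons w b : Fin (k + 1) → R4)) (c := r)).trans ?_
  rw [zero_mul, one_mul]

/-- Fubini reduces the prism to a line integral over each base point, and replacing `n` by `n + c`
in the first slot adds only a degenerate term. -/
lemma Cell.toCurrent_swept {k : ℕ} (σ : Cell k) {n c : R4}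
    (hb : Orthonormal ℝ (Fin.cons n σ.frame : Fin (k + 1) → R4))
    (hc : c ∈ Submodule.span ℝ (Set.range σ.frame)) {α : ℝ} (hα : 0 < α) (ω : Form (k + 1)) :
    (σ.swept n c hb hc α hα).toCurrent ω = σ.toCurrent (ω.sweep (α • (n + c))) := by
  rw [toCurrent_apply, toCurrent_apply]
  simp_rw [Form.sweep_smul_apply]
  change ∫ y in sweptSet σ.carrier (Set.Ioo 0 α) (n + c),
    ω.1 y (Fin.cons n σ.frame : Fin (k + 1) → R4) ∂μHE[k + 1] = _
  rw [integral_sweptSet σ hb hc (Metric.isBounded_Ioo 0 α) measurableSet_Ioo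
    (ω.continuous_apply _)]
  congr 1
  funext x
  rw [intervalIntegral.integral_of_le hα.le, integral_Ioc_eq_integral_Ioo]
  congr 1
  funext r
  rw [apply_cons_add, apply_cons_of_mem_span _ hc, add_zero]

/-- The chain swept out by `A` along the segment `[0, w]`. -/
def sweep {k : ℕ} (w : R4) (A : Current k) : Current (k + 1) := fun ω => A (ω.sweep w)

lemma Cell.sweep_eq_zero {k : ℕ} (σ : Cell k) {w : R4}
    (hw : w ∈ Submodule.span ℝ (Set.range σ.frame)) : sweep w σ.toCurrent = 0 := by
  funext ω
  simp only [sweep, toCurrent_apply, Form.sweep_apply]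
  simp [apply_cons_of_mem_span _ hw]

/-- Split `w` into its normal part `z ≠ 0` and its projection to the plane. After scaling by `‖z‖⁻¹`
the swept chain is an oblique prism of height `‖z‖ ≤ ‖w‖`. -/
lemma Cell.exists_sweep_eq {k : ℕ} (σ : Cell k) {w : R4}
    (hw : w ∉ Submodule.span ℝ (Set.range σ.frame)) : ∃ σ' : Cell (k + 1),
      sweep w σ.toCurrent = σ'.toCurrent ∧ σ'.mass ≤ ‖w‖ * σ.mass ∧
      σ'.carrier = sweptSet σ.carrier (Set.Ioo 0 1) w := by
  set K := Submodule.span ℝ (Set.range σ.frame) with hK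
  set z := w - K.starProjection w with hz
  have hz0 : z ≠ 0 := fun h => hw (by
    rw [← Submodule.starProjection_eq_self_iff]
    exact (sub_eq_zero.1 h).symm)
  have hα : 0 < ‖z‖ := norm_pos_iff.2 hz0
  have hzK : z ∈ Kᗮ := Submodule.sub_starProjection_mem_orthogonal w
  have hb : Orthonormal ℝ (Fin.cons (‖z‖⁻¹ • z) σ.frame : Fin (k + 1) → R4) := by
    refine orthonormal_vecCons_iff.2 ⟨?_, fun i => ?_, σ.orthonormal⟩
    · rw [norm_smul, norm_inv, norm_norm, inv_mul_cancel₀ hα.ne']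
    · rw [inner_smul_left, Submodule.inner_left_of_mem_orthogonal
        (K := K) (Submodule.subset_span (Set.mem_range_self i)) hzK, mul_zero]
  have hc : ‖z‖⁻¹ • K.starProjection w ∈ K :=
    Submodule.smul_mem _ _ (Submodule.starProjection_apply_mem K w)
  have hw' : ‖z‖ • (‖z‖⁻¹ • z + ‖z‖⁻¹ • K.starProjection w) = w := by
    rw [← smul_add, smul_smul, mul_inv_cancel₀ hα.ne', one_smul, hz, sub_add_cancel]
  refine ⟨σ.swept _ _ hb hc ‖z‖ hα, ?_, ?_, ?_⟩
  · funext ω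
    rw [σ.toCurrent_swept hb hc hα, hw']
    rfl
  · rw [σ.mass_swept hb hc hα]
    refine mul_le_mul_of_nonneg_right ?_ σ.mass_nonneg
    have h1 := Submodule.norm_sq_eq_add_norm_sq_starProjection w K
    have h2 : Kᗮ.starProjection w = z := by
      rw [Submodule.starProjection_orthogonal_val]
    rw [h2] at h1
    exact le_of_sq_le_sq (by nlinarith [sq_nonneg ‖K.starProjection w‖]) (norm_nonneg _)
  · change sweptSet σ.carrier (Set.Ioo 0 ‖z‖) _ = _
    ext y
    constructor
    · rintro ⟨x, hx, r, hr, rfl⟩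
      refine ⟨x, hx, r / ‖z‖, ⟨div_pos hr.1 hα, (div_lt_one hα).2 hr.2⟩, ?_⟩
      conv_rhs => rw [← hw', smul_smul, div_mul_cancel₀ _ hα.ne']
    · rintro ⟨x, hx, r, hr, rfl⟩
      refine ⟨x, hx, r * ‖z‖, ⟨mul_pos hr.1 hα, mul_lt_of_lt_one_left hα hr.2⟩, ?_⟩
      conv_lhs => rw [← hw', smul_smul]

/-! ### Mass cells -/

lemma norm_e4 : ‖e4‖ = 1 := by simp [e4]

lemma inner_e4 (x : R4) : inner ℝ e4 x = x 3 := by simp [e4, EuclideanSpace.inner_single_left]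

lemma Cell.exists_add_smul_mem {k : ℕ} (σ : Cell k) {p v : R4} (hp : p ∈ σ.carrier)
    (hv : v ∈ Submodule.span ℝ (Set.range σ.frame)) : ∃ ε : ℝ, 0 < ε ∧ p + ε • v ∈ σ.carrier := by
  obtain ⟨β, hβ⟩ := (Submodule.mem_span_range_iff_exists_fun ℝ).1 hv
  have h0 : (0 : Fin k → ℝ) ∈ param p σ.frame ⁻¹' σ.carrier := by simpa [param] using hp
  have hc : ContinuousAt (fun t : ℝ => t • β) 0 := by fun_prop
  have h1 : ∀ᶠ t : ℝ in 𝓝 0, t • β ∈ param p σ.frame ⁻¹' σ.carrier :=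
    hc.eventually_mem (by simpa using (σ.isOpen_preimage hp).mem_nhds h0)
  obtain ⟨ε, hε, h⟩ := ((h1.filter_mono nhdsWithin_le_nhds).and
    (self_mem_nhdsWithin : Set.Ioi (0 : ℝ) ∈ 𝓝[>] 0)).exists
  refine ⟨ε, h, ?_⟩
  have : param p σ.frame (ε • β) = p + ε • v := by
    simp [param, ← hβ, Finset.smul_sum, smul_smul]
  rw [← this]
  exact hε

/-- A cell is relatively open in its plane, so a short step from one of its points in any direction
of the plane stays in the cell, hence in `ℝ³`. -/
lemma Cell.InR3.apply_eq_zero {k : ℕ} {σ : Cell k} (h : σ.InR3) {v : R4}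
    (hv : v ∈ Submodule.span ℝ (Set.range σ.frame)) : v 3 = 0 := by
  obtain ⟨p, hp⟩ := σ.nonempty
  obtain ⟨ε, hε, h1⟩ := σ.exists_add_smul_mem hp hv
  have h2 := h _ h1
  have h3 := h _ hp
  simp [h3] at h2
  exact h2.resolve_left hε.ne'

lemma Cell.InR3.orthonormal {k : ℕ} {σ : Cell k} (h : σ.InR3) :
    Orthonormal ℝ (Fin.cons e4 σ.frame : Fin (k + 1) → R4) := by
  refine orthonormal_vecCons_iff.2 ⟨norm_e4, fun i => ?_, σ.orthonormal⟩
  rw [inner_e4]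
  exact h.apply_eq_zero (Submodule.subset_span (Set.mem_range_self i))

lemma prism_eq_sweep {k : ℕ} {τ : Cell k} (h : τ.InR3) {t : ℝ} (ht : 0 < t) :
    prism τ t = sweep (t • e4) τ.toCurrent := by
  funext ω
  have h0 : (0 : R4) ∈ Submodule.span ℝ (Set.range τ.frame) := Submodule.zero_mem _
  have h1 := integral_sweptSet τ h.orthonormal h0 (Metric.isBounded_Icc 0 t) measurableSet_Icc
    (ω.continuous_apply (Fin.cons e4 τ.frame : Fin (k + 1) → R4))
  rw [add_zero] at h1
  refine h1.trans ?_
  change _ = ∫ x in τ.carrier, (ω.sweep (t • e4)).1 x τ.frame ∂μHE[k]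
  simp_rw [Form.sweep_smul_apply]
  congr 1
  funext x
  rw [intervalIntegral.integral_of_le ht.le, integral_Icc_eq_integral_Ioc]

lemma Cell.InR3.exists_prism {k : ℕ} {τ : Cell k} (h : τ.InR3) {t : ℝ} (ht : 0 < t) :
    ∃ σ : Cell (k + 1), σ.toCurrent = sweep (t • e4) τ.toCurrent ∧ σ.mass = t * τ.mass := by
  have h0 : (0 : R4) ∈ Submodule.span ℝ (Set.range τ.frame) := Submodule.zero_mem _
  refine ⟨τ.swept e4 0 h.orthonormal h0 t ht, ?_, τ.mass_swept _ _ _⟩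
  funext ω
  rw [τ.toCurrent_swept, add_zero]
  rfl

/-- The segment `[0, m w]` is cut into `m` translates of `[0, w]`. -/
lemma Cell.sweep_nsmul {k : ℕ} (σ : Cell k) (w : R4) (m : ℕ) :
    sweep ((m : ℝ) • w) σ.toCurrent =
      ∑ i ∈ Finset.range m, translate ((i : ℝ) • w) (sweep w σ.toCurrent) := by
  induction m with
  | zero =>
    funext ω
    have h0 : σ.toCurrent (ω.sweep 0) = 0 :=
      congrFun (σ.sweep_eq_zero (Submodule.zero_mem _)) ω
    simp [sweep, h0]
  | succ m ih =>
    rw [Finset.sum_range_succ, ← ih]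
    funext ω
    change ∫ x in σ.carrier, (ω.sweep (((m + 1 : ℕ) : ℝ) • w)).1 x σ.frame ∂μHE[k] =
      ∫ x in σ.carrier, (ω.sweep ((m : ℝ) • w)).1 x σ.frame ∂μHE[k] +
      ∫ x in σ.carrier, ((ω.translate ((m : ℝ) • w)).sweep w).1 x σ.frame ∂μHE[k]
    rw [← integral_add (σ.integrableOn_form _ _) (σ.integrableOn_form _ _)]
    congr 1
    funext x
    have hw : w = (1 : ℝ) • w := (one_smul _ _).symm
    have h1 : ((ω.translate ((m : ℝ) • w)).sweep w).1 x σ.frame = ∫ s in (0 : ℝ)..1,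
        ω.1 (x + (s + m) • w) (Fin.cons w σ.frame : Fin (k + 1) → R4) := by
      rw [Form.sweep_apply]
      congr 1
      funext s
      change ω.1 (x + s • w + (m : ℝ) • w) _ = _
      rw [add_smul, add_assoc]
    rw [h1, Form.sweep_smul_apply, Form.sweep_smul_apply]
    have h2 := intervalIntegral.integral_comp_add_right (a := 0) (b := 1)
      (fun s : ℝ => ω.1 (x + s • w) (Fin.cons w σ.frame : Fin (k + 1) → R4)) (m : ℝ)
    rw [h2, zero_add, intervalIntegral.integral_add_adjacent_intervals]
    · push_cast
      rw [add_comm (1 : ℝ)]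
    all_goals
      exact ((ω.continuous_apply _).comp (by fun_prop)).intervalIntegrable _ _

lemma polyMass_nonneg {k : ℕ} (P : Current k) : 0 ≤ polyMass P := by
  refine Real.sInf_nonneg ?_
  rintro w ⟨N, a, σ, -, -, rfl⟩
  exact Finset.sum_nonneg fun i _ => mul_nonneg (abs_nonneg _) (σ i).mass_nonneg

lemma polyMass_zero {k : ℕ} : polyMass (0 : Current k) = 0 := by
  refine le_antisymm (csInf_le ⟨0, ?_⟩ ?_) (polyMass_nonneg _)
  · rintro w ⟨N, a, σ, -, -, rfl⟩
    exact Finset.sum_nonneg fun i _ => mul_nonneg (abs_nonneg _) (σ i).mass_nonneg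
  · exact ⟨0, Fin.elim0, Fin.elim0, fun i => i.elim0, by simp, by simp⟩

/-- Differences of a cell and its translates are small in the `1`-natural norm. -/
lemma natNorm_one_le {k N : ℕ} (a : Fin N → ℤ) (σ : Fin N → Cell k) (v : Fin N → R4) :
    natNorm 1 (∑ i, a i • ((σ i).toCurrent - translate (v i) (σ i).toCurrent)) ≤
      ∑ i, |(a i : ℝ)| * ((σ i).mass * ‖v i‖) := by
  rw [natNorm]
  refine csInf_le ⟨0, ?_⟩ ?_
  · rintro w ⟨N, a, σ, v, C, -, -, -, rfl⟩
    refine add_nonneg (Finset.sum_nonneg fun i _ => mul_nonneg (abs_nonneg _)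
      (mul_nonneg (σ i).mass_nonneg (List.prod_nonneg ?_))) ?_
    · intro r hr
      obtain ⟨u, -, rfl⟩ := List.mem_map.1 hr
      exact norm_nonneg u
    · rw [natNorm]
      exact polyMass_nonneg _
  · refine ⟨N, a, σ, fun i => [v i], 0, AddSubgroup.zero_mem _, fun i => le_rfl, ?_, ?_⟩
    · have : bdry (0 : Current (k + 1)) = 0 := rfl
      rw [this, add_zero]
      rfl
    · rw [natNorm, polyMass_zero]
      simp

/-- The functional of the mass cell of a chain: contraction with `e₄`. -/
def massOf {k : ℕ} (A : Current k) : Current (k + 1) := fun ω => A (ω.interior e4)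

/-- Dominated convergence; the bound `‖w j‖ ≤ 1` keeps all the evaluation points in one compact set.
-/
lemma tendsto_average {k : ℕ} (σ : Cell k) (ω : Form k) {w : ℕ → R4}
    (hw : Tendsto w atTop (𝓝 0)) (hw1 : ∀ j, ‖w j‖ ≤ 1) :
    Tendsto (fun j => σ.toCurrent (ω.average (w j))) atTop (𝓝 (σ.toCurrent ω)) := by
  simp only [Cell.toCurrent_apply]
  have hcomp : IsCompact ((fun q : R4 × ℝ × R4 => q.1 + q.2.1 • q.2.2) ''
      (closure σ.carrier ×ˢ Set.Icc (0 : ℝ) 1 ×ˢ Metric.closedBall 0 1)) :=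
    (σ.bounded.isCompact_closure.prod (isCompact_Icc.prod (isCompact_closedBall _ _))).image
      (by fun_prop)
  obtain ⟨C, hC⟩ := hcomp.exists_bound_of_continuousOn (ω.continuous_apply σ.frame).continuousOn
  refine tendsto_integral_of_dominated_convergence (fun _ => C)
    (fun j => ((ω.average (w j)).continuous_apply _).aestronglyMeasurable) (integrable_const C)
    (fun j => ?_) (Eventually.of_forall fun x => ?_)
  · refine (ae_restrict_iff' σ.measurableSet).2 (Eventually.of_forall fun x hx => ?_)
    rw [Form.average_apply]
    refine (intervalIntegral.norm_integral_le_of_norm_le_const (C := C) fun t ht => ?_).trans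
      (by simp)
    rw [Set.uIoc_of_le zero_le_one] at ht
    exact hC _ ⟨(x, t, w j), ⟨subset_closure hx, ⟨ht.1.le, ht.2⟩, by simpa using hw1 j⟩, rfl⟩
  · simp_rw [Form.average_apply]
    have hc : Continuous fun u : R4 => ∫ t in (0 : ℝ)..1, ω.1 (x + t • u) σ.frame := by
      refine intervalIntegral.continuous_parametric_intervalIntegral_of_continuous' ?_ _ _
      exact (ω.continuous_apply σ.frame).comp (by fun_prop)
    have := (hc.tendsto 0).comp hw
    simpa [Function.comp_def] using this

lemma sweep_smul_eq {k : ℕ} (σ : Cell k) {t : ℝ} (w : R4) (ω : Form (k + 1)) :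
    sweep (t • w) σ.toCurrent ω = t * σ.toCurrent ((ω.interior w).average (t • w)) := by
  simp only [sweep, Cell.toCurrent_apply]
  rw [← integral_const_mul]
  congr 1
  funext x
  rw [Form.sweep_apply, Form.average_apply, ← intervalIntegral.integral_const_mul]
  congr 1
  funext s
  rw [apply_cons_smul]
  rfl

lemma tendsto_two_pow_inv : Tendsto (fun j : ℕ => ((2 : ℝ) ^ j)⁻¹) atTop (𝓝 0) :=
  tendsto_inv_atTop_zero.comp (tendsto_pow_atTop_atTop_of_one_lt (one_lt_two : (1 : ℝ) < 2))

/-- The factor `2ʲ` cancels the length of the sweeping vector, leaving the average of the contracted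
form over a segment that shrinks to a point. -/
lemma tendsto_prism {k : ℕ} {τ : Cell k} (h : τ.InR3) (ω : Form (k + 1)) :
    Tendsto (fun j : ℕ => ((2 ^ j : ℤ) • prism τ ((2 : ℝ) ^ j)⁻¹) ω) atTop
      (𝓝 (massOf τ.toCurrent ω)) := by
  have hw : Tendsto (fun j : ℕ => ((2 : ℝ) ^ j)⁻¹ • e4) atTop (𝓝 0) := by
    simpa using tendsto_two_pow_inv.smul_const e4
  have hw1 : ∀ j : ℕ, ‖((2 : ℝ) ^ j)⁻¹ • e4‖ ≤ 1 := fun j => by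
    rw [norm_smul, norm_e4, mul_one, norm_inv, norm_pow, Real.norm_ofNat]
    exact inv_le_one_of_one_le₀ (one_le_pow₀ one_le_two)
  refine (tendsto_average τ (ω.interior e4) hw hw1).congr fun j => ?_
  have hp : (0 : ℝ) < (2 : ℝ) ^ j := by positivity
  rw [prism_eq_sweep h (inv_pos.2 hp), Pi.smul_apply, sweep_smul_eq, zsmul_eq_mul]
  push_cast
  rw [mul_inv_cancel_left₀ hp.ne']

/-- The prism of height `2⁻ⁱ` is a stack of `2ⁿ` translates of a thin prism of height `2^{-(i+n)}`,
so the difference is a sum of `2ⁿ` terms "thin prism minus translate" with coefficients `±2ⁱ`.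
Displacements are at most `2⁻ⁱ`, and each term costs at most `2^{-(i+n)} M(τ)`. The sign `e` lets
one estimate serve both orders of subtraction. -/
lemma natNorm_prism_sub_le {k : ℕ} {τ : Cell k} (h : τ.InR3) (i n : ℕ) (e : ℤ) (he : |e| = 1) :
    natNorm 1 (e • ((2 ^ i : ℤ) • prism τ ((2 : ℝ) ^ i)⁻¹ -
      (2 ^ (i + n) : ℤ) • prism τ ((2 : ℝ) ^ (i + n))⁻¹)) ≤ τ.mass * ((2 : ℝ) ^ i)⁻¹ := by
  have hp : (0 : ℝ) < (2 : ℝ) ^ i := by positivity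
  have hq : (0 : ℝ) < (2 : ℝ) ^ (i + n) := by positivity
  obtain ⟨σ, hσ, hm⟩ := h.exists_prism (inv_pos.2 hq)
  have h1 : prism τ ((2 : ℝ) ^ i)⁻¹ = ∑ m : Fin (2 ^ n),
      translate (((m : ℕ) : ℝ) • ((2 : ℝ) ^ (i + n))⁻¹ • e4) σ.toCurrent := by
    rw [prism_eq_sweep h (inv_pos.2 hp), hσ, Fin.sum_univ_eq_sum_range
      (fun m => translate ((m : ℝ) • ((2 : ℝ) ^ (i + n))⁻¹ • e4)
        (sweep (((2 : ℝ) ^ (i + n))⁻¹ • e4) τ.toCurrent)), ← Cell.sweep_nsmul, smul_smul]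
    congr 2
    push_cast
    rw [pow_add]
    field_simp
  have h2 : e • ((2 ^ i : ℤ) • prism τ ((2 : ℝ) ^ i)⁻¹ -
      (2 ^ (i + n) : ℤ) • prism τ ((2 : ℝ) ^ (i + n))⁻¹) =
      ∑ m : Fin (2 ^ n), (-e * 2 ^ i : ℤ) • (σ.toCurrent -
        translate (((m : ℕ) : ℝ) • ((2 : ℝ) ^ (i + n))⁻¹ • e4) σ.toCurrent) := by
    rw [h1, prism_eq_sweep h (inv_pos.2 hq), ← hσ, ← Finset.smul_sum, Finset.sum_sub_distrib]
    simp only [Finset.sum_const, Finset.card_univ, Fintype.card_fin, smul_sub]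
    rw [← natCast_zsmul, smul_smul, smul_smul, smul_smul]
    push_cast
    rw [pow_add]
    module
  rw [h2]
  refine (natNorm_one_le _ _ _).trans ?_
  have he' : |(e : ℝ)| = 1 := by exact_mod_cast he
  have h3 : ∀ m : Fin (2 ^ n), |((-e * 2 ^ i : ℤ) : ℝ)| *
      (σ.mass * ‖((m : ℕ) : ℝ) • ((2 : ℝ) ^ (i + n))⁻¹ • e4‖) ≤
        ((2 : ℝ) ^ (i + n))⁻¹ * τ.mass := fun m => by
    have hm1 : ((m : ℕ) : ℝ) ≤ 2 ^ n := by exact_mod_cast m.2.le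
    push_cast
    rw [abs_mul, abs_neg, he', norm_smul, norm_smul, norm_e4, hm, norm_inv,
      abs_of_pos hp, Real.norm_natCast, norm_pow, Real.norm_ofNat, one_mul, mul_one]
    calc (2 : ℝ) ^ i * (((2 : ℝ) ^ (i + n))⁻¹ * τ.mass * ((m : ℕ) * ((2 : ℝ) ^ (i + n))⁻¹))
        ≤ (2 : ℝ) ^ i * (((2 : ℝ) ^ (i + n))⁻¹ * τ.mass * (2 ^ n * ((2 : ℝ) ^ (i + n))⁻¹)) := by
          have := τ.mass_nonneg
          gcongr
      _ = ((2 : ℝ) ^ (i + n))⁻¹ * τ.mass := by rw [pow_add]; field_simp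
  refine (Finset.sum_le_sum fun m _ => h3 m).trans ?_
  rw [Finset.sum_const, Finset.card_univ, Fintype.card_fin, nsmul_eq_mul]
  push_cast
  rw [pow_add]
  apply le_of_eq
  field_simp

lemma isMassCell_massOf {k : ℕ} {τ : Cell k} (h : τ.InR3) :
    IsMassCell τ (massOf τ.toCurrent) := by
  refine ⟨h, fun ε hε => ?_, tendsto_prism h⟩
  have h1 : Tendsto (fun j : ℕ => τ.mass * ((2 : ℝ) ^ j)⁻¹) atTop (𝓝 (τ.mass * 0)) :=
    tendsto_two_pow_inv.const_mul _
  rw [mul_zero] at h1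
  obtain ⟨j₀, hj₀⟩ := eventually_atTop.1 (h1.eventually (gt_mem_nhds hε))
  refine ⟨j₀, fun i hi j hj => ?_⟩
  rcases le_total i j with hij | hij
  · obtain ⟨n, rfl⟩ := Nat.exists_eq_add_of_le hij
    have := natNorm_prism_sub_le h i n 1 (by simp)
    rw [one_smul] at this
    exact this.trans_lt (hj₀ i hi)
  · obtain ⟨n, rfl⟩ := Nat.exists_eq_add_of_le hij
    have := natNorm_prism_sub_le h j n (-1) (by simp)
    rw [neg_one_smul, neg_sub] at this
    exact this.trans_lt (hj₀ j hj)

/-- The Cauchy condition holds for every cell of `ℝ³` and limits of functionals are unique, so being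
a mass cell reduces to an explicit formula. -/
lemma isMassCell_iff {k : ℕ} {τ : Cell k} {m : Current (k + 1)} :
    IsMassCell τ m ↔ τ.InR3 ∧ m = massOf τ.toCurrent := by
  refine ⟨fun h => ⟨h.1, funext fun ω => ?_⟩, fun h => h.2 ▸ isMassCell_massOf h.1⟩
  exact tendsto_nhds_unique (h.2.2 ω) (tendsto_prism h.1 ω)

/-! ### Frames -/

lemma finrank_span_frame {k : ℕ} {b : Fin k → R4} (hb : Orthonormal ℝ b) :
    Module.finrank ℝ (Submodule.span ℝ (Set.range b)) = k := by
  rw [finrank_span_eq_card hb.linearIndependent, Fintype.card_fin]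

/-- An orthonormal frame as an orthonormal basis of its span `V`. -/
lemma exists_orthonormalBasis {k : ℕ} {b : Fin k → R4} (hb : Orthonormal ℝ b)
    {V : Submodule ℝ R4} (hV : Submodule.span ℝ (Set.range b) = V) :
    ∃ B : OrthonormalBasis (Fin k) ℝ V, ∀ i, (B i : R4) = b i := by
  have hmem : ∀ i, b i ∈ V := fun i => hV ▸ Submodule.subset_span (Set.mem_range_self i)
  let b' : Fin k → V := fun i => ⟨b i, hmem i⟩
  have hb' : Orthonormal ℝ b' := by
    rw [orthonormal_iff_ite] at hb ⊢
    exact hb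
  have hspan : ⊤ ≤ Submodule.span ℝ (Set.range b') := by
    intro x _
    have hx : (x : R4) ∈ Submodule.span ℝ (Set.range b) := hV ▸ x.2
    obtain ⟨β, hβ⟩ := (Submodule.mem_span_range_iff_exists_fun ℝ).1 hx
    refine (Submodule.mem_span_range_iff_exists_fun ℝ).2 ⟨β, Subtype.ext ?_⟩
    simpa [b'] using hβ
  exact ⟨OrthonormalBasis.mk hb' hspan, fun i => by simp [b']⟩

/-- Two orthonormal frames of the same plane differ by a sign on alternating maps. -/
lemma exists_sign_of_span_eq {k : ℕ} {b b' : Fin k → R4} (hb : Orthonormal ℝ b)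
    (hb' : Orthonormal ℝ b')
    (h : Submodule.span ℝ (Set.range b) = Submodule.span ℝ (Set.range b')) :
    ∃ e : ℤ, |e| = 1 ∧ ∀ f : R4 [⋀^Fin k]→L[ℝ] ℝ, f b = e * f b' := by
  obtain ⟨B, hB⟩ := exists_orthonormalBasis hb rfl
  obtain ⟨B', hB'⟩ := exists_orthonormalBasis hb' h.symm
  -- On the `k`-dimensional span an alternating `k`-form is a multiple of the determinant, and the
  -- determinant between two orthonormal bases is `±1`.
  have key : ∀ f : R4 [⋀^Fin k]→L[ℝ] ℝ, f b = B'.toBasis.det B * f b' := fun f => by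
    have h1 := AlternatingMap.eq_smul_basis_det B'.toBasis
      (f.toAlternatingMap.compLinearMap (Submodule.span ℝ (Set.range b)).subtype)
    have h2 := congrArg (fun g => g B) h1
    have h3 : (⇑(Submodule.span ℝ (Set.range b)).subtype ∘ ⇑B) = b := funext hB
    have h4 : (⇑(Submodule.span ℝ (Set.range b)).subtype ∘ ⇑B') = b' := funext hB'
    simp only [AlternatingMap.compLinearMap_apply, AlternatingMap.smul_apply, smul_eq_mul,
      OrthonormalBasis.coe_toBasis] at h2
    rw [mul_comm]
    have h5 : f b = f.toAlternatingMap (⇑(Submodule.span ℝ (Set.range b)).subtype ∘ ⇑B) := by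
      rw [h3]; rfl
    have h6 : f b' = f.toAlternatingMap (⇑(Submodule.span ℝ (Set.range b)).subtype ∘ ⇑B') := by
      rw [h4]; rfl
    rw [h5, h6]
    exact h2
  rcases B'.det_to_matrix_orthonormalBasis_real B with hd | hd
  · exact ⟨1, by simp, fun f => by rw [key, hd]; simp⟩
  · exact ⟨-1, by simp, fun f => by rw [key, hd]; simp⟩

/-- Any unit vector of a plane is the first vector of an orthonormal frame of the plane. -/
lemma exists_frame_cons {k : ℕ} {b : Fin (k + 1) → R4} (hb : Orthonormal ℝ b) {n : R4}
    (hn : n ∈ Submodule.span ℝ (Set.range b)) (hn1 : ‖n‖ = 1) :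
    ∃ f : Fin k → R4, Orthonormal ℝ (Fin.cons n f : Fin (k + 1) → R4) ∧
      Submodule.span ℝ (Set.range (Fin.cons n f : Fin (k + 1) → R4)) =
        Submodule.span ℝ (Set.range b) := by
  set V := Submodule.span ℝ (Set.range b) with hV
  have hle : Submodule.span ℝ {n} ≤ V := by simpa using hn
  have hn0 : n ≠ 0 := by rintro rfl; simp at hn1
  have h1 := Submodule.finrank_add_inf_finrank_orthogonal hle
  rw [finrank_span_singleton hn0, finrank_span_frame hb] at h1
  have h2 : Module.finrank ℝ ((Submodule.span ℝ {n})ᗮ ⊓ V : Submodule ℝ R4) = k := by omega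
  let B := (stdOrthonormalBasis ℝ ((Submodule.span ℝ {n})ᗮ ⊓ V : Submodule ℝ R4)).reindex
    (finCongr h2)
  have ho : Orthonormal ℝ (Fin.cons n (fun i => (B i : R4)) : Fin (k + 1) → R4) := by
    refine orthonormal_vecCons_iff.2 ⟨hn1, fun i => ?_, ?_⟩
    · exact Submodule.inner_right_of_mem_orthogonal (Submodule.mem_span_singleton_self n)
        (B i).2.1
    · have := B.orthonormal
      rw [orthonormal_iff_ite] at this ⊢
      exact this
  refine ⟨fun i => B i, ho, Submodule.eq_of_le_of_finrank_eq ?_ ?_⟩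
  · rw [Submodule.span_le]
    rintro _ ⟨i, rfl⟩
    refine Fin.cases ?_ (fun i => ?_) i
    · exact hn
    · exact (B i).2.2
  · rw [finrank_span_frame ho, finrank_span_frame hb]

/-- Normal form of a cell: the half spaces are given by unit vectors of the plane. -/
lemma Cell.exists_unit_halfSpaces {k : ℕ} (σ : Cell k) {p : R4} (hp : p ∈ σ.carrier) :
    ∃ H : Finset (R4 × ℝ),
      (∀ h ∈ H, h.1 ∈ Submodule.span ℝ (Set.range σ.frame) ∧ ‖h.1‖ = 1 ∧ 0 < h.2) ∧
      σ.carrier = {x | x - p ∈ Submodule.span ℝ (Set.range σ.frame) ∧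
        ∀ h ∈ H, inner ℝ h.1 (x - p) < h.2} := by
  classical
  obtain ⟨H, hH⟩ := σ.exists_halfSpaces hp
  set V := Submodule.span ℝ (Set.range σ.frame) with hV
  let π : R4 × ℝ → R4 := fun h => V.starProjection h.1
  have hπ : ∀ h : R4 × ℝ, ∀ x, x - p ∈ V → inner ℝ h.1 x = inner ℝ (π h) (x - p) +
      inner ℝ h.1 p := fun h x hx => by
    have := Submodule.starProjection_inner_eq_zero (K := V) h.1 _ hx
    rw [inner_sub_left, sub_eq_zero, inner_sub_right] at this
    simp only [π]
    linarith
  let φ : R4 × ℝ → R4 × ℝ := fun h => (‖π h‖⁻¹ • π h, ‖π h‖⁻¹ * (h.2 - inner ℝ h.1 p))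
  have hp2 := hp
  rw [hH] at hp2
  -- Normals are projected to the plane and normalized. A half space whose normal projects to zero
  -- contains the whole plane, as it contains `p`, and is dropped. The offsets are positive because
  -- `p` satisfies every inequality strictly.
  refine ⟨(H.filter fun h => π h ≠ 0).image φ, ?_, ?_⟩
  · simp only [Finset.forall_mem_image, Finset.mem_filter, φ]
    rintro h ⟨hh, h0⟩
    have h1 : 0 < ‖π h‖ := norm_pos_iff.2 h0
    refine ⟨Submodule.smul_mem _ _ (Submodule.starProjection_apply_mem V _), ?_, ?_⟩
    · rw [norm_smul, norm_inv, norm_norm, inv_mul_cancel₀ h1.ne']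
    · exact mul_pos (inv_pos.2 h1) (sub_pos.2 (hp2.2 h hh))
  · rw [hH]
    ext x
    simp only [Set.mem_ofPred_eq, Finset.forall_mem_image, Finset.mem_filter, φ]
    refine and_congr_right fun hx => ?_
    constructor
    · rintro hxH h ⟨hh, h0⟩
      have h1 : 0 < ‖π h‖ := norm_pos_iff.2 h0
      rw [inner_smul_left]
      refine mul_lt_mul_of_pos_left ?_ (inv_pos.2 h1)
      have := hxH h hh
      rw [hπ h x hx] at this
      linarith
    · intro hxH h hh
      rw [hπ h x hx]
      by_cases h0 : π h = 0
      · rw [h0, inner_zero_left, zero_add]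
        exact hp2.2 h hh
      · have h1 : 0 < ‖π h‖ := norm_pos_iff.2 h0
        have := hxH ⟨hh, h0⟩
        rw [inner_smul_left] at this
        have := lt_of_mul_lt_mul_left this (inv_pos.2 h1).le
        linarith

/-! ### The divergence theorem on cells -/

lemma differentiable_smoothTransition : Differentiable ℝ Real.smoothTransition :=
  (Real.smoothTransition.contDiff (n := 1)).differentiable one_ne_zero

lemma continuous_deriv_smoothTransition : Continuous (deriv Real.smoothTransition) :=
  (Real.smoothTransition.contDiff (n := 1)).continuous_deriv le_rfl

/-- Outside `(0, 1)`, endpoints included, the transition function attains its global minimum or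
maximum. -/
lemma deriv_smoothTransition_eq_zero {s : ℝ} (hs : s ∉ Set.Ioo (0 : ℝ) 1) :
    deriv Real.smoothTransition s = 0 := by
  rw [Set.mem_Ioo, not_and_or, not_lt, not_lt] at hs
  rcases hs with hs | hs
  · refine IsLocalMin.deriv_eq_zero (Eventually.of_forall fun t => ?_)
    rw [Real.smoothTransition.zero_of_nonpos hs]
    exact Real.smoothTransition.nonneg t
  · refine IsLocalMax.deriv_eq_zero (Eventually.of_forall fun t => ?_)
    rw [Real.smoothTransition.one_of_one_le hs]
    exact Real.smoothTransition.le_one t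

lemma exists_bound_deriv_smoothTransition :
    ∃ M : ℝ, 0 ≤ M ∧ ∀ s, |deriv Real.smoothTransition s| ≤ M := by
  obtain ⟨M, hM⟩ := (isCompact_Icc (a := (0 : ℝ)) (b := 1)).exists_bound_of_continuousOn
    continuous_deriv_smoothTransition.continuousOn
  refine ⟨|M|, abs_nonneg _, fun s => ?_⟩
  by_cases hs : s ∈ Set.Icc (0 : ℝ) 1
  · exact (hM s hs).trans (le_abs_self _)
  · rw [deriv_smoothTransition_eq_zero fun h => hs (Set.Ioo_subset_Icc_self h), abs_zero]
    exact abs_nonneg _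

lemma integral_deriv_smoothTransition : ∫ s, deriv Real.smoothTransition s = 1 := by
  rw [← setIntegral_eq_integral_of_forall_compl_eq_zero (s := Set.Ioc 0 1),
    ← intervalIntegral.integral_of_le zero_le_one, intervalIntegral.integral_deriv_eq_sub]
  · simp
  · exact fun s _ => differentiable_smoothTransition s
  · exact continuous_deriv_smoothTransition.intervalIntegrable _ _
  · exact fun s hs => deriv_smoothTransition_eq_zero fun h => hs (Set.Ioo_subset_Ioc_self h)

/-- The term `ε j * e` is the effect of moving a point by a multiple of `ε j` off a face. After
division it is bounded, so the sign of `d` alone decides the limit. -/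
lemma tendsto_smoothTransition_div {ε : ℕ → ℝ} (hε0 : ∀ j, 0 < ε j) (hε : Tendsto ε atTop (𝓝 0))
    {d : ℝ} (hd : d ≠ 0) (e : ℝ) :
    Tendsto (fun j => Real.smoothTransition ((d + ε j * e) / ε j)) atTop
      (𝓝 (if 0 < d then 1 else 0)) := by
  have hinv : Tendsto (fun j => (ε j)⁻¹) atTop atTop :=
    Tendsto.inv_tendsto_nhdsGT_zero
      (tendsto_nhdsWithin_iff.2 ⟨hε, Eventually.of_forall hε0⟩)
  have heq : ∀ j, (d + ε j * e) / ε j = d * (ε j)⁻¹ + e := fun j => by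
    have := (hε0 j).ne'
    field_simp
  simp_rw [heq]
  split_ifs with h
  · have h1 : Tendsto (fun j => d * (ε j)⁻¹ + e) atTop atTop :=
      tendsto_atTop_add_const_right _ _ (hinv.const_mul_atTop h)
    refine tendsto_const_nhds.congr' ?_
    filter_upwards [h1.eventually_ge_atTop 1] with j hj
    rw [Real.smoothTransition.one_of_one_le hj]
  · have hd' : d < 0 := lt_of_le_of_ne (not_lt.1 h) hd
    have h1 : Tendsto (fun j => d * (ε j)⁻¹ + e) atTop atBot :=
      tendsto_atBot_add_const_right _ _ (hinv.const_mul_atTop_of_neg hd')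
    refine tendsto_const_nhds.congr' ?_
    filter_upwards [h1.eventually_le_atBot 0] with j hj
    rw [Real.smoothTransition.zero_of_nonpos hj]

lemma volume_hyperplane_eq_zero {k : ℕ} (a : Fin k → ℝ) (ha : a ≠ 0) (t : ℝ) :
    volume {u : Fin k → ℝ | ∑ i, u i * a i = t} = 0 := by
  let L : (Fin k → ℝ) →ₗ[ℝ] ℝ := Fintype.linearCombination ℝ a
  have hL : ∀ u, L u = ∑ i, u i * a i := fun u => by
    simp [L, Fintype.linearCombination_apply]
  let S : AffineSubspace ℝ (Fin k → ℝ) :=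
    (AffineSubspace.mk' t (⊥ : Submodule ℝ ℝ)).comap L.toAffineMap
  have hS : (S : Set (Fin k → ℝ)) = {u | ∑ i, u i * a i = t} := by
    ext u
    simp only [S, AffineSubspace.coe_comap, Set.mem_preimage, SetLike.mem_coe,
      AffineSubspace.mem_mk', LinearMap.coe_toAffineMap, hL, Set.mem_ofPred_eq]
    simp [sub_eq_zero]
  rw [← hS]
  refine Measure.addHaar_affineSubspace _ _ fun htop => ha ?_
  have hall : ∀ u : Fin k → ℝ, ∑ i, u i * a i = t := fun u => by
    have : u ∈ (S : Set (Fin k → ℝ)) := by rw [htop]; trivial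
    rwa [hS] at this
  have h0 := hall 0
  simp only [Pi.zero_apply, zero_mul, Finset.sum_const_zero] at h0
  funext i
  have := hall (Pi.single i 1)
  simpa [Pi.single_apply, ← h0] using this

/-- Integrals over a plane do not depend on the orthonormal frame. -/
lemma integral_param_congr {k : ℕ} {p : R4} {b b' : Fin k → R4} (hb : Orthonormal ℝ b)
    (hb' : Orthonormal ℝ b')
    (h : Submodule.span ℝ (Set.range b) = Submodule.span ℝ (Set.range b')) (g : R4 → ℝ) :
    ∫ u, g (param p b u) = ∫ u, g (param p b' u) := by
  have hr : Set.range (param p b) = Set.range (param p b') := by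
    ext x
    rw [mem_range_param, mem_range_param, h]
  have h1 := setIntegral_param hb (Set.Subset.refl (Set.range (param p b))) g
  have h2 := setIntegral_param hb' (Set.Subset.refl (Set.range (param p b'))) g
  simp only [Set.preimage_range, Measure.restrict_univ] at h1 h2
  rw [← h1, ← h2, hr]

/-- The face of the polyhedron cut out of the plane `p + V` by the half spaces of `H` that lies in
the boundary of the half space `h`. -/
def faceSet (p : R4) (V : Submodule ℝ R4) (H : Finset (R4 × ℝ)) (h : R4 × ℝ) : Set R4 :=
  {x | x - p ∈ V ∧ inner ℝ h.1 (x - p) = h.2 ∧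
    ∀ h' ∈ H, h' ≠ h → inner ℝ h'.1 (x - p) < h'.2}

/-- A smooth approximation of the indicator function of a half space. -/
def ramp (p : R4) (ε : ℝ) (h : R4 × ℝ) (x : R4) : ℝ :=
  Real.smoothTransition ((h.2 - inner ℝ h.1 (x - p)) / ε)

lemma continuous_ramp (p : R4) (ε : ℝ) (h : R4 × ℝ) : Continuous (ramp p ε h) :=
  Real.smoothTransition.continuous.comp (by fun_prop)

lemma ramp_nonneg (p : R4) (ε : ℝ) (h : R4 × ℝ) (x : R4) : 0 ≤ ramp p ε h x :=
  Real.smoothTransition.nonneg _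

lemma ramp_le_one (p : R4) (ε : ℝ) (h : R4 × ℝ) (x : R4) : ramp p ε h x ≤ 1 :=
  Real.smoothTransition.le_one _

lemma lt_of_ramp_ne_zero {p : R4} {ε : ℝ} (hε : 0 < ε) {h : R4 × ℝ} {x : R4}
    (hx : ramp p ε h x ≠ 0) : inner ℝ h.1 (x - p) < h.2 := by
  by_contra hcon
  exact hx (Real.smoothTransition.zero_of_nonpos
    (div_nonpos_of_nonpos_of_nonneg (by linarith [not_lt.1 hcon]) hε.le))

lemma abs_prod_ramp_le_one (p : R4) (ε : ℝ) (H : Finset (R4 × ℝ)) (x : R4) :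
    |∏ h ∈ H, ramp p ε h x| ≤ 1 := by
  rw [Finset.abs_prod]
  refine Finset.prod_le_one (fun _ _ => abs_nonneg _) fun h _ => ?_
  rw [abs_of_nonneg (ramp_nonneg _ _ _ _)]
  exact ramp_le_one _ _ _ _

/-- On the plane of the face of `h`, the constraint `h'` is a nonconstant affine function unless its
normal is `±h.1`. With equal normals, `h' ≠ h` forces different offsets; with opposite normals a tie
contradicts positivity of both offsets. Hence almost every point of the face plane strictly
satisfies or strictly violates each other constraint. -/
lemma volume_tie_eq_zero {k : ℕ} {p : R4} {f : Fin k → R4} {h h' : R4 × ℝ}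
    (hf : Orthonormal ℝ (Fin.cons h.1 f : Fin (k + 1) → R4))
    (hh' : h'.1 ∈ Submodule.span ℝ (Set.range (Fin.cons h.1 f : Fin (k + 1) → R4)))
    (h1' : ‖h'.1‖ = 1) (hpos : 0 < h.2) (hpos' : 0 < h'.2) (hne : h' ≠ h) :
    volume {u | h'.2 - inner ℝ h'.1 (param (p + h.2 • h.1) f u - p) = 0} = 0 := by
  have hexp : ∀ u, inner ℝ h'.1 (param (p + h.2 • h.1) f u - p) =
      h.2 * inner ℝ h'.1 h.1 + ∑ i, u i * inner ℝ h'.1 (f i) := fun u => by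
    rw [param, add_assoc, add_sub_cancel_left, inner_add_right, inner_sum, inner_smul_right]
    simp_rw [inner_smul_right]
  by_cases ha : (fun i => (inner ℝ h'.1 (f i) : ℝ)) = 0
  · have hz : ∀ i, (inner ℝ h'.1 (f i) : ℝ) = 0 := fun i => congrFun ha i
    rw [span_range_cons] at hh'
    obtain ⟨_, hs, z, hz1, hsz⟩ := Submodule.mem_sup.1 hh'
    obtain ⟨s, rfl⟩ := Submodule.mem_span_singleton.1 hs
    have hn1 : ‖h.1‖ = 1 := (orthonormal_vecCons_iff.1 hf).1
    have hzz : z = 0 := by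
      have h2 : ∀ y ∈ Submodule.span ℝ (Set.range f), (inner ℝ h'.1 y : ℝ) = 0 := by
        intro y hy
        induction hy using Submodule.span_induction with
        | mem x hx => obtain ⟨i, rfl⟩ := hx; exact hz i
        | zero => simp
        | add x y _ _ hx hy => rw [inner_add_right, hx, hy, add_zero]
        | smul a x _ hx => rw [inner_smul_right, hx, mul_zero]
      have h3 := h2 z hz1
      rw [← hsz, inner_add_left, inner_smul_left, inner_eq_zero_of_mem_span hf hz1, mul_zero,
        zero_add] at h3
      exact inner_self_eq_zero.1 h3
    rw [hzz, add_zero] at hsz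
    have hs1 : |s| = 1 := by
      rw [← hsz, norm_smul, hn1, mul_one] at h1'
      exact h1'
    have hin : (inner ℝ h'.1 h.1 : ℝ) = s := by
      rw [← hsz, inner_smul_left, real_inner_self_eq_norm_sq, hn1]; simp
    convert measure_empty (μ := (volume : Measure (Fin k → ℝ)))
    ext u
    simp only [Set.mem_ofPred_eq, Set.mem_empty_iff_false, iff_false, hexp, hz, mul_zero,
      Finset.sum_const_zero, add_zero, hin]
    intro hcon
    rcases (abs_eq zero_le_one).1 hs1 with rfl | rfl
    · refine hne (Prod.ext ?_ ?_)
      · rw [← hsz, one_smul]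
      · linarith
    · linarith
  · convert volume_hyperplane_eq_zero _ ha (h'.2 - h.2 * inner ℝ h'.1 h.1) using 2
    ext u
    simp only [Set.mem_ofPred_eq, hexp]
    constructor <;> intro h <;> linarith

lemma mem_range_param_of_cons {k : ℕ} {p q n : R4} {f : Fin k → R4} {V : Submodule ℝ R4}
    (hV : Submodule.span ℝ (Set.range (Fin.cons n f : Fin (k + 1) → R4)) = V) (u : Fin k → ℝ)
    (hq : q - p ∈ V) : param q f u - p ∈ V := by
  have h1 : param q f u - p = (param q f u - q) + (q - p) := by abel
  rw [h1]
  refine Submodule.add_mem _ ?_ hq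
  rw [← hV, span_range_cons]
  exact Submodule.mem_sup_right (param_sub_mem_span q f u)

lemma faceSet_eq {k : ℕ} {p : R4} {f : Fin k → R4} {V : Submodule ℝ R4} {H : Finset (R4 × ℝ)}
    {h : R4 × ℝ} (hf : Orthonormal ℝ (Fin.cons h.1 f : Fin (k + 1) → R4))
    (hV : Submodule.span ℝ (Set.range (Fin.cons h.1 f : Fin (k + 1) → R4)) = V) :
    faceSet p V H h = {x | x - (p + h.2 • h.1) ∈ Submodule.span ℝ (Set.range f) ∧
      ∀ h' ∈ H, h' ≠ h → inner ℝ h'.1 (x - p) < h'.2} := by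
  have hn : inner ℝ h.1 h.1 = (1 : ℝ) := by
    rw [real_inner_self_eq_norm_sq, (orthonormal_vecCons_iff.1 hf).1, one_pow]
  ext x
  simp only [faceSet, Set.mem_ofPred_eq, ← and_assoc]
  refine and_congr_left fun _ => ?_
  constructor
  · rintro ⟨h1, h2⟩
    rw [← hV, span_range_cons] at h1
    obtain ⟨_, hs, z, hz, hsz⟩ := Submodule.mem_sup.1 h1
    obtain ⟨s, rfl⟩ := Submodule.mem_span_singleton.1 hs
    rw [← hsz, inner_add_right, inner_smul_right, hn, inner_eq_zero_of_mem_span hf hz, mul_one,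
      add_zero] at h2
    rw [← sub_sub, ← hsz, h2, add_sub_cancel_left]
    exact hz
  · intro h1
    have h2 : x - p = h.2 • h.1 + (x - (p + h.2 • h.1)) := by abel
    constructor
    · rw [h2, ← hV, span_range_cons]
      exact Submodule.add_mem_sup (Submodule.smul_mem _ _ (Submodule.mem_span_singleton_self _)) h1
    · rw [h2, inner_add_right, inner_smul_right, hn, inner_eq_zero_of_mem_span hf h1]
      ring

/-- The integral over a thin layer along a face converges to the integral over the face. -/
lemma tendsto_integral_layer {k : ℕ} (σ : Cell (k + 1)) {p : R4} {H : Finset (R4 × ℝ)}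
    (hH : ∀ h ∈ H, h.1 ∈ Submodule.span ℝ (Set.range σ.frame) ∧ ‖h.1‖ = 1 ∧ 0 < h.2)
    (hσ : σ.carrier = {x | x - p ∈ Submodule.span ℝ (Set.range σ.frame) ∧
        ∀ h ∈ H, inner ℝ h.1 (x - p) < h.2}) {h : R4 × ℝ} (hh : h ∈ H) {f : Fin k → R4}
    (hf : Orthonormal ℝ (Fin.cons h.1 f : Fin (k + 1) → R4))
    (hV : Submodule.span ℝ (Set.range (Fin.cons h.1 f : Fin (k + 1) → R4)) =
      Submodule.span ℝ (Set.range σ.frame))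
    {F : R4 → ℝ} (hF : Continuous F) {ε : ℕ → ℝ} (hε0 : ∀ j, 0 < ε j) (hε1 : ∀ j, ε j ≤ 1)
    (hε : Tendsto ε atTop (𝓝 0)) [DecidableEq (R4 × ℝ)] :
    Tendsto (fun j => ∫ u, (fun x => (ε j)⁻¹ *
      deriv Real.smoothTransition ((h.2 - inner ℝ h.1 (x - p)) / ε j) *
      (∏ h' ∈ H.erase h, ramp p (ε j) h' x) * F x) (param p σ.frame u)) atTop
      (𝓝 (∫ x in faceSet p (Submodule.span ℝ (Set.range σ.frame)) H h, F x ∂μHE[k])) := by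
  set V := Submodule.span ℝ (Set.range σ.frame) with hVdef
  have hf' := orthonormal_tail hf
  have hn : inner ℝ h.1 h.1 = (1 : ℝ) := by
    rw [real_inner_self_eq_norm_sq, (orthonormal_vecCons_iff.1 hf).1, one_pow]
  have hn1 : ‖h.1‖ = 1 := (orthonormal_vecCons_iff.1 hf).1
  set q := p + h.2 • h.1 with hq
  set g : ℕ → R4 → ℝ := fun j x => (ε j)⁻¹ *
      deriv Real.smoothTransition ((h.2 - inner ℝ h.1 (x - p)) / ε j) *
      (∏ h' ∈ H.erase h, ramp p (ε j) h' x) * F x with hg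
  have hgc : ∀ j, Continuous (g j) := fun j => by
    refine ((continuous_const.mul (continuous_deriv_smoothTransition.comp (by fun_prop))).mul
      (continuous_finsetProd _ fun h' _ => continuous_ramp _ _ _)).mul hF
  -- points of the plane where the layer function does not vanish lie in the cell
  have hmem : ∀ j x, x - p ∈ V → 0 < (h.2 - inner ℝ h.1 (x - p)) / ε j →
      (∏ h' ∈ H.erase h, ramp p (ε j) h' x) ≠ 0 → x ∈ σ.carrier := fun j x hx h1 h2 => by
    rw [hσ]
    refine ⟨hx, fun h' hh' => ?_⟩
    by_cases he : h' = h
    · rw [he]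
      have := (div_pos_iff_of_pos_right (hε0 j)).1 h1
      linarith
    · exact lt_of_ramp_ne_zero (hε0 j)
        (Finset.prod_ne_zero_iff.1 h2 h' (Finset.mem_erase.2 ⟨he, hh'⟩))
  obtain ⟨M, hM0, hM⟩ := exists_bound_deriv_smoothTransition
  obtain ⟨R, hR⟩ := (Metric.isBounded_iff_subset_closedBall p).1 σ.bounded
  obtain ⟨C, hC⟩ := (isCompact_closedBall p R).exists_bound_of_continuousOn hF.continuousOn
  -- the layer function after rescaling the normal coordinate
  let y : ℕ → ℝ × (Fin k → ℝ) → R4 := fun j z => param q f z.2 - (ε j * z.1) • h.1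
  let Q : ℕ → ℝ × (Fin k → ℝ) → ℝ := fun j z => deriv Real.smoothTransition z.1 *
    ((∏ h' ∈ H.erase h, ramp p (ε j) h' (y j z)) * F (y j z))
  have hyc : ∀ j, Continuous (y j) := fun j =>
    ((continuous_param q f).comp continuous_snd).sub (by fun_prop)
  have hQc : ∀ j, Continuous (Q j) := fun j =>
    (continuous_deriv_smoothTransition.comp continuous_fst).mul
      ((continuous_finsetProd _ fun h' _ => (continuous_ramp _ _ _).comp (hyc j)).mul
        (hF.comp (hyc j)))
  have hyV : ∀ j z, y j z - p ∈ V := fun j z => by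
    have h1 : y j z - p = (param q f z.2 - p) - (ε j * z.1) • h.1 := by simp only [y]; abel
    rw [h1]
    refine Submodule.sub_mem _ (mem_range_param_of_cons hV _ ?_)
      (Submodule.smul_mem _ _ (hH h hh).1)
    rw [hq, add_sub_cancel_left]
    exact Submodule.smul_mem _ _ (hH h hh).1
  have hyn : ∀ j z, (h.2 - inner ℝ h.1 (y j z - p)) / ε j = z.1 := fun j z => by
    have h1 : y j z - p = h.2 • h.1 + (param q f z.2 - q) - (ε j * z.1) • h.1 := by
      simp only [y, hq]; abel
    rw [h1, inner_sub_right, inner_add_right, inner_smul_right, inner_smul_right, hn,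
      inner_eq_zero_of_mem_span hf (param_sub_mem_span q f z.2)]
    have := (hε0 j).ne'
    field_simp
    ring
  -- The rescaled layers have a common bounded support: where `Q j` is nonzero the point `y j z`
  -- lies in the cell, and its foot on the face plane is at distance at most `ε j ≤ 1`. This
  -- provides the dominating function.
  let B : Set (Fin k → ℝ) := param q f ⁻¹' Metric.closedBall p (R + 1)
  have hBm : MeasurableSet B :=
    (Metric.isClosed_closedBall.preimage (continuous_param q f)).measurableSet
  have hBfin : volume B < ⊤ :=
    (isBounded_preimage_param q hf' Metric.isBounded_closedBall).measure_lt_top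
  let D : ℝ × (Fin k → ℝ) → ℝ := (Set.Icc (0 : ℝ) 1 ×ˢ B).indicator fun _ => M * C
  have hDi : Integrable D (volume.prod volume) := by
    refine (integrable_indicator_iff (measurableSet_Icc.prod hBm)).2 ?_
    refine integrableOn_const ?_
    rw [Measure.prod_prod]
    exact (ENNReal.mul_lt_top (by simp) hBfin).ne
  have hQD : ∀ j z, ‖Q j z‖ ≤ D z := fun j z => by
    by_cases hz : Q j z = 0
    · rw [hz, norm_zero]
      refine Set.indicator_nonneg (fun z hz => ?_) _
      refine mul_nonneg hM0 ?_
      exact (norm_nonneg _).trans (hC p (by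
        have := hR (show p ∈ σ.carrier by
          rw [hσ]; exact ⟨by simp, fun h hh => by simpa using (hH h hh).2.2⟩)
        exact this))
    · have hz1 := left_ne_zero_of_mul hz
      have hz2 := left_ne_zero_of_mul (right_ne_zero_of_mul hz)
      have hz3 : z.1 ∈ Set.Ioo (0 : ℝ) 1 := by
        by_contra hcon
        exact hz1 (deriv_smoothTransition_eq_zero hcon)
      have hmem1 : y j z ∈ σ.carrier := hmem j _ (hyV j z) (by rw [hyn]; exact hz3.1) hz2
      have hzB : z.2 ∈ B := by
        have h1 := hR hmem1
        rw [Metric.mem_closedBall] at h1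
        simp only [B, Set.mem_preimage, Metric.mem_closedBall]
        refine (dist_triangle _ (y j z) _).trans ?_
        have h2 : dist (param q f z.2) (y j z) ≤ 1 := by
          simp only [y, dist_eq_norm, sub_sub_cancel, norm_smul, hn1, mul_one, Real.norm_eq_abs]
          rw [abs_of_nonneg (mul_nonneg (hε0 j).le hz3.1.le)]
          exact mul_le_one₀ (hε1 j) hz3.1.le hz3.2.le
        linarith
      have hD : D z = M * C := 
        Set.indicator_of_mem (s := Set.Icc (0 : ℝ) 1 ×ˢ B) (Set.mk_mem_prod
          (Set.Ioo_subset_Icc_self hz3) hzB) _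
      rw [hD]
      simp only [Q, norm_mul]
      refine mul_le_mul (hM _) ?_ (by positivity) hM0
      calc _ ≤ 1 * C := mul_le_mul (abs_prod_ramp_le_one _ _ _ _) (hC _ (hR hmem1))
            (norm_nonneg _) zero_le_one
        _ = C := one_mul C
  have hQi : ∀ j, Integrable (Q j) (volume.prod volume) := fun j =>
    hDi.mono' (hQc j).aestronglyMeasurable (Eventually.of_forall (hQD j))
  -- rewriting the layer integral
  have hrw : ∀ j, ∫ u, g j (param p σ.frame u) = ∫ z, Q j z ∂(volume.prod volume) := fun j => by
    rw [integral_param_congr σ.orthonormal hf hV.symm,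
      ← (volume_preserving_cons k).integral_comp (measurableEmbedding_cons k)]
    simp_rw [param_cons]
    have hcs : HasCompactSupport fun u => g j (param p (Fin.cons h.1 f : Fin (k + 1) → R4) u) := by
      refine HasCompactSupport.of_support_subset_isCompact
        (isBounded_preimage_param p hf σ.bounded).isCompact_closure fun u hu => subset_closure ?_
      have h1 : g j (param p (Fin.cons h.1 f : Fin (k + 1) → R4) u) ≠ 0 := hu
      have h2 := left_ne_zero_of_mul h1
      refine hmem j _ (hV ▸ param_sub_mem_span _ _ u) ?_ (right_ne_zero_of_mul h2)
      by_contra hcon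
      exact right_ne_zero_of_mul (left_ne_zero_of_mul h2)
        (deriv_smoothTransition_eq_zero fun hh => hcon hh.1)
    have hint : Integrable (fun z : ℝ × (Fin k → ℝ) => g j (param p f z.2 + z.1 • h.1))
        (volume.prod volume) := by
      have h1 := ((hgc j).comp (continuous_param p _)).integrable_of_hasCompactSupport
        (μ := volume) hcs
      have h2 := (volume_preserving_cons k).integrable_comp_of_integrable h1
      refine h2.congr (Eventually.of_forall fun z => ?_)
      simp only [Function.comp_apply, param_cons]
    have h3 : ∫ z : ℝ × (Fin k → ℝ), g j (param p f z.2 + z.1 • h.1) =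
      ∫ r : ℝ, ∫ u : Fin k → ℝ, g j (param p f u + r • h.1) := integral_prod _ hint
    rw [h3, integral_prod _ (hQi j)]
    set K : ℝ → ℝ := fun r => ∫ u : Fin k → ℝ, g j (param p f u + r • h.1) with hK
    -- The substitution `r = h.2 - ε s` absorbs the factor `ε⁻¹` and makes the layer have unit
    -- thickness.
    have h4 : ∫ r, K r = ∫ s, ε j * K (h.2 - ε j * s) := by
      rw [integral_const_mul, Measure.integral_comp_mul_left (fun y => K (h.2 - y)) (ε j),
        integral_sub_left_eq_self, abs_of_pos (inv_pos.2 (hε0 j)), smul_eq_mul,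
        mul_inv_cancel_left₀ (hε0 j).ne']
    rw [h4]
    congr 1
    funext s
    rw [hK, ← integral_const_mul]
    congr 1
    funext u
    have h5 : param p f u + (h.2 - ε j * s) • h.1 = y j (s, u) := by
      simp only [y, param, hq, sub_smul]; abel
    rw [h5]
    simp only [hg, Q]
    rw [hyn j (s, u)]
    have := (hε0 j).ne'
    field_simp
  -- the limit
  let S : Set (Fin k → ℝ) := param q f ⁻¹' faceSet p V H h
  have hface := faceSet_eq (p := p) (H := H) hf hV
  have hSmem : ∀ u, u ∈ S ↔ ∀ h' ∈ H.erase h, inner ℝ h'.1 (param q f u - p) < h'.2 := fun u => by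
    simp only [S, Set.mem_preimage, hface, Set.mem_ofPred_eq, Finset.mem_erase]
    exact ⟨fun hu h' hh' => hu.2 h' hh'.2 hh'.1,
      fun hu => ⟨param_sub_mem_span q f u, fun h' hh' hne => hu h' ⟨hne, hh'⟩⟩⟩
  have hSm : MeasurableSet S := by
    have : S = ⋂ h' ∈ H.erase h, {u | inner ℝ h'.1 (param q f u - p) < h'.2} := by
      ext u
      rw [hSmem]
      simp
    rw [this]
    refine (isOpen_biInter_finset fun h' _ => isOpen_lt ?_ continuous_const).measurableSet
    exact continuous_const.inner ((continuous_param q f).sub continuous_const)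
  have hlim : ∫ x in faceSet p V H h, F x ∂μHE[k] = ∫ z : ℝ × (Fin k → ℝ),
      deriv Real.smoothTransition z.1 * S.indicator (fun u => F (param q f u)) z.2
        ∂(volume.prod volume) := by
    rw [integral_prod_mul (fun s => deriv Real.smoothTransition s)
      (fun u => S.indicator (fun u => F (param q f u)) u), integral_deriv_smoothTransition,
      one_mul, integral_indicator hSm]
    refine setIntegral_param hf' ?_ F
    rw [hface]
    exact fun x hx => mem_range_param.2 hx.1
  rw [hlim]
  refine Tendsto.congr (fun j => (hrw j).symm) ?_
  -- Away from ties every remaining ramp converges to `0` or `1`, and their product to the indicator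
  -- of the face.
  have hae : ∀ᵐ u : Fin k → ℝ, ∀ h' ∈ H.erase h, h'.2 - inner ℝ h'.1 (param q f u - p) ≠ 0 := by
    refine (ae_ball_iff (H.erase h).countable_toSet).2 fun h' hh' => ?_
    have hh'' := Finset.mem_erase.1 hh'
    exact measure_eq_zero_iff_ae_notMem.1 (volume_tie_eq_zero hf (hV ▸ (hH h' hh''.2).1)
      (hH h' hh''.2).2.1 (hH h hh).2.2 (hH h' hh''.2).2.2 hh''.1)
  refine tendsto_integral_of_dominated_convergence D (fun j => (hQc j).aestronglyMeasurable) hDi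
    (fun j => Eventually.of_forall (hQD j)) ?_
  have hae2 : ∀ᵐ z : ℝ × (Fin k → ℝ) ∂(volume.prod volume), ∀ h' ∈ H.erase h,
      h'.2 - inner ℝ h'.1 (param q f z.2 - p) ≠ 0 := Measure.quasiMeasurePreserving_snd.ae hae
  filter_upwards [hae2] with z hz
  refine Tendsto.const_mul _ ?_
  have hy0 : Tendsto (fun j => y j z) atTop (𝓝 (param q f z.2)) := by
    have : Tendsto (fun j => param q f z.2 - (ε j * z.1) • h.1) atTop
        (𝓝 (param q f z.2 - ((0 : ℝ) * z.1) • h.1)) :=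
      tendsto_const_nhds.sub ((hε.mul_const z.1).smul_const h.1)
    simpa [y] using this
  have hr : ∀ h' ∈ H.erase h, Tendsto (fun j => ramp p (ε j) h' (y j z)) atTop
      (𝓝 (if 0 < h'.2 - inner ℝ h'.1 (param q f z.2 - p) then 1 else 0)) := fun h' hh' => by
    refine (tendsto_smoothTransition_div hε0 hε (hz h' hh')
      (z.1 * inner ℝ h'.1 h.1)).congr fun j => ?_
    simp only [ramp, y]
    congr 2
    rw [sub_right_comm, inner_sub_right _ (param q f z.2 - p), inner_smul_right]
    ring
  have hprod := tendsto_finsetProd (H.erase h) hr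
  have heq : S.indicator (fun u => F (param q f u)) z.2 = (∏ h' ∈ H.erase h,
      (if 0 < h'.2 - inner ℝ h'.1 (param q f z.2 - p) then (1 : ℝ) else 0)) *
      F (param q f z.2) := by
    by_cases hzS : z.2 ∈ S
    · rw [Set.indicator_of_mem hzS, Finset.prod_eq_one, one_mul]
      intro h' hh'
      rw [if_pos (sub_pos.2 ((hSmem _).1 hzS h' hh'))]
    · rw [Set.indicator_of_notMem hzS]
      have h1 := mt (hSmem z.2).2 hzS
      push Not at h1
      obtain ⟨h', hh', h2⟩ := h1
      rw [Finset.prod_eq_zero hh' (if_neg (by linarith)), zero_mul]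
  rw [heq]
  exact hprod.mul ((hF.tendsto _).comp hy0)

lemma hasFDerivAt_param {k : ℕ} (p : R4) (b : Fin k → R4) (u : Fin k → ℝ) :
    HasFDerivAt (param p b) (Fintype.linearCombination ℝ b).toContinuousLinearMap u := by
  have h : param p b = fun u => p + (Fintype.linearCombination ℝ b).toContinuousLinearMap u := by
    funext u
    simp [param, Fintype.linearCombination_apply]
  rw [h]
  exact (ContinuousLinearMap.hasFDerivAt _).const_add p

lemma hasFDerivAt_ramp (p : R4) (ε : ℝ) (h : R4 × ℝ) (x : R4) :
    HasFDerivAt (ramp p ε h)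
      ((-(ε⁻¹ * deriv Real.smoothTransition ((h.2 - inner ℝ h.1 (x - p)) / ε))) •
        innerSL ℝ h.1) x := by
  have h1 : HasFDerivAt (fun x : R4 => (h.2 - inner ℝ h.1 (x - p)) / ε)
      ((-ε⁻¹) • innerSL ℝ h.1) x := by
    have h2 : HasFDerivAt (fun x : R4 => (inner ℝ h.1 (x - p) : ℝ)) (innerSL ℝ h.1) x :=
      (innerSL ℝ h.1).hasFDerivAt.comp x ((hasFDerivAt_id x).sub_const p)
    have h3 := (h2.const_sub h.2).mul_const ε⁻¹
    simp only [div_eq_mul_inv]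
    exact h3.congr_fderiv (by rw [smul_neg, neg_smul])
  have h4 := (differentiable_smoothTransition
    ((h.2 - inner ℝ h.1 (x - p)) / ε)).hasDerivAt.comp_hasFDerivAt x h1
  refine h4.congr_fderiv ?_
  rw [smul_smul]
  congr 1
  ring

/-- The divergence theorem on a cell, for a constant direction. -/
lemma Cell.integral_fderiv {k : ℕ} (σ : Cell (k + 1)) {p : R4} {H : Finset (R4 × ℝ)}
    (hH : ∀ h ∈ H, h.1 ∈ Submodule.span ℝ (Set.range σ.frame) ∧ ‖h.1‖ = 1 ∧ 0 < h.2)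
    (hσ : σ.carrier = {x | x - p ∈ Submodule.span ℝ (Set.range σ.frame) ∧
        ∀ h ∈ H, inner ℝ h.1 (x - p) < h.2})
    {F : R4 → ℝ} (hF : ContDiff ℝ 1 F) {v : R4}
    (hv : v ∈ Submodule.span ℝ (Set.range σ.frame)) :
    ∫ x in σ.carrier, fderiv ℝ F x v ∂μHE[k + 1] = ∑ h ∈ H, inner ℝ h.1 v *
      ∫ x in faceSet p (Submodule.span ℝ (Set.range σ.frame)) H h, F x ∂μHE[k] := by
  classical
  set V := Submodule.span ℝ (Set.range σ.frame) with hVdef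
  obtain ⟨β, hβ⟩ := (Submodule.mem_span_range_iff_exists_fun ℝ).1 hv
  set J := param p σ.frame with hJ
  set L := (Fintype.linearCombination ℝ σ.frame).toContinuousLinearMap with hL
  have hLβ : L β = v := by simp [hL, Fintype.linearCombination_apply, hβ]
  let ε : ℕ → ℝ := fun j => ((2 : ℝ) ^ j)⁻¹
  have hε0 : ∀ j, 0 < ε j := fun j => by positivity
  have hε1 : ∀ j, ε j ≤ 1 := fun j => inv_le_one_of_one_le₀ (one_le_pow₀ one_le_two)
  have hε : Tendsto ε atTop (𝓝 0) := tendsto_two_pow_inv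
  -- A smooth cutoff that vanishes on the plane outside the cell and tends to its indicator.
  -- Integration by parts moves the derivative onto the cutoff, where it concentrates in layers
  -- along the faces. The sign from integration by parts cancels that of the inward gradient of each
  -- ramp.
  let χ : ℕ → R4 → ℝ := fun j x => ∏ h ∈ H, ramp p (ε j) h x
  let lay : ℕ → R4 × ℝ → R4 → ℝ := fun j h x => (ε j)⁻¹ *
      deriv Real.smoothTransition ((h.2 - inner ℝ h.1 (x - p)) / ε j) *
      (∏ h' ∈ H.erase h, ramp p (ε j) h' x) * F x
  have hχd : ∀ j x, HasFDerivAt (χ j) (∑ h ∈ H, (∏ h' ∈ H.erase h, ramp p (ε j) h' x) •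
      ((-((ε j)⁻¹ * deriv Real.smoothTransition ((h.2 - inner ℝ h.1 (x - p)) / ε j))) •
        innerSL ℝ h.1)) x := fun j x =>
    HasFDerivAt.finsetProd fun h _ => hasFDerivAt_ramp p (ε j) h x
  have hχ0 : ∀ j x, x - p ∈ V → x ∉ σ.carrier → χ j x = 0 := fun j x hx hxσ => by
    by_contra hcon
    refine hxσ ?_
    rw [hσ]
    exact ⟨hx, fun h hh => lt_of_ramp_ne_zero (hε0 j) (Finset.prod_ne_zero_iff.1 hcon h hh)⟩
  have hJV : ∀ u, J u - p ∈ V := fun u => param_sub_mem_span _ _ u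
  have hχC : ∀ j, ContDiff ℝ 1 (χ j) := fun j => by
    refine contDiff_prod fun h _ => ?_
    refine (Real.smoothTransition.contDiff (n := 1)).comp ?_
    exact (contDiff_const.sub (contDiff_const.inner ℝ (contDiff_id.sub contDiff_const))).div_const _
  have hJC : ContDiff ℝ 1 J := by
    have : J = fun u => p + L u := by
      funext u
      simp [hJ, hL, param, Fintype.linearCombination_apply]
    rw [this]
    exact contDiff_const.add L.contDiff
  have hfJ : ∀ j u, fderiv ℝ (fun u => χ j (J u)) u β = -∑ h ∈ H, inner ℝ h.1 v *
      ((ε j)⁻¹ * deriv Real.smoothTransition ((h.2 - inner ℝ h.1 (J u - p)) / ε j) *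
      (∏ h' ∈ H.erase h, ramp p (ε j) h' (J u))) := fun j u => by
    have h1 := ((hχd j (J u)).comp u (hasFDerivAt_param p σ.frame u)).fderiv
    have h2 : (fun u => χ j (J u)) = χ j ∘ param p σ.frame := rfl
    rw [h2, h1, ContinuousLinearMap.comp_apply, ← hL, hLβ, sum_apply,
      ← Finset.sum_neg_distrib]
    refine Finset.sum_congr rfl fun h _ => ?_
    simp only [smul_apply, innerSL_apply_apply, smul_eq_mul]
    ring
  have hgJ : ∀ u, fderiv ℝ (fun u => F (J u)) u β = fderiv ℝ F (J u) v := fun u => by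
    have h1 := ((hF.differentiable one_ne_zero (J u)).hasFDerivAt.comp u
      (hasFDerivAt_param p σ.frame u)).fderiv
    have h2 : (fun u => F (J u)) = F ∘ param p σ.frame := rfl
    rw [h2, h1, ContinuousLinearMap.comp_apply, ← hL, hLβ]
  have hcs : ∀ j, HasCompactSupport fun u => χ j (J u) := fun j => by
    refine HasCompactSupport.of_support_subset_isCompact
      (isBounded_preimage_param p σ.orthonormal σ.bounded).isCompact_closure
      fun u hu => subset_closure ?_
    by_contra hcon
    exact hu (hχ0 j _ (hJV u) hcon)
  have hχJ : ∀ j, ContDiff ℝ 1 fun u => χ j (J u) := fun j => (hχC j).comp hJC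
  have hFJ : ContDiff ℝ 1 fun u => F (J u) := hF.comp hJC
  have hparts : ∀ j, ∫ u, χ j (J u) * fderiv ℝ F (J u) v =
      ∑ h ∈ H, inner ℝ h.1 v * ∫ u, lay j h (J u) := fun j => by
    have hcs' : HasCompactSupport fun u => fderiv ℝ (fun u => χ j (J u)) u β :=
      (hcs j).fderiv_apply ℝ β
    have h1 := integral_smul_fderiv_eq_neg_fderiv_smul_of_integrable (μ := volume)
      (f := fun u => χ j (J u)) (g := fun u => F (J u)) (v := β) ?_ ?_ ?_
      (fun u _ => (hχJ j).differentiable one_ne_zero u)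
      (fun u _ => hFJ.differentiable one_ne_zero u)
    · simp only [smul_eq_mul, hgJ, hfJ] at h1
      rw [h1, ← integral_neg]
      have h2 : ∀ h ∈ H, Integrable fun u => inner ℝ h.1 v * lay j h (J u) := fun h hh => by
        refine Integrable.const_mul ?_ _
        refine Continuous.integrable_of_hasCompactSupport ?_ ?_
        · refine Continuous.comp (g := lay j h) ?_ (continuous_param p σ.frame)
          exact ((continuous_const.mul (continuous_deriv_smoothTransition.comp (by fun_prop))).mul
            (continuous_finsetProd _ fun h' _ => continuous_ramp _ _ _)).mul hF.continuous
        · refine HasCompactSupport.of_support_subset_isCompact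
            (isBounded_preimage_param p σ.orthonormal σ.bounded).isCompact_closure
            fun u hu => subset_closure ?_
          have hu1 := left_ne_zero_of_mul hu
          change J u ∈ σ.carrier
          rw [hσ]
          refine ⟨hJV u, fun h' hh' => ?_⟩
          by_cases he : h' = h
          · rw [he]
            by_contra hcon
            refine right_ne_zero_of_mul (left_ne_zero_of_mul hu1)
              (deriv_smoothTransition_eq_zero fun h3 => hcon ?_)
            have := (div_pos_iff_of_pos_right (hε0 j)).1 h3.1
            linarith
          · exact lt_of_ramp_ne_zero (hε0 j) (Finset.prod_ne_zero_iff.1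
              (right_ne_zero_of_mul hu1) h' (Finset.mem_erase.2 ⟨he, hh'⟩))
      simp_rw [← integral_const_mul]
      rw [← integral_finsetSum H h2]
      congr 1
      funext u
      rw [neg_mul, neg_neg, Finset.sum_mul]
      refine Finset.sum_congr rfl fun h _ => ?_
      simp only [lay]
      ring
    · refine Continuous.integrable_of_hasCompactSupport ?_ hcs'.smul_right
      exact (((hχJ j).continuous_fderiv one_ne_zero).clm_apply continuous_const).smul
        hFJ.continuous
    · refine Continuous.integrable_of_hasCompactSupport ?_ (hcs j).smul_right
      exact (hχJ j).continuous.smul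
        ((hFJ.continuous_fderiv one_ne_zero).clm_apply continuous_const)
    · refine Continuous.integrable_of_hasCompactSupport ?_ (hcs j).smul_right
      exact (hχJ j).continuous.smul hFJ.continuous
  have hright : Tendsto (fun j => ∑ h ∈ H, inner ℝ h.1 v * ∫ u, lay j h (J u)) atTop
      (𝓝 (∑ h ∈ H, inner ℝ h.1 v * ∫ x in faceSet p V H h, F x ∂μHE[k])) := by
    refine tendsto_finsetSum _ fun h hh => Tendsto.const_mul _ ?_
    obtain ⟨f, hf, hfV⟩ := exists_frame_cons σ.orthonormal (hH h hh).1 (hH h hh).2.1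
    exact tendsto_integral_layer σ hH hσ hh hf hfV hF.continuous hε0 hε1 hε
  have hpσ : p ∈ σ.carrier := by
    rw [hσ]; exact ⟨by simp, fun h hh => by simpa using (hH h hh).2.2⟩
  have hFv : Continuous fun x => fderiv ℝ F x v :=
    (hF.continuous_fderiv one_ne_zero).clm_apply continuous_const
  have hleft : Tendsto (fun j => ∫ u, χ j (J u) * fderiv ℝ F (J u) v) atTop
      (𝓝 (∫ x in σ.carrier, fderiv ℝ F x v ∂μHE[k + 1])) := by
    rw [setIntegral_param σ.orthonormal (σ.subset_range hpσ), ← hJ,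
      ← integral_indicator (σ.isOpen_preimage hpσ).measurableSet]
    have hb := σ.integrableOn hFv
    refine tendsto_integral_of_dominated_convergence
      (fun u => ‖(J ⁻¹' σ.carrier).indicator (fun u => fderiv ℝ F (J u) v) u‖) ?_ ?_ ?_ ?_
    · exact fun j => ((hχJ j).continuous.mul (hFv.comp hJC.continuous)).aestronglyMeasurable
    · refine Integrable.norm ?_
      refine (integrable_indicator_iff (σ.isOpen_preimage hpσ).measurableSet).2 ?_
      rw [IntegrableOn, restrict_eq_map_param σ.orthonormal (σ.subset_range hpσ)] at hb
      exact hb.comp_measurable (continuous_param p σ.frame).measurable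
    · refine fun j => Eventually.of_forall fun u => ?_
      by_cases hu : J u ∈ σ.carrier
      · rw [Set.indicator_of_mem (by exact hu), norm_mul]
        exact mul_le_of_le_one_left (norm_nonneg _) (abs_prod_ramp_le_one _ _ _ _)
      · rw [hχ0 j _ (hJV u) hu, zero_mul, norm_zero]
        exact norm_nonneg _
    · refine Eventually.of_forall fun u => ?_
      by_cases hu : J u ∈ σ.carrier
      · rw [Set.indicator_of_mem (by exact hu)]
        have h1 : Tendsto (fun j => χ j (J u)) atTop (𝓝 (∏ h ∈ H, (1 : ℝ))) := by
          refine tendsto_finsetProd _ fun h hh => ?_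
          have hd : 0 < h.2 - inner ℝ h.1 (J u - p) := by
            rw [hσ] at hu
            exact sub_pos.2 (hu.2 h hh)
          have := tendsto_smoothTransition_div hε0 hε hd.ne' 0
          rw [if_pos hd] at this
          simpa [ramp] using this
        rw [Finset.prod_const_one] at h1
        simpa using h1.mul_const (fderiv ℝ F (J u) v)
      · rw [Set.indicator_of_notMem (by exact hu)]
        simp [hχ0 _ _ (hJV u) hu]
  refine tendsto_nhds_unique hleft (hright.congr fun j => (hparts j).symm)

/-! ### The Stokes theorem on cells -/

/-- Contracting a point of the face slightly towards `p` makes every inequality strict, since all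
offsets are positive. -/
lemma Cell.faceSet_subset {k : ℕ} (σ : Cell (k + 1)) {p : R4} {H : Finset (R4 × ℝ)}
    (hH : ∀ h ∈ H, h.1 ∈ Submodule.span ℝ (Set.range σ.frame) ∧ ‖h.1‖ = 1 ∧ 0 < h.2)
    (hσ : σ.carrier = {x | x - p ∈ Submodule.span ℝ (Set.range σ.frame) ∧
        ∀ h ∈ H, inner ℝ h.1 (x - p) < h.2}) {h : R4 × ℝ} :
    faceSet p (Submodule.span ℝ (Set.range σ.frame)) H h ⊆ closure σ.carrier := by
  rintro x ⟨hx, hx1, hx2⟩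
  have h0 : Tendsto (fun j : ℕ => x - ((2 : ℝ) ^ (j + 1))⁻¹ • (x - p)) atTop (𝓝 x) := by
    have h1 : Tendsto (fun j : ℕ => ((2 : ℝ) ^ (j + 1))⁻¹) atTop (𝓝 0) :=
      tendsto_two_pow_inv.comp (tendsto_add_atTop_nat 1)
    simpa using (tendsto_const_nhds (x := x)).sub (h1.smul_const (x - p))
  refine mem_closure_of_tendsto h0 (Eventually.of_forall fun j => ?_)
  set t := ((2 : ℝ) ^ (j + 1))⁻¹ with ht
  have ht0 : 0 < t := by positivity
  have ht1 : t < 1 := inv_lt_one_of_one_lt₀ (one_lt_pow₀ one_lt_two (by simp))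
  rw [hσ]
  have h2 : x - t • (x - p) - p = (1 - t) • (x - p) := by
    rw [sub_smul, one_smul]; abel
  refine ⟨?_, fun h' hh' => ?_⟩
  · rw [h2]
    exact Submodule.smul_mem _ _ hx
  · rw [h2, inner_smul_right]
    have hpos := (hH h' hh').2.2
    have hle : inner ℝ h'.1 (x - p) ≤ h'.2 := by
      by_cases he : h' = h
      · rw [he, hx1]
      · exact (hx2 h' hh' he).le
    nlinarith

/-- A nonempty face of a cell, as a cell. -/
def faceCell {k : ℕ} (p : R4) (V : Submodule ℝ R4) (H : Finset (R4 × ℝ)) (h : R4 × ℝ)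
    (f : Fin k → R4) (hf : Orthonormal ℝ (Fin.cons h.1 f : Fin (k + 1) → R4))
    (hV : Submodule.span ℝ (Set.range (Fin.cons h.1 f : Fin (k + 1) → R4)) = V)
    (hne : (faceSet p V H h).Nonempty) (hbd : Bornology.IsBounded (faceSet p V H h)) :
    Cell k where
  carrier := faceSet p V H h
  frame := f
  orthonormal := orthonormal_tail hf
  halfSpaces := by
    classical
    refine ⟨p + h.2 • h.1, (H.erase h).image fun h' => (h'.1, h'.2 + inner ℝ h'.1 p), ?_⟩
    rw [faceSet_eq hf hV]
    ext x
    simp only [Set.mem_ofPred_eq, Finset.forall_mem_image, Finset.mem_erase]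
    refine and_congr_right fun _ => ?_
    constructor
    · rintro hx h' ⟨hne, hh'⟩
      have := hx h' hh' hne
      rw [inner_sub_right] at this
      linarith
    · intro hx h' hh' hne
      have := hx ⟨hne, hh'⟩
      rw [inner_sub_right]
      linarith
  nonempty := hne
  bounded := hbd

/-- The covector `⟪n, ·⟫` wedged with an alternating map. -/
def wedgeInner {k : ℕ} (n : R4) (f : R4 [⋀^Fin k]→L[ℝ] ℝ) : R4 [⋀^Fin (k + 1)]→L[ℝ] ℝ :=
  ContinuousAlternatingMap.alternatizeUncurryFin ((innerSL ℝ n).smulRight f)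

lemma wedgeInner_apply {k : ℕ} (n : R4) (f : R4 [⋀^Fin k]→L[ℝ] ℝ) (b : Fin (k + 1) → R4) :
    wedgeInner n f b = ∑ i : Fin (k + 1), (-1) ^ (i : ℕ) * (inner ℝ n (b i) *
      f (Fin.removeNth i b)) := by
  rw [wedgeInner, ContinuousAlternatingMap.alternatizeUncurryFin_apply]
  refine Finset.sum_congr rfl fun i _ => ?_
  rw [zsmul_eq_mul]
  simp

/-- With a unit vector `n` in the first slot and vectors orthogonal to it behind, only the zeroth
term of the alternating sum survives. -/
lemma wedgeInner_cons {k : ℕ} {n : R4} {b : Fin k → R4}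
    (hb : Orthonormal ℝ (Fin.cons n b : Fin (k + 1) → R4)) (f : R4 [⋀^Fin k]→L[ℝ] ℝ) :
    wedgeInner n f (Fin.cons n b : Fin (k + 1) → R4) = f b := by
  rw [wedgeInner_apply, Fin.sum_univ_succ]
  have h := orthonormal_vecCons_iff.1 hb
  have h0 : Fin.removeNth 0 (Fin.cons n b : Fin (k + 1) → R4) = b := by
    ext i; simp [Fin.removeNth]
  simp [h0, h.1, h.2.1]

/-- **The Stokes theorem**: the boundary of a cell is a chain of cells in its closure. -/
theorem Cell.bdry_mem {k : ℕ} (σ : Cell (k + 1)) : bdry σ.toCurrent ∈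
    AddSubgroup.closure {A : Current k | ∃ τ : Cell k, τ.carrier ⊆ closure σ.carrier ∧
      A = τ.toCurrent} := by
  obtain ⟨p, hp⟩ := σ.nonempty
  obtain ⟨H, hH, hσ⟩ := σ.exists_unit_halfSpaces hp
  set V := Submodule.span ℝ (Set.range σ.frame) with hV
  -- The contribution of one face after applying the divergence theorem to each component of `dω`.
  let P : R4 × ℝ → Current k := fun h ω => ∑ i : Fin (k + 1), (-1) ^ (i : ℕ) *
    (inner ℝ h.1 (σ.frame i) * ∫ x in faceSet p V H h, ω.1 x (Fin.removeNth i σ.frame) ∂μHE[k])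
  have hP : bdry σ.toCurrent = ∑ h ∈ H, P h := by
    funext ω
    rw [Finset.sum_apply]
    have h1 : ∀ x, ω.d.1 x σ.frame = ∑ i : Fin (k + 1), (-1) ^ (i : ℕ) *
        fderiv ℝ (fun x => ω.1 x (Fin.removeNth i σ.frame)) x (σ.frame i) := fun x => by
      refine (extDeriv_apply (ω.differentiable x) σ.frame).trans ?_
      refine Finset.sum_congr rfl fun i _ => ?_
      rw [zsmul_eq_mul]
      simp
    have hsm : ∀ i, ContDiff ℝ 1 fun x => ω.1 x (Fin.removeNth i σ.frame) := fun i =>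
      (ContinuousAlternatingMap.apply ℝ R4 ℝ (Fin.removeNth i σ.frame)).contDiff.comp
        ω.contDiff_one
    change ∫ x in σ.carrier, ω.d.1 x σ.frame ∂μHE[k + 1] = _
    simp_rw [h1]
    rw [integral_finsetSum]
    · simp only [P]
      rw [Finset.sum_comm]
      refine Finset.sum_congr rfl fun i _ => ?_
      rw [integral_const_mul, σ.integral_fderiv hH hσ (hsm i)
        (Submodule.subset_span (Set.mem_range_self i)), Finset.mul_sum]
    · intro i _
      refine Integrable.const_mul (σ.integrableOn ?_) _
      exact ((hsm i).continuous_fderiv one_ne_zero).clm_apply continuous_const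
  rw [hP]
  refine AddSubgroup.sum_mem _ fun h hh => ?_
  rcases (faceSet p V H h).eq_empty_or_nonempty with he | hne
  · have : P h = 0 := by
      funext ω
      simp [P, he]
    rw [this]
    exact AddSubgroup.zero_mem _
  · obtain ⟨f, hf, hfV⟩ := exists_frame_cons σ.orthonormal (hH h hh).1 (hH h hh).2.1
    have hsub := σ.faceSet_subset hH hσ (h := h)
    let τ : Cell k := faceCell p V H h f hf hfV hne (σ.bounded.closure.subset hsub)
    obtain ⟨e, -, he⟩ := exists_sign_of_span_eq σ.orthonormal hf hfV.symm
    have : P h = e • τ.toCurrent := by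
      funext ω
      rw [Pi.smul_apply, zsmul_eq_mul, Cell.toCurrent_apply]
      simp only [P]
      simp_rw [← integral_const_mul]
      rw [← integral_finsetSum]
      · refine integral_congr_ae (Eventually.of_forall fun x => ?_)
        -- The sum over `i` is the covector of the face normal wedged with `ω`, evaluated on
        -- `σ.frame`. Passing to the frame that starts with the normal costs a sign and leaves `ω`
        -- on the frame of the face.
        have h1 := he (wedgeInner h.1 (ω.1 x))
        rw [wedgeInner_cons hf, wedgeInner_apply] at h1
        exact h1
      · intro i _
        exact ((τ.integrableOn_form ω _).const_mul _).const_mul _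
    rw [this]
    refine AddSubgroup.zsmul_mem _ (AddSubgroup.subset_closure ?_) _
    exact ⟨τ, hsub, rfl⟩

/-! ### Common refinements -/

lemma Cell.sub_mem_span {k : ℕ} (σ : Cell k) {x y : R4} (hx : x ∈ σ.carrier)
    (hy : y ∈ σ.carrier) : x - y ∈ Submodule.span ℝ (Set.range σ.frame) :=
  mem_range_param.1 (σ.subset_range hy hx)

lemma Cell.span_eq_of_subset {k : ℕ} {σ τ : Cell k} (h : τ.carrier ⊆ σ.carrier) :
    Submodule.span ℝ (Set.range σ.frame) = Submodule.span ℝ (Set.range τ.frame) := by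
  refine (Submodule.eq_of_le_of_finrank_eq (fun v hv => ?_) ?_).symm
  · obtain ⟨p, hp⟩ := τ.nonempty
    obtain ⟨ε, hε, h1⟩ := τ.exists_add_smul_mem hp hv
    have h2 := σ.sub_mem_span (h h1) (h hp)
    rw [add_sub_cancel_left] at h2
    exact (Submodule.smul_mem_iff _ hε.ne').1 h2
  · rw [finrank_span_frame σ.orthonormal, finrank_span_frame τ.orthonormal]

/-- The equations of the plane `p + V`. -/
def planeEq (p : R4) (V : Submodule ℝ R4) (j : Fin 4) : R4 × ℝ :=
  (Vᗮ.starProjection (EuclideanSpace.single j 1),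
    inner ℝ (Vᗮ.starProjection (EuclideanSpace.single j 1)) p)

lemma sub_mem_iff_planeEq {p x : R4} {V : Submodule ℝ R4} :
    x - p ∈ V ↔ ∀ j, inner ℝ (planeEq p V j).1 x = (planeEq p V j).2 := by
  constructor
  · intro h j
    simp only [planeEq]
    rw [← sub_eq_zero, ← inner_sub_right]
    exact Submodule.inner_left_of_mem_orthogonal h (Submodule.starProjection_apply_mem _ _)
  · intro h
    have h1 : ∀ j, (Vᗮ.starProjection (x - p)) j = 0 := fun j => by
      have h2 := h j
      simp only [planeEq] at h2
      rw [← sub_eq_zero, ← inner_sub_right, Submodule.inner_starProjection_left_eq_right,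
        EuclideanSpace.inner_single_left] at h2
      simpa using h2
    have h3 : Vᗮ.starProjection (x - p) = 0 := by
      ext j
      simpa using h1 j
    rw [Submodule.starProjection_orthogonal_val, sub_eq_zero] at h3
    rw [h3]
    exact Submodule.starProjection_apply_mem _ _

/-- The points at which the affine functions of `H` have the prescribed signs. -/
def signFiber (H : Finset (R4 × ℝ)) (ε : H → SignType) : Set R4 :=
  {x | ∀ h : H, SignType.sign (inner ℝ h.1.1 x - h.1.2) = ε h}

lemma measurableSet_signFiber (H : Finset (R4 × ℝ)) (ε : H → SignType) :
    MeasurableSet (signFiber H ε) := by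
  have : signFiber H ε =
      ⋂ h : H, {x | SignType.sign (inner ℝ h.1.1 x - h.1.2) = ε h} := by
    ext x; simp [signFiber]
  rw [this]
  refine MeasurableSet.iInter fun h => ?_
  have hm : Measurable fun x : R4 => (inner ℝ h.1.1 x - h.1.2 : ℝ) := by fun_prop
  rcases hs : ε h with _ | _ | _
  · have h1 : {x : R4 | SignType.sign (inner ℝ h.1.1 x - h.1.2) = SignType.zero} =
        (fun x : R4 => (inner ℝ h.1.1 x - h.1.2 : ℝ)) ⁻¹' {0} := by
      ext x
      exact sign_eq_zero_iff
    rw [h1]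
    exact hm (measurableSet_singleton 0)
  · have h1 : {x : R4 | SignType.sign (inner ℝ h.1.1 x - h.1.2) = SignType.neg} =
        (fun x : R4 => (inner ℝ h.1.1 x - h.1.2 : ℝ)) ⁻¹' Set.Iio 0 := by
      ext x
      exact sign_eq_neg_one_iff
    rw [h1]
    exact hm measurableSet_Iio
  · have h1 : {x : R4 | SignType.sign (inner ℝ h.1.1 x - h.1.2) = SignType.pos} =
        (fun x : R4 => (inner ℝ h.1.1 x - h.1.2 : ℝ)) ⁻¹' Set.Ioi 0 := by
      ext x
      exact sign_eq_one_iff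
    rw [h1]
    exact hm measurableSet_Ioi

lemma disjoint_signFiber {H : Finset (R4 × ℝ)} {ε ε' : H → SignType} (h : ε ≠ ε') :
    Disjoint (signFiber H ε) (signFiber H ε') :=
  Set.disjoint_left.2 fun _ hx hx' => h (funext fun i => (hx i).symm.trans (hx' i))

lemma iUnion_signFiber (H : Finset (R4 × ℝ)) : ⋃ ε, signFiber H ε = Set.univ :=
  Set.eq_univ_of_forall fun _ => Set.mem_iUnion.2 ⟨_, fun _ => rfl⟩

/-- `H` contains the half spaces and plane equations defining `σ`. -/
def Cell.CutBy {k : ℕ} (σ : Cell k) (H : Finset (R4 × ℝ)) : Prop :=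
  ∀ x ∈ σ.carrier, ∀ y, (∀ h ∈ H, SignType.sign (inner ℝ h.1 x - h.2) =
    SignType.sign (inner ℝ h.1 y - h.2)) → y ∈ σ.carrier

lemma Cell.CutBy.mono {k : ℕ} {σ : Cell k} {H H' : Finset (R4 × ℝ)} (h : σ.CutBy H)
    (hH : H ⊆ H') : σ.CutBy H' :=
  fun x hx y hy => h x hx y fun g hg => hy g (hH hg)

lemma Cell.exists_cutBy {k : ℕ} (σ : Cell k) : ∃ H, σ.CutBy H := by
  classical
  obtain ⟨p, H, hσ⟩ := σ.halfSpaces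
  refine ⟨H ∪ Finset.univ.image (planeEq p (Submodule.span ℝ (Set.range σ.frame))),
    fun x hx y hy => ?_⟩
  rw [hσ] at hx ⊢
  refine ⟨sub_mem_iff_planeEq.2 fun j => ?_, fun h hh => ?_⟩
  · have h1 := hy _ (Finset.mem_union_right _ (Finset.mem_image_of_mem _ (Finset.mem_univ j)))
    rw [sub_mem_iff_planeEq.1 hx.1 j, sub_self, sign_zero] at h1
    exact sub_eq_zero.1 (sign_eq_zero_iff.1 h1.symm)
  · have h1 := hy _ (Finset.mem_union_left _ hh)
    rw [sign_neg (sub_neg.2 (hx.2 h hh))] at h1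
    exact sub_neg.1 (sign_eq_neg_one_iff.1 h1.symm)

lemma Cell.CutBy.subset_or_disjoint {k : ℕ} {σ : Cell k} {H : Finset (R4 × ℝ)}
    (hσ : σ.CutBy H) (ε : H → SignType) :
    signFiber H ε ⊆ σ.carrier ∨ σ.carrier ∩ signFiber H ε = ∅ := by
  by_cases h : (σ.carrier ∩ signFiber H ε).Nonempty
  · obtain ⟨x, hx, hxε⟩ := h
    exact Or.inl fun y hy => hσ x hx y fun g hg => (hxε ⟨g, hg⟩).trans (hy ⟨g, hg⟩).symm
  · exact Or.inr (Set.not_nonempty_iff_eq_empty.1 h)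

/-- A sign fiber inside a cell is a null set or a cell. -/
lemma Cell.signFiber_null_or_cell {k : ℕ} (σ : Cell k) {H : Finset (R4 × ℝ)}
    {ε : H → SignType} (hε : signFiber H ε ⊆ σ.carrier) :
    μHE[k] (signFiber H ε) = 0 ∨ ∃ τ : Cell k, τ.carrier = signFiber H ε := by
  classical
  rcases (signFiber H ε).eq_empty_or_nonempty with he | ⟨p, hp⟩
  · left; rw [he, measure_empty]
  set V := Submodule.span ℝ (Set.range σ.frame) with hV
  have hpσ := hε hp
  -- If every equality in the sign pattern has its normal orthogonal to the plane, it is constant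
  -- there and the strict inequalities alone define the fiber, which is a cell. Otherwise some
  -- equality cuts the plane in a hyperplane and the fiber is null.
  by_cases hall : ∀ h : H, ε h = 0 → ∀ i, inner ℝ h.1.1 (σ.frame i) = (0 : ℝ)
  · right
    have horth : ∀ h : H, ε h = 0 → ∀ v ∈ V, inner ℝ h.1.1 v = (0 : ℝ) := by
      intro h hh v hv
      induction hv using Submodule.span_induction with
      | mem x hx => obtain ⟨i, rfl⟩ := hx; exact hall h hh i
      | zero => simp
      | add x y _ _ hx hy => rw [inner_add_right, hx, hy, add_zero]
      | smul a x _ hx => rw [inner_smul_right, hx, mul_zero]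
    let neg := (Finset.univ.filter fun h : H => ε h = -1).image fun h => h.1
    let pos := (Finset.univ.filter fun h : H => ε h = 1).image fun h => (-h.1.1, -h.1.2)
    refine ⟨⟨signFiber H ε, σ.frame, σ.orthonormal, ⟨p, neg ∪ pos, ?_⟩, ⟨p, hp⟩,
      σ.bounded.subset hε⟩, rfl⟩
    ext x
    simp only [neg, pos, Set.mem_ofPred_eq, Finset.forall_mem_union, Finset.forall_mem_image,
      Finset.mem_filter, Finset.mem_univ, true_and, inner_neg_left, neg_lt_neg_iff]
    constructor
    · intro hx
      refine ⟨σ.sub_mem_span (hε hx) hpσ, fun h hh => ?_, fun h hh => ?_⟩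
      · have := hx h
        rw [hh] at this
        exact sub_neg.1 (sign_eq_neg_one_iff.1 this)
      · have := hx h
        rw [hh] at this
        exact sub_pos.1 (sign_eq_one_iff.1 this)
    · rintro ⟨h1, h2, h3⟩ h
      rcases hs : ε h with _ | _ | _
      · have h4 := hp h
        rw [hs] at h4
        have h5 := horth h hs _ h1
        rw [inner_sub_right] at h5
        have h6 : inner ℝ h.1.1 p - h.1.2 = 0 := sign_eq_zero_iff.1 h4
        refine sign_eq_zero_iff.2 ?_
        linarith
      · exact sign_eq_neg_one_iff.2 (sub_neg.2 (h2 hs))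
      · exact sign_eq_one_iff.2 (sub_pos.2 (h3 hs))
  · left
    push Not at hall
    obtain ⟨h, hh, i, hi⟩ := hall
    have hsub : signFiber H ε ⊆ Set.range (param p σ.frame) := hε.trans (σ.subset_range hpσ)
    rw [measure_param σ.orthonormal hsub]
    refine measure_mono_null ?_ (volume_hyperplane_eq_zero
      (fun i => (inner ℝ h.1.1 (σ.frame i) : ℝ)) (fun h0 => hi (congrFun h0 i))
      (h.1.2 - inner ℝ h.1.1 p))
    intro u hu
    have h1 := hu h
    rw [hh] at h1
    have h2 := sign_eq_zero_iff.1 h1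
    simp only [param, inner_add_right, inner_sum, inner_smul_right] at h2
    simp only [Set.mem_ofPred_eq]
    linarith

lemma Cell.exists_sign_of_subset {k : ℕ} {σ τ : Cell k} (h : τ.carrier ⊆ σ.carrier) :
    ∃ e : ℤ, |e| = 1 ∧ ∀ ω : Form k,
      ∫ x in τ.carrier, ω.1 x σ.frame ∂μHE[k] = e * τ.toCurrent ω := by
  obtain ⟨e, he, h1⟩ :=
    exists_sign_of_span_eq σ.orthonormal τ.orthonormal (Cell.span_eq_of_subset h)
  refine ⟨e, he, fun ω => ?_⟩
  rw [Cell.toCurrent_apply, ← integral_const_mul]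
  exact integral_congr_ae (Eventually.of_forall fun x => h1 (ω.1 x))

/-- A finite family of cells has a common refinement by nonoverlapping cells. -/
theorem exists_refinement {k N : ℕ} (σ : Fin N → Cell k) :
    ∃ (M : ℕ) (τ : Fin M → Cell k) (c : Fin N → Fin M → ℤ), NonOverlapping τ ∧
      (∀ i, (σ i).toCurrent = ∑ j, c i j • (τ j).toCurrent) ∧
      (∀ i, ∑ j, |(c i j : ℝ)| * (τ j).mass ≤ (σ i).mass) ∧
      ∀ j, ∃ i, (τ j).carrier ⊆ (σ i).carrier := by
  classical
  choose H₀ hH₀ using fun i => (σ i).exists_cutBy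
  set H := Finset.univ.biUnion H₀
  have hH : ∀ i, (σ i).CutBy H := fun i =>
    (hH₀ i).mono (Finset.subset_biUnion_of_mem H₀ (Finset.mem_univ i))
  -- The sign fibers kept as cells of the refinement. Every other fiber meets each `σ i` in a null
  -- set.
  let Good : (H → SignType) → Prop := fun ε => (∃ τ : Cell k, τ.carrier = signFiber H ε) ∧
    ∃ i, signFiber H ε ⊆ (σ i).carrier
  let ι := {ε // Good ε}
  choose τ hτ using fun ε : ι => ε.2.1
  -- The coefficient is `±1`, by comparison of orientations, if the fiber lies in `σ i`, and `0` if
  -- it misses `σ i`; no other case occurs.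
  have hsign : ∀ (i : Fin N) (ε : ι), ∃ e : ℤ,
      (∀ ω : Form k, ∫ x in (σ i).carrier ∩ signFiber H ε.1, ω.1 x (σ i).frame ∂μHE[k] =
        e * (τ ε).toCurrent ω) ∧ |(e : ℝ)| * (τ ε).mass ≤
          (μHE[k] ((σ i).carrier ∩ signFiber H ε.1)).toReal := by
    intro i ε
    rcases (hH i).subset_or_disjoint ε.1 with h | h
    · obtain ⟨e, he, h1⟩ := Cell.exists_sign_of_subset (σ := σ i) (τ := τ ε) (by rw [hτ]; exact h)
      have he' : |(e : ℝ)| = 1 := by exact_mod_cast he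
      refine ⟨e, fun ω => ?_, ?_⟩
      · rw [Set.inter_eq_right.2 h, ← h1, hτ]
      · rw [Set.inter_eq_right.2 h, he', one_mul, ← hτ]
        rfl
    · exact ⟨0, fun ω => by simp [h], by simp⟩
  choose c hc2 hc3 using hsign
  have hpart : ∀ i, (σ i).carrier = ⋃ ε : H → SignType, (σ i).carrier ∩ signFiber H ε := fun i => by
    rw [← Set.inter_iUnion, iUnion_signFiber, Set.inter_univ]
  have hmeas : ∀ i, ∀ ε : H → SignType, MeasurableSet ((σ i).carrier ∩ signFiber H ε) :=
    fun i ε => (σ i).measurableSet.inter (measurableSet_signFiber H ε)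
  have hdisj : ∀ i, Pairwise (Function.onFun Disjoint
      fun ε : H → SignType => (σ i).carrier ∩ signFiber H ε) := fun i ε ε' h =>
    (disjoint_signFiber h).mono Set.inter_subset_right Set.inter_subset_right
  have hbad : ∀ i, ∀ ε : H → SignType, ¬ Good ε →
      μHE[k] ((σ i).carrier ∩ signFiber H ε) = 0 := fun i ε hε => by
    rcases (hH i).subset_or_disjoint ε with h | h
    · rcases (σ i).signFiber_null_or_cell h with h1 | h1
      · exact measure_mono_null Set.inter_subset_right h1
      · exact absurd ⟨h1, i, h⟩ hε
    · rw [h, measure_empty]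
  have hsum : ∀ φ : (H → SignType) → ℝ, (∀ ε, ¬ Good ε → φ ε = 0) →
      ∑ ε, φ ε = ∑ ε : ι, φ ε.1 := fun φ hφ => by
    rw [← Finset.sum_filter_of_ne (p := Good) (fun ε _ h => by_contra fun h1 => h (hφ ε h1))]
    exact (Finset.sum_subtype (Finset.univ.filter Good) (by simp) φ)
  let e := Fintype.equivFin ι
  refine ⟨Fintype.card ι, fun j => τ (e.symm j), fun i j => c i (e.symm j), ?_, ?_, ?_, ?_⟩
  · intro j j' hj
    have h1 : (e.symm j).1 ≠ (e.symm j').1 := fun h => hj (e.symm.injective (Subtype.ext h))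
    rw [hτ, hτ, (disjoint_signFiber h1).inter_eq, measure_empty]
  · intro i
    funext ω
    rw [e.symm.sum_comp (fun ε => c i ε • (τ ε).toCurrent), Finset.sum_apply]
    simp only [Pi.smul_apply, zsmul_eq_mul]
    simp_rw [← hc2]
    have h1 := integral_iUnion_fintype (hmeas i) (hdisj i)
      (f := fun x => ω.1 x (σ i).frame) (μ := μHE[k])
      (fun ε => ((σ i).integrableOn_form ω _).mono_set Set.inter_subset_left)
    rw [← hpart i] at h1
    rw [Cell.toCurrent_apply, h1]
    refine hsum (fun ε => ∫ x in (σ i).carrier ∩ signFiber H ε, ω.1 x (σ i).frame ∂μHE[k])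
      fun ε hε => ?_
    exact setIntegral_measure_zero _ (hbad i ε hε)
  · intro i
    rw [e.symm.sum_comp (fun ε => |(c i ε : ℝ)| * (τ ε).mass)]
    refine (Finset.sum_le_sum fun ε _ => hc3 i ε).trans ?_
    rw [← hsum (fun ε => (μHE[k] ((σ i).carrier ∩ signFiber H ε)).toReal)
      (fun ε hε => by rw [hbad i ε hε, ENNReal.toReal_zero])]
    rw [← ENNReal.toReal_sum]
    · have h1 := measure_iUnion (μ := μHE[k]) (hdisj i) (hmeas i)
      rw [← hpart i, tsum_fintype] at h1
      rw [← h1]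
      rfl
    · exact fun ε _ => ((measure_mono Set.inter_subset_left).trans_lt (σ i).measure_lt_top).ne
  · intro j
    obtain ⟨i, hi⟩ := (e.symm j).2.2
    exact ⟨i, by rw [hτ]; exact hi⟩

/-! ### Homomorphisms between groups of polyhedral chains -/

/-- The translate of a cell. -/
def Cell.translate {k : ℕ} (v : R4) (σ : Cell k) : Cell k where
  carrier := (fun x => x + v) '' σ.carrier
  frame := σ.frame
  orthonormal := σ.orthonormal
  halfSpaces := by
    classical
    obtain ⟨p, H, h⟩ := σ.halfSpaces
    refine ⟨p + v, H.image fun h => (h.1, h.2 + inner ℝ h.1 v), ?_⟩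
    ext y
    simp only [Set.mem_image, Set.mem_ofPred_eq, Finset.forall_mem_image, h]
    constructor
    · rintro ⟨x, hx, rfl⟩
      refine ⟨by simpa using hx.1, fun g hg => ?_⟩
      rw [inner_add_right]
      linarith [hx.2 g hg]
    · rintro ⟨h1, h2⟩
      refine ⟨y - v, ⟨?_, fun g hg => ?_⟩, sub_add_cancel _ _⟩
      · rwa [sub_sub, add_comm v]
      · have := h2 hg
        rw [inner_sub_right]
        linarith
  nonempty := σ.nonempty.image _
  bounded := by
    obtain ⟨C, hC⟩ := (Metric.isBounded_iff).1 σ.bounded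
    refine Metric.isBounded_iff.2 ⟨C, ?_⟩
    rintro _ ⟨x, hx, rfl⟩ _ ⟨y, hy, rfl⟩
    simpa using hC hx hy

lemma Cell.mass_translate {k : ℕ} (v : R4) (σ : Cell k) : (σ.translate v).mass = σ.mass := by
  have h : Isometry fun x : R4 => x + v := (IsometryEquiv.addRight v).isometry
  exact congrArg ENNReal.toReal (h.euclideanHausdorffMeasure_image σ.carrier)

lemma Cell.toCurrent_translate {k : ℕ} (v : R4) (σ : Cell k) :
    (σ.translate v).toCurrent = Dipolyhedra.translate v σ.toCurrent := by
  funext ω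
  have h := ((IsometryEquiv.addRight v : R4 ≃ᵢ R4).measurePreserving_euclideanHausdorffMeasure
    k).setIntegral_image_emb (IsometryEquiv.addRight v : R4 ≃ᵢ R4).toHomeomorph.measurableEmbedding
    (fun x => ω.1 x σ.frame) σ.carrier
  exact h

lemma polyChains_le {k l : ℕ} {f : Current k →+ Current l}
    (hf : ∀ σ : Cell k, f σ.toCurrent ∈ polyChains l) {A : Current k} (hA : A ∈ polyChains k) :
    f A ∈ polyChains l := by
  have : polyChains k ≤ (polyChains l).comap f := by
    rw [polyChains, AddSubgroup.closure_le]
    rintro _ ⟨σ, rfl⟩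
    exact hf σ
  exact this hA

lemma Cell.mem_polyChains {k : ℕ} (σ : Cell k) : σ.toCurrent ∈ polyChains k :=
  AddSubgroup.subset_closure ⟨σ, rfl⟩

/-- A cell as a polyhedral chain. -/
def Cell.chain {k : ℕ} (σ : Cell k) : polyChains k := ⟨σ.toCurrent, σ.mem_polyChains⟩

/-- The homomorphism of groups of polyhedral chains induced by a homomorphism of currents. -/
def chainMap {k l : ℕ} (f : Current k →+ Current l)
    (hf : ∀ σ : Cell k, f σ.toCurrent ∈ polyChains l) : polyChains k →ₗ[ℤ] polyChains l :=
  (AddMonoidHom.mk' (fun A : polyChains k => (⟨f (A : Current k), polyChains_le hf A.2⟩ : polyChains l))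
    fun A B => Subtype.ext (map_add f (A : Current k) B)).toIntLinearMap

/-- The boundary operator on polyhedral chains. -/
def chainBdry (k : ℕ) : polyChains (k + 1) →ₗ[ℤ] polyChains k :=
  chainMap ⟨⟨bdry, rfl⟩, fun _ _ => rfl⟩ fun σ => by
    refine AddSubgroup.closure_mono ?_ σ.bdry_mem
    rintro _ ⟨τ, -, rfl⟩
    exact ⟨τ, rfl⟩

/-- The translation operator on polyhedral chains. -/
def chainTranslate (k : ℕ) (w : R4) : polyChains k →ₗ[ℤ] polyChains k :=
  chainMap ⟨⟨translate w, rfl⟩, fun _ _ => rfl⟩ fun σ => by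
    change translate w σ.toCurrent ∈ _
    rw [← σ.toCurrent_translate w]
    exact Cell.mem_polyChains _

lemma Cell.sweep_mem {k : ℕ} (σ : Cell k) (w : R4) :
    sweep w σ.toCurrent ∈ polyChains (k + 1) := by
  by_cases hw : w ∈ Submodule.span ℝ (Set.range σ.frame)
  · rw [σ.sweep_eq_zero hw]
    exact AddSubgroup.zero_mem _
  · obtain ⟨σ', h, -⟩ := σ.exists_sweep_eq hw
    rw [h]
    exact σ'.mem_polyChains

/-- The sweeping operator on polyhedral chains. -/
def chainSweep (k : ℕ) (w : R4) : polyChains k →ₗ[ℤ] polyChains (k + 1) :=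
  chainMap ⟨⟨sweep w, rfl⟩, fun _ _ => rfl⟩ fun σ => σ.sweep_mem w

lemma polyChains_hom_ext {k : ℕ} {M : Type*} [AddCommGroup M] {f g : polyChains k →ₗ[ℤ] M}
    (h : ∀ σ : Cell k, f σ.chain = g σ.chain) : f = g := by
  refine LinearMap.ext fun ⟨A, hA⟩ => ?_
  induction hA using AddSubgroup.closure_induction with
  | mem x hx => obtain ⟨σ, rfl⟩ := hx; exact h σ
  | zero => exact (map_zero f).trans (map_zero g).symm
  | add x y hx hy h1 h2 =>
    have : (⟨x + y, AddSubgroup.add_mem _ hx hy⟩ : polyChains k) = ⟨x, hx⟩ + ⟨y, hy⟩ := rfl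
    exact (this ▸ map_add f _ _).trans ((congrArg₂ (· + ·) h1 h2).trans (map_add g _ _).symm)
  | neg x hx h1 =>
    have : (⟨-x, AddSubgroup.neg_mem _ hx⟩ : polyChains k) = -⟨x, hx⟩ := rfl
    exact (this ▸ map_neg f _).trans ((congrArg Neg.neg h1).trans (map_neg g _).symm)

/-- The homotopy formula for polyhedral chains. -/
lemma chainSweep_homotopy (k : ℕ) (w : R4) :
    (chainSweep k w).comp (chainBdry k) = chainTranslate (k + 1) w - LinearMap.id -
      (chainBdry (k + 1)).comp (chainSweep (k + 1) w) := by
  refine polyChains_hom_ext fun σ => Subtype.ext (funext fun ω => ?_)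
  change σ.toCurrent (ω.sweep w).d = σ.toCurrent (ω.translate w) - σ.toCurrent ω -
    σ.toCurrent (ω.d.sweep w)
  simp only [Cell.toCurrent_apply]
  rw [← integral_sub (σ.integrableOn_form _ _) (σ.integrableOn_form _ _), ← integral_sub]
  · congr 1
    funext x
    have h := congrArg (fun f => f σ.frame) (ω.sweep_homotopy w x)
    change (ω.d.sweep w).1 x σ.frame + (ω.sweep w).d.1 x σ.frame =
      ω.1 (x + w) σ.frame - ω.1 x σ.frame at h
    change _ = ω.1 (x + w) σ.frame - ω.1 x σ.frame - _
    linarith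
  · exact (σ.integrableOn_form (ω.translate w) _).sub (σ.integrableOn_form _ _)
  · exact σ.integrableOn_form _ _

lemma chainBdry_comp (k : ℕ) : (chainBdry k).comp (chainBdry (k + 1)) = 0 := by
  refine polyChains_hom_ext fun σ => Subtype.ext (funext fun ω => ?_)
  change σ.toCurrent ω.d.d = 0
  simp only [Cell.toCurrent_apply]
  simp [Form.d_d]

/-! ### Chains of vanishing flat norm -/

section FlatNull

variable {G : Type*} [NormedAddCommGroup G]

/-- The chain `X` with coefficients in `G` is a sum of cells of total mass at most `r`. -/
def HasMassLE {k : ℕ} (X : G ⊗[ℤ] polyChains k) (r : ℝ) : Prop :=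
  ∃ (N : ℕ) (g : Fin N → G) (σ : Fin N → Cell k),
    X = ∑ i, g i ⊗ₜ[ℤ] (σ i).chain ∧ ∑ i, ‖g i‖ * (σ i).mass ≤ r

lemma HasMassLE.zero {k : ℕ} : HasMassLE (0 : G ⊗[ℤ] polyChains k) 0 :=
  ⟨0, Fin.elim0, Fin.elim0, by simp, by simp⟩

lemma HasMassLE.single {k : ℕ} (g : G) (σ : Cell k) :
    HasMassLE (g ⊗ₜ[ℤ] σ.chain) (‖g‖ * σ.mass) :=
  ⟨1, fun _ => g, fun _ => σ, by simp, by simp⟩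

lemma HasMassLE.mono {k : ℕ} {X : G ⊗[ℤ] polyChains k} {r s : ℝ} (h : HasMassLE X r)
    (hrs : r ≤ s) : HasMassLE X s := by
  obtain ⟨N, g, σ, h1, h2⟩ := h
  exact ⟨N, g, σ, h1, h2.trans hrs⟩

lemma HasMassLE.nonneg {k : ℕ} {X : G ⊗[ℤ] polyChains k} {r : ℝ} (h : HasMassLE X r) :
    0 ≤ r := by
  obtain ⟨N, g, σ, -, h2⟩ := h
  exact (Finset.sum_nonneg fun i _ => mul_nonneg (norm_nonneg _) (σ i).mass_nonneg).trans h2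

lemma HasMassLE.add {k : ℕ} {X Y : G ⊗[ℤ] polyChains k} {r s : ℝ} (hX : HasMassLE X r)
    (hY : HasMassLE Y s) : HasMassLE (X + Y) (r + s) := by
  obtain ⟨N, g, σ, rfl, h2⟩ := hX
  obtain ⟨N', g', σ', rfl, h2'⟩ := hY
  refine ⟨N + N', Fin.append g g', Fin.append σ σ', ?_, ?_⟩
  · simp [Fin.sum_univ_add]
  · simp only [Fin.sum_univ_add, Fin.append_left, Fin.append_right]
    exact add_le_add h2 h2'

lemma HasMassLE.neg {k : ℕ} {X : G ⊗[ℤ] polyChains k} {r : ℝ} (hX : HasMassLE X r) :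
    HasMassLE (-X) r := by
  obtain ⟨N, g, σ, rfl, h2⟩ := hX
  exact ⟨N, fun i => -g i, σ, by simp [TensorProduct.neg_tmul], by simpa using h2⟩

lemma HasMassLE.sum {k N : ℕ} {X : Fin N → G ⊗[ℤ] polyChains k} {r : Fin N → ℝ}
    (h : ∀ i, HasMassLE (X i) (r i)) : HasMassLE (∑ i, X i) (∑ i, r i) := by
  induction N with
  | zero => simpa using HasMassLE.zero
  | succ N ih =>
    rw [Fin.sum_univ_succ, Fin.sum_univ_succ]
    exact (h 0).add (ih fun i => h i.succ)

/-- Overlapping representations are allowed, so a mass bound on single cells extends termwise to all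
chains. -/
lemma HasMassLE.lTensor {k l : ℕ} {f : polyChains k →ₗ[ℤ] polyChains l} {C : ℝ}
    (hf : ∀ (g : G) (σ : Cell k), HasMassLE (g ⊗ₜ[ℤ] f σ.chain) (C * (‖g‖ * σ.mass)))
    (hC : 0 ≤ C) {X : G ⊗[ℤ] polyChains k} {r : ℝ} (hX : HasMassLE X r) :
    HasMassLE (f.lTensor G X) (C * r) := by
  obtain ⟨N, g, σ, rfl, h2⟩ := hX
  rw [map_sum]
  simp only [LinearMap.lTensor_tmul]
  refine (HasMassLE.sum fun i => hf (g i) (σ i)).mono ?_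
  rw [← Finset.mul_sum]
  exact mul_le_mul_of_nonneg_left h2 hC

lemma HasMassLE.sweep {k : ℕ} {X : G ⊗[ℤ] polyChains k} {r : ℝ} (hX : HasMassLE X r) (w : R4) :
    HasMassLE ((chainSweep k w).lTensor G X) (‖w‖ * r) := by
  refine hX.lTensor (fun g σ => ?_) (norm_nonneg w)
  by_cases hw : w ∈ Submodule.span ℝ (Set.range σ.frame)
  · have : chainSweep k w σ.chain = 0 := Subtype.ext (σ.sweep_eq_zero hw)
    rw [this, TensorProduct.tmul_zero]
    exact HasMassLE.zero.mono (mul_nonneg (norm_nonneg _)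
      (mul_nonneg (norm_nonneg _) σ.mass_nonneg))
  · obtain ⟨σ', h, hm, -⟩ := σ.exists_sweep_eq hw
    have : chainSweep k w σ.chain = σ'.chain := Subtype.ext h
    rw [this]
    refine (HasMassLE.single g σ').mono ?_
    calc ‖g‖ * σ'.mass ≤ ‖g‖ * (‖w‖ * σ.mass) := mul_le_mul_of_nonneg_left hm (norm_nonneg _)
      _ = ‖w‖ * (‖g‖ * σ.mass) := by ring

lemma HasMassLE.translate {k : ℕ} {X : G ⊗[ℤ] polyChains k} {r : ℝ} (hX : HasMassLE X r)
    (w : R4) : HasMassLE ((chainTranslate k w).lTensor G X) r := by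
  rw [← one_mul r]
  refine hX.lTensor (fun g σ => ?_) zero_le_one
  have : chainTranslate k w σ.chain = (σ.translate w).chain :=
    Subtype.ext (σ.toCurrent_translate w).symm
  rw [this, one_mul, ← σ.mass_translate w]
  exact HasMassLE.single g _

/-- The chain `X` has vanishing flat norm. -/
def FlatNull {k : ℕ} (X : G ⊗[ℤ] polyChains k) : Prop :=
  ∀ ε > 0, ∃ (Y : G ⊗[ℤ] polyChains k) (Z : G ⊗[ℤ] polyChains (k + 1)) (r s : ℝ),
    HasMassLE Y r ∧ HasMassLE Z s ∧ X = Y + (chainBdry k).lTensor G Z ∧ r + s < ε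

/-- By the homotopy formula the sweep of `∂Z` is `T_w Z - Z` minus the boundary of the sweep of `Z`.
The decomposition `Y + ∂Z` becomes one of total mass at most `(‖w‖ + 2)(r + s)`. -/
lemma FlatNull.sweep {k : ℕ} {X : G ⊗[ℤ] polyChains k} (hX : FlatNull X) (w : R4) :
    FlatNull ((chainSweep k w).lTensor G X) := by
  intro ε hε
  have hC : 0 < ‖w‖ + 2 := by positivity
  obtain ⟨Y, Z, r, s, hY, hZ, rfl, hrs⟩ := hX (ε / (‖w‖ + 2)) (by positivity)
  refine ⟨(chainSweep k w).lTensor G Y + ((chainTranslate (k + 1) w).lTensor G Z + -Z),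
    -(chainSweep (k + 1) w).lTensor G Z, ‖w‖ * r + (s + s), ‖w‖ * s,
    (hY.sweep w).add ((hZ.translate w).add hZ.neg), (hZ.sweep w).neg, ?_, ?_⟩
  · have h := congrArg (fun f => LinearMap.lTensor G f Z) (chainSweep_homotopy k w)
    simp only [LinearMap.lTensor_comp, LinearMap.lTensor_sub, LinearMap.comp_apply,
      LinearMap.sub_apply, LinearMap.lTensor_id, LinearMap.id_apply] at h
    rw [map_add, h, map_neg]
    abel
  · have hr := hY.nonneg
    have hs := hZ.nonneg
    calc ‖w‖ * r + (s + s) + ‖w‖ * s ≤ (‖w‖ + 2) * (r + s) := by nlinarith [norm_nonneg w]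
      _ < (‖w‖ + 2) * (ε / (‖w‖ + 2)) := mul_lt_mul_of_pos_left hrs hC
      _ = ε := by field_simp

end FlatNull

/-! ### The multiplicity of a top-dimensional chain -/

lemma exists_alternating_apply_eq_one {k : ℕ} {b : Fin k → R4} (hb : Orthonormal ℝ b) :
    ∃ f : R4 [⋀^Fin k]→L[ℝ] ℝ, f b = 1 := by
  induction k with
  | zero => exact ⟨ContinuousAlternatingMap.constOfIsEmpty ℝ R4 (Fin 0) 1, rfl⟩
  | succ k ih =>
    have hb' : Orthonormal ℝ (Fin.cons (b 0) (Fin.tail b) : Fin (k + 1) → R4) := by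
      rwa [Fin.cons_self_tail]
    obtain ⟨f, hf⟩ := ih (orthonormal_tail hb')
    refine ⟨wedgeInner (b 0) f, ?_⟩
    rw [← hf, ← wedgeInner_cons hb' f, Fin.cons_self_tail]

/-- A volume form on `ℝ⁴`. -/
def volumeForm : R4 [⋀^Fin 4]→L[ℝ] ℝ :=
  (exists_alternating_apply_eq_one (EuclideanSpace.basisFun (Fin 4) ℝ).orthonormal).choose

lemma span_eq_top_of_orthonormal {b : Fin 4 → R4} (hb : Orthonormal ℝ b) :
    Submodule.span ℝ (Set.range b) = ⊤ :=
  Submodule.eq_top_of_finrank_eq (by rw [finrank_span_frame hb, finrank_euclideanSpace_fin])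

lemma exists_volumeForm_apply {b : Fin 4 → R4} (hb : Orthonormal ℝ b) :
    ∃ e : ℤ, |e| = 1 ∧ volumeForm b = e := by
  obtain ⟨e, he, h⟩ := exists_sign_of_span_eq hb (EuclideanSpace.basisFun (Fin 4) ℝ).orthonormal
    ((span_eq_top_of_orthonormal hb).trans (span_eq_top_of_orthonormal
      (EuclideanSpace.basisFun (Fin 4) ℝ).orthonormal).symm)
  refine ⟨e, he, ?_⟩
  rw [h, volumeForm, (exists_alternating_apply_eq_one
    (EuclideanSpace.basisFun (Fin 4) ℝ).orthonormal).choose_spec, mul_one]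

/-- The form `ρ dx₁ ∧ dx₂ ∧ dx₃ ∧ dx₄`. -/
def densityForm (ρ : R4 → ℝ) (hρ : ContDiff ℝ (⊤ : ℕ∞) ρ) : Form 4 :=
  ⟨fun x => ρ x • volumeForm, hρ.smul contDiff_const⟩

/-- The function `f` is the multiplicity of the chain `P`. -/
def IsMultiplicity (P : Current 4) (f : R4 → ℤ) : Prop :=
  LocallyIntegrable (fun x => (f x : ℝ)) ∧ ∀ (ρ : R4 → ℝ) (hρ : ContDiff ℝ (⊤ : ℕ∞) ρ),
    HasCompactSupport ρ → P (densityForm ρ hρ) = ∫ x, ρ x • (f x : ℝ)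

/-- Compactly supported smooth densities determine a locally integrable function almost everywhere.
This uniqueness is what makes `multiplicity` additive on germs. -/
lemma IsMultiplicity.ae_eq {P : Current 4} {f g : R4 → ℤ} (hf : IsMultiplicity P f)
    (hg : IsMultiplicity P g) : f =ᵐ[volume] g := by
  filter_upwards [ae_eq_of_integral_contDiff_smul_eq hf.1 hg.1 fun ρ hρ hρ' =>
    (hf.2 ρ hρ hρ').symm.trans (hg.2 ρ hρ hρ')] with x hx
  exact_mod_cast hx

lemma IsMultiplicity.add {P Q : Current 4} {f g : R4 → ℤ} (hf : IsMultiplicity P f)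
    (hg : IsMultiplicity Q g) : IsMultiplicity (P + Q) (f + g) := by
  have h : (fun x => ((f + g) x : ℝ)) = (fun x => (f x : ℝ)) + fun x => (g x : ℝ) := by
    funext x; simp
  refine ⟨h ▸ hf.1.add hg.1, fun ρ hρ hρ' => ?_⟩
  rw [Pi.add_apply, hf.2 ρ hρ hρ', hg.2 ρ hρ hρ', ← integral_add
    (hf.1.integrable_smul_left_of_hasCompactSupport hρ.continuous hρ')
    (hg.1.integrable_smul_left_of_hasCompactSupport hρ.continuous hρ')]
  congr 1
  funext x
  simp [mul_add]

lemma IsMultiplicity.neg {P : Current 4} {f : R4 → ℤ} (hf : IsMultiplicity P f) :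
    IsMultiplicity (-P) (-f) := by
  have h : (fun x => ((-f) x : ℝ)) = -(fun x => (f x : ℝ)) := by
    funext x; simp
  refine ⟨h ▸ hf.1.neg, fun ρ hρ hρ' => ?_⟩
  rw [Pi.neg_apply, hf.2 ρ hρ hρ', ← integral_neg]
  congr 1
  funext x
  simp

lemma IsMultiplicity.zero : IsMultiplicity 0 0 :=
  ⟨by simpa using locallyIntegrable_zero, fun ρ hρ _ => by simp⟩

lemma volume_eq_hausdorff : (volume : Measure R4) = μHE[4] :=
  (EuclideanSpace.euclideanHausdorffMeasure_eq_volume 4).symm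

lemma Cell.exists_isMultiplicity (σ : Cell 4) : ∃ e : ℤ, |e| = 1 ∧
    IsMultiplicity σ.toCurrent (σ.carrier.indicator fun _ => e) := by
  obtain ⟨e, he, h⟩ := exists_volumeForm_apply σ.orthonormal
  have hi : (fun x => ((σ.carrier.indicator (fun _ => e) x : ℤ) : ℝ)) =
      σ.carrier.indicator fun _ => (e : ℝ) := by
    funext x
    by_cases hx : x ∈ σ.carrier <;> simp [hx]
  refine ⟨e, he, ?_, fun ρ hρ hρ' => ?_⟩
  · rw [hi]
    refine Integrable.locallyIntegrable (IntegrableOn.integrable_indicator ?_ σ.measurableSet)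
    rw [volume_eq_hausdorff]
    exact σ.integrableOn continuous_const
  · rw [Cell.toCurrent_apply, ← volume_eq_hausdorff, ← integral_indicator σ.measurableSet]
    congr 1
    funext x
    rw [congrFun hi x]
    by_cases hx : x ∈ σ.carrier
    · simp only [Set.indicator_of_mem hx]
      change ρ x • volumeForm σ.frame = _
      rw [h]
    · simp [hx]

lemma exists_isMultiplicity {P : Current 4} (hP : P ∈ polyChains 4) :
    ∃ f, IsMultiplicity P f := by
  induction hP using AddSubgroup.closure_induction with
  | mem x hx =>
    obtain ⟨σ, rfl⟩ := hx
    obtain ⟨e, -, h⟩ := σ.exists_isMultiplicity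
    exact ⟨_, h⟩
  | zero => exact ⟨0, IsMultiplicity.zero⟩
  | add x y _ _ hx hy =>
    obtain ⟨f, hf⟩ := hx
    obtain ⟨g, hg⟩ := hy
    exact ⟨_, hf.add hg⟩
  | neg x _ hx =>
    obtain ⟨f, hf⟩ := hx
    exact ⟨_, hf.neg⟩

/-- The multiplicity of a top-dimensional chain, up to null sets. -/
def multiplicity : polyChains 4 →+ (ae (volume : Measure R4)).Germ ℤ :=
  AddMonoidHom.mk' (fun P => ((exists_isMultiplicity P.2).choose : R4 → ℤ)) fun P Q =>
    Germ.coe_eq.2 (((exists_isMultiplicity (P + Q).2).choose_spec).ae_eq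
      ((exists_isMultiplicity P.2).choose_spec.add (exists_isMultiplicity Q.2).choose_spec))

lemma multiplicity_eq {P : polyChains 4} {f : R4 → ℤ} (hf : IsMultiplicity (P : Current 4) f) :
    multiplicity P = (f : (ae (volume : Measure R4)).Germ ℤ) :=
  Germ.coe_eq.2 ((exists_isMultiplicity P.2).choose_spec.ae_eq hf)

/-! ### Multiplicities with coefficients in `G` and the top-dimensional case -/

section Coefficients

variable {G : Type*} [NormedAddCommGroup G]

/-- The multiplicity of a top-dimensional chain with coefficients in `G`, up to null sets. -/
def coeffMultiplicity : G ⊗[ℤ] polyChains 4 →+ (ae (volume : Measure R4)).Germ G :=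
  TensorProduct.liftAddHom
    (AddMonoidHom.mk' (fun g => AddMonoidHom.mk'
      (fun P => (multiplicity P).map fun n : ℤ => n • g) fun P Q => by
        rw [map_add]
        induction multiplicity P using Germ.inductionOn with | _ f
        induction multiplicity Q using Germ.inductionOn with | _ f'
        exact congrArg _ (funext fun x => add_smul (f x) (f' x) g)) fun g g' => by
        ext P
        change Germ.map (fun n : ℤ => n • (g + g')) (multiplicity P) =
          Germ.map (fun n : ℤ => n • g) (multiplicity P) +
            Germ.map (fun n : ℤ => n • g') (multiplicity P)
        induction multiplicity P using Germ.inductionOn with | _ f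
        exact congrArg _ (funext fun x => smul_add (f x) g g'))
    fun n g P => by
      change Germ.map _ (multiplicity P) = Germ.map _ (multiplicity (n • P))
      rw [map_zsmul]
      induction multiplicity P using Germ.inductionOn with | _ f
      refine congrArg _ (funext fun x => ?_)
      change f x • n • g = (n • f x) • g
      rw [smul_smul, smul_eq_mul, mul_comm]

lemma coeffMultiplicity_tmul (g : G) (σ : Cell 4) : ∃ e : ℤ, |e| = 1 ∧
    coeffMultiplicity (g ⊗ₜ[ℤ] σ.chain) =
      ((σ.carrier.indicator fun _ => e • g : R4 → G) : (ae (volume : Measure R4)).Germ G) := by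
  obtain ⟨e, he, h⟩ := σ.exists_isMultiplicity
  refine ⟨e, he, ?_⟩
  change Germ.map _ (multiplicity σ.chain) = _
  rw [multiplicity_eq (P := σ.chain) h]
  refine congrArg _ (funext fun x => ?_)
  by_cases hx : x ∈ σ.carrier <;> simp [hx]

lemma norm_zsmul_of_abs_eq_one {e : ℤ} (he : |e| = 1) (g : G) : ‖e • g‖ = ‖g‖ := by
  rcases (abs_eq zero_le_one).1 he with rfl | rfl <;> simp

/-- Pointwise triangle inequality: the norm of the multiplicity is at most a sum of multiples of
indicators of cells, whose integral is the mass. No measurability of `h` itself is needed. -/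
lemma HasMassLE.exists_coeffMultiplicity {X : G ⊗[ℤ] polyChains 4} {r : ℝ} (hX : HasMassLE X r) :
    ∃ h : R4 → G, coeffMultiplicity X = (h : (ae (volume : Measure R4)).Germ G) ∧
      ∫⁻ x, ‖h x‖ₑ ≤ ENNReal.ofReal r := by
  obtain ⟨N, g, σ, rfl, hr⟩ := hX
  choose e he h using fun i => coeffMultiplicity_tmul (g i) (σ i)
  refine ⟨∑ i, (σ i).carrier.indicator fun _ => e i • g i, ?_, ?_⟩
  · rw [map_sum, Finset.sum_congr rfl fun i _ => h i]
    exact (map_sum (Germ.coeAddHom (ae (volume : Measure R4)) : (R4 → G) →+ _) _ _).symm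
  · calc ∫⁻ x, ‖(∑ i, (σ i).carrier.indicator fun _ => e i • g i) x‖ₑ
        ≤ ∫⁻ x, ∑ i, (σ i).carrier.indicator (fun _ => ‖g i‖ₑ) x := by
          refine lintegral_mono fun x => ?_
          rw [Finset.sum_apply]
          refine (enorm_sum_le _ _).trans (Finset.sum_le_sum fun i _ => ?_)
          by_cases hx : x ∈ (σ i).carrier
          · simp only [Set.indicator_of_mem hx]
            rw [← ofReal_norm, norm_zsmul_of_abs_eq_one (he i), ofReal_norm]
          · simp [hx]
      _ = ∑ i, ENNReal.ofReal (‖g i‖ * (σ i).mass) := by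
          rw [lintegral_finsetSum _ fun i _ => measurable_const.indicator (σ i).measurableSet]
          refine Finset.sum_congr rfl fun i _ => ?_
          rw [lintegral_indicator (σ i).measurableSet, setLIntegral_const,
            ENNReal.ofReal_mul (norm_nonneg _), ofReal_norm, volume_eq_hausdorff,
            (σ i).ofReal_mass]
      _ ≤ ENNReal.ofReal r := by
          rw [← ENNReal.ofReal_sum_of_nonneg fun i _ =>
            mul_nonneg (norm_nonneg _) (σ i).mass_nonneg]
          exact ENNReal.ofReal_le_ofReal hr

lemma isEmpty_cell {k : ℕ} (hk : 4 < k) : IsEmpty (Cell k) :=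
  ⟨fun σ => by
    have h := Submodule.finrank_le (Submodule.span ℝ (Set.range σ.frame))
    rw [finrank_span_frame σ.orthonormal, finrank_euclideanSpace_fin] at h
    omega⟩

/-- There are no `5`-cells in `ℝ⁴`, so the filling `Z` is zero and smallness of the flat norm is
smallness of the mass. -/
lemma FlatNull.lintegral_eq_zero {X : G ⊗[ℤ] polyChains 4} (hX : FlatNull X) {h : R4 → G}
    (hh : coeffMultiplicity X = (h : (ae (volume : Measure R4)).Germ G)) :
    ∫⁻ x, ‖h x‖ₑ = 0 := by
  have := isEmpty_cell (k := 5) (by norm_num)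
  refine le_antisymm (le_of_forall_pos_le_add fun ε hε => ?_) zero_le
  rcases eq_or_ne ε ⊤ with rfl | hε'
  · simp
  obtain ⟨Y, Z, r, s, hY, hZ, rfl, hrs⟩ := hX ε.toReal (ENNReal.toReal_pos hε.ne' hε')
  have hs := hZ.nonneg
  obtain ⟨N, g, σ, rfl, -⟩ := hZ
  have hN : IsEmpty (Fin N) := ⟨fun i => this.elim (σ i)⟩
  rw [Finset.univ_eq_empty, Finset.sum_empty, map_zero, add_zero] at hh
  obtain ⟨h', h1, h2⟩ := hY.exists_coeffMultiplicity
  have h3 : h =ᵐ[volume] h' := Germ.coe_eq.1 (hh.symm.trans h1)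
  calc ∫⁻ x, ‖h x‖ₑ = ∫⁻ x, ‖h' x‖ₑ := lintegral_congr_ae (h3.mono fun x hx => by simp only [hx])
    _ ≤ ENNReal.ofReal r := h2
    _ ≤ ENNReal.ofReal ε.toReal := ENNReal.ofReal_le_ofReal (by linarith)
    _ = 0 + ε := by rw [ENNReal.ofReal_toReal hε', zero_add]

/-- The group of chains generated by cells off the set `U`. -/
def offChains (G : Type*) [NormedAddCommGroup G] (k : ℕ) (U : Set R4) :
    AddSubgroup (G ⊗[ℤ] polyChains k) :=
  AddSubgroup.closure {X | ∃ (g : G) (σ : Cell k), Disjoint σ.carrier U ∧ X = g ⊗ₜ[ℤ] σ.chain}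

lemma exists_coeffMultiplicity_of_mem_offChains {U : Set R4} {X : G ⊗[ℤ] polyChains 4}
    (hX : X ∈ offChains G 4 U) :
    ∃ h : R4 → G, coeffMultiplicity X = (h : (ae (volume : Measure R4)).Germ G) ∧
      ∀ x ∈ U, h x = 0 := by
  induction hX using AddSubgroup.closure_induction with
  | mem x hx =>
    obtain ⟨g, σ, hσ, rfl⟩ := hx
    obtain ⟨e, -, h⟩ := coeffMultiplicity_tmul g σ
    exact ⟨_, h, fun x hx => Set.indicator_of_notMem (Set.disjoint_right.1 hσ hx) _⟩
  | zero => exact ⟨0, map_zero _, fun _ _ => rfl⟩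
  | add x y _ _ hx hy =>
    obtain ⟨f, hf, hf'⟩ := hx
    obtain ⟨g, hg, hg'⟩ := hy
    exact ⟨f + g, by rw [map_add, hf, hg, Germ.coe_add], fun x hx => by simp [hf' x hx, hg' x hx]⟩
  | neg x _ hx =>
    obtain ⟨f, hf, hf'⟩ := hx
    exact ⟨-f, by rw [map_neg, hf, Germ.coe_neg], fun x hx => by simp [hf' x hx]⟩

/-- The multiplicity is `±g` on the part of `σ` inside the ball, an open nonempty set and hence of
positive volume, while its norm integrates to zero. -/
lemma FlatNull.eq_zero_of_top {g : G} {σ : Cell 4} {x : R4} (hx : x ∈ σ.carrier) {r : ℝ}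
    (hr : 0 < r) {Y : G ⊗[ℤ] polyChains 4} (hY : Y ∈ offChains G 4 (Metric.ball x r))
    (h : FlatNull (g ⊗ₜ[ℤ] σ.chain + Y)) : g = 0 := by
  obtain ⟨e, he, h1⟩ := coeffMultiplicity_tmul g σ
  obtain ⟨f, h2, h3⟩ := exists_coeffMultiplicity_of_mem_offChains hY
  have h4 := h.lintegral_eq_zero (h := σ.carrier.indicator (fun _ => e • g) + f)
    (by rw [map_add, h1, h2, Germ.coe_add])
  have hσ : IsOpen σ.carrier := by
    obtain ⟨H, hH⟩ := σ.exists_halfSpaces hx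
    rw [hH, span_eq_top_of_orthonormal σ.orthonormal]
    simp only [Submodule.mem_top, true_and, Set.ofPred_forall]
    exact H.finite_toSet.isOpen_biInter fun h _ => isOpen_lt (by fun_prop) continuous_const
  have hV : IsOpen (σ.carrier ∩ Metric.ball x r) := hσ.inter Metric.isOpen_ball
  have h5 : ‖g‖ₑ * volume (σ.carrier ∩ Metric.ball x r) ≤ 0 := by
    rw [← h4, ← setLIntegral_const]
    refine (setLIntegral_mono' hV.measurableSet fun y hy => ?_).trans (setLIntegral_le_lintegral _ _)
    rw [Pi.add_apply, h3 y hy.2, add_zero, Set.indicator_of_mem hy.1, ← ofReal_norm, ← ofReal_norm,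
      norm_zsmul_of_abs_eq_one he]
  rcases mul_eq_zero.1 (le_antisymm h5 zero_le) with h6 | h6
  · simpa using h6
  · exact absurd h6 (hV.measure_pos _ ⟨x, hx, Metric.mem_ball_self hr⟩).ne'

end Coefficients

/-! ### Chains of vanishing flat norm vanish -/

lemma Cell.sub_mem_span_of_mem_closure {k : ℕ} (σ : Cell k) {x z : R4} (hx : x ∈ closure σ.carrier)
    (hz : z ∈ σ.carrier) : x - z ∈ Submodule.span ℝ (Set.range σ.frame) := by
  have hc : IsClosed {y : R4 | y - z ∈ Submodule.span ℝ (Set.range σ.frame)} :=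
    (Submodule.closed_of_finiteDimensional _).preimage (by fun_prop : Continuous fun y : R4 => y - z)
  exact closure_minimal (fun y hy => σ.sub_mem_span hy hz) hc hx

lemma Cell.measure_inter_pos {k : ℕ} {σ τ : Cell k}
    (h : Submodule.span ℝ (Set.range σ.frame) = Submodule.span ℝ (Set.range τ.frame)) {z : R4}
    (hσ : z ∈ σ.carrier) (hτ : z ∈ τ.carrier) : 0 < μHE[k] (σ.carrier ∩ τ.carrier) := by
  classical
  obtain ⟨H, hH⟩ := σ.exists_halfSpaces hσ
  obtain ⟨H', hH'⟩ := τ.exists_halfSpaces hτ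
  let ρ : Cell k := {
    carrier := σ.carrier ∩ τ.carrier
    frame := σ.frame
    orthonormal := σ.orthonormal
    halfSpaces := by
      refine ⟨z, H ∪ H', ?_⟩
      rw [hH, hH', ← h]
      ext x
      simp only [Set.mem_inter_iff, Set.mem_ofPred_eq, Finset.mem_union, or_imp, forall_and]
      tauto
    nonempty := ⟨z, hσ, hτ⟩
    bounded := σ.bounded.subset Set.inter_subset_left }
  exact ρ.measure_pos

/-- Suppose `U ∩ σ` lies in the closure of `τ`. Then the two planes have the same direction, and
points of `τ` close to a point of `σ` lie in `σ`, so the cells overlap in positive measure. -/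
lemma Cell.exists_notMem_closure {k : ℕ} {σ τ : Cell k}
    (h : μHE[k] (σ.carrier ∩ τ.carrier) = 0) {U : Set R4} (hU : IsOpen U)
    (hσ : (U ∩ σ.carrier).Nonempty) : ∃ x ∈ U ∩ σ.carrier, x ∉ closure τ.carrier := by
  by_contra! hc
  obtain ⟨x, hxU, hxσ⟩ := hσ
  obtain ⟨z, hz⟩ := τ.nonempty
  have hspan : Submodule.span ℝ (Set.range σ.frame) = Submodule.span ℝ (Set.range τ.frame) := by
    refine Submodule.eq_of_le_of_finrank_eq (fun v hv => ?_) ?_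
    · obtain ⟨ε, hε, h1⟩ := σ.exists_add_smul_mem hxσ hv
      have hcont : Tendsto (fun t : ℝ => x + (t * ε) • v) (𝓝[>] 0) (𝓝 x) := by
        have : Continuous fun t : ℝ => x + (t * ε) • v := by fun_prop
        simpa using (this.tendsto 0).mono_left (nhdsWithin_le_nhds (s := Set.Ioi 0))
      obtain ⟨t, ht, ht0, ht1⟩ := ((hcont.eventually_mem (hU.mem_nhds hxU)).and
        (Ioc_mem_nhdsGT (zero_lt_one (α := ℝ)))).exists
      have h2 : x + (t * ε) • v ∈ σ.carrier := by
        have h3 := σ.convex hxσ h1 (sub_nonneg.2 ht1) ht0.le (sub_add_cancel 1 t)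
        have h4 : (1 - t) • x + t • (x + ε • v) = x + (t * ε) • v := by
          rw [sub_smul, one_smul, smul_add, smul_smul]; abel
        rwa [h4] at h3
      have h5 := Submodule.sub_mem _ (τ.sub_mem_span_of_mem_closure (hc _ ⟨ht, h2⟩) hz)
        (τ.sub_mem_span_of_mem_closure (hc _ ⟨hxU, hxσ⟩) hz)
      rw [sub_sub_sub_cancel_right, add_sub_cancel_left] at h5
      exact (Submodule.smul_mem_iff _ (mul_pos ht0 hε).ne').1 h5
    · rw [finrank_span_frame σ.orthonormal, finrank_span_frame τ.orthonormal]
  obtain ⟨H, hH⟩ := σ.exists_halfSpaces hxσ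
  have hV : IsOpen {y : R4 | ∀ h ∈ H, inner ℝ h.1 y < h.2} := by
    simp only [Set.ofPred_forall]
    exact H.finite_toSet.isOpen_biInter fun h _ => isOpen_lt (by fun_prop) continuous_const
  obtain ⟨y, hyV, hyτ⟩ := mem_closure_iff.1 (hc x ⟨hxU, hxσ⟩) _ hV (by
    have := hxσ
    rw [hH] at this
    exact this.2)
  have hyσ : y ∈ σ.carrier := by
    rw [hH, hspan]
    refine ⟨?_, hyV⟩
    have := τ.sub_mem_span_of_mem_closure (hc x ⟨hxU, hxσ⟩) hyτ
    rw [← Submodule.neg_mem_iff] at this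
    simpa using this
  exact (Cell.measure_inter_pos hspan hyσ hyτ).ne' h

/-- Nonoverlapping cells may still cross in null sets, so the ball is found by removing the closures
of the other cells one at a time from an open set that keeps meeting `σ i`. -/
lemma NonOverlapping.exists_ball {k N : ℕ} {σ : Fin N → Cell k} (hσ : NonOverlapping σ)
    (i : Fin N) : ∃ x ∈ (σ i).carrier, ∃ r > 0, ∀ j ≠ i,
      Disjoint (σ j).carrier (Metric.ball x r) := by
  classical
  have key : ∀ s : Finset (Fin N), i ∉ s → ∃ U : Set R4, IsOpen U ∧ (U ∩ (σ i).carrier).Nonempty ∧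
      ∀ j ∈ s, Disjoint (σ j).carrier U := by
    intro s
    induction s using Finset.induction_on with
    | empty => exact fun _ => ⟨Set.univ, isOpen_univ, by simpa using (σ i).nonempty, by simp⟩
    | insert j s hj ih =>
      intro hi
      rw [Finset.mem_insert, not_or] at hi
      obtain ⟨U, hU, hne, hd⟩ := ih hi.2
      obtain ⟨x, hx, hx'⟩ := Cell.exists_notMem_closure (hσ hi.1) hU hne
      refine ⟨U ∩ (closure (σ j).carrier)ᶜ, hU.inter isClosed_closure.isOpen_compl,
        ⟨x, ⟨hx.1, hx'⟩, hx.2⟩, fun l hl => ?_⟩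
      rcases Finset.mem_insert.1 hl with rfl | hl
      · exact (disjoint_compl_right.mono_left subset_closure).mono_right Set.inter_subset_right
      · exact (hd l hl).mono_right Set.inter_subset_left
  obtain ⟨U, hU, ⟨x, hxU, hx⟩, hd⟩ := key (Finset.univ.erase i) (by simp)
  obtain ⟨r, hr, hrU⟩ := Metric.isOpen_iff.1 hU x hxU
  exact ⟨x, hx, r, hr, fun j hj => (hd j (by simp [hj])).mono_right hrU⟩

/-! ### Vanishing of flat null chains by raising the dimension -/

section Coefficients

variable {G : Type*} [NormedAddCommGroup G]

lemma sweep_mem_offChains {k : ℕ} {U V : Set R4} {w : R4}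
    (hUV : ∀ x, ∀ t ∈ Set.Ioo (0 : ℝ) 1, x + t • w ∈ V → x ∈ U) {X : G ⊗[ℤ] polyChains k}
    (hX : X ∈ offChains G k U) : (chainSweep k w).lTensor G X ∈ offChains G (k + 1) V := by
  induction hX using AddSubgroup.closure_induction with
  | mem x hx =>
    obtain ⟨g, σ, hσ, rfl⟩ := hx
    rw [LinearMap.lTensor_tmul]
    by_cases hw : w ∈ Submodule.span ℝ (Set.range σ.frame)
    · have : chainSweep k w σ.chain = 0 := Subtype.ext (σ.sweep_eq_zero hw)
      rw [this, TensorProduct.tmul_zero]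
      exact AddSubgroup.zero_mem _
    · obtain ⟨σ', h, -, hc⟩ := σ.exists_sweep_eq hw
      have : chainSweep k w σ.chain = σ'.chain := Subtype.ext h
      rw [this]
      refine AddSubgroup.subset_closure ⟨g, σ', ?_, rfl⟩
      rw [hc, Set.disjoint_left]
      rintro _ ⟨x, hx, t, ht, rfl⟩ hV
      exact Set.disjoint_left.1 hσ hx (hUV x t ht hV)
  | zero => rw [map_zero]; exact AddSubgroup.zero_mem _
  | add x y _ _ hx hy => rw [map_add]; exact AddSubgroup.add_mem _ hx hy
  | neg x _ hx => rw [map_neg]; exact AddSubgroup.neg_mem _ hx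

/-- Induction on the codimension `m`. Sweeping along a normal vector `w` turns `σ` into a cell of
one dimension more with the same coefficient and keeps the chain flat null; the sweep of `Y` avoids
a smaller ball. -/
lemma FlatNull.eq_zero_of_offChains {k : ℕ} {g : G} {σ : Cell k} {x : R4} (hx : x ∈ σ.carrier)
    {r : ℝ} (hr : 0 < r) {Y : G ⊗[ℤ] polyChains k} (hY : Y ∈ offChains G k (Metric.ball x r))
    (h : FlatNull (g ⊗ₜ[ℤ] σ.chain + Y)) : g = 0 := by
  have hk : k ≤ 4 := not_lt.1 fun h => (isEmpty_cell h).elim σ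
  obtain ⟨m, hm⟩ := Nat.exists_eq_add_of_le' hk
  induction m generalizing k x r with
  | zero =>
    obtain rfl : k = 4 := by omega
    exact h.eq_zero_of_top hx hr hY
  | succ m ih =>
    set K := Submodule.span ℝ (Set.range σ.frame) with hK
    have hne : Kᗮ ≠ ⊥ := fun h => by
      have h1 := K.finrank_add_finrank_orthogonal
      rw [h, finrank_bot, finrank_span_frame σ.orthonormal, finrank_euclideanSpace_fin] at h1
      omega
    obtain ⟨v, hv, hv0⟩ := Submodule.exists_mem_ne_zero_of_ne_bot hne
    have hv0' : ‖v‖ ≠ 0 := norm_ne_zero_iff.2 hv0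
    set w : R4 := (r / 2 / ‖v‖) • v with hw
    have hwn : ‖w‖ = r / 2 := by
      rw [hw, norm_smul, Real.norm_of_nonneg (by positivity)]
      field_simp
    have hwK : w ∉ K := fun h1 => by
      have h2 : w ∈ Kᗮ := Submodule.smul_mem _ _ hv
      have h3 : inner ℝ w w = 0 := h2 w h1
      rw [inner_self_eq_zero] at h3
      rw [h3, norm_zero] at hwn
      linarith
    obtain ⟨σ', h1, -, hc⟩ := σ.exists_sweep_eq hwK
    have h2 : chainSweep k w σ.chain = σ'.chain := Subtype.ext h1
    have h3 := h.sweep w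
    rw [map_add, LinearMap.lTensor_tmul, h2] at h3
    -- With `‖w‖ = r / 2`, if `y + t w` is within `r / 2` of `x + w / 2`, then `y` is within `r` of
    -- `x`. So cells off the old ball sweep out cells off the new one, whose center lies in `σ'`.
    refine ih (σ := σ') (x := x + (1 / 2 : ℝ) • w) (r := r / 2) ?_ (by positivity)
      (sweep_mem_offChains (fun y t ht hy => ?_) hY) h3 (by omega) (by omega)
    · rw [hc]
      exact ⟨x, hx, 1 / 2, by norm_num, rfl⟩
    · rw [Metric.mem_ball, dist_eq_norm] at hy ⊢
      have h4 : y - x = (y + t • w - (x + (1 / 2 : ℝ) • w)) - (t - 1 / 2) • w := by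
        rw [sub_smul]; abel
      rw [h4]
      refine (norm_sub_le _ _).trans_lt ?_
      rw [norm_smul, hwn, Real.norm_eq_abs]
      have h5 : |t - 1 / 2| ≤ 1 := abs_le.2 ⟨by linarith [ht.1], by linarith [ht.2]⟩
      nlinarith

theorem FlatNull.eq_zero_of_nonOverlapping {k N : ℕ} {g : Fin N → G} {σ : Fin N → Cell k}
    (hσ : NonOverlapping σ) (h : FlatNull (∑ i, g i ⊗ₜ[ℤ] (σ i).chain)) (i : Fin N) :
    g i = 0 := by
  classical
  obtain ⟨x, hx, r, hr, hd⟩ := hσ.exists_ball i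
  rw [← Finset.add_sum_erase _ _ (Finset.mem_univ i)] at h
  refine h.eq_zero_of_offChains hx hr (AddSubgroup.sum_mem _ fun j hj => ?_)
  exact AddSubgroup.subset_closure ⟨g j, σ j, hd j (Finset.ne_of_mem_erase hj), rfl⟩

end Coefficients

/-! ### Mass chains and dipole chains as polyhedral chains -/

namespace Form

variable {k : ℕ}

lemma d_mulCoord (ω : Form k) (x : R4) :
    ω.mulCoord.d.1 x = wedgeInner e4 (ω.1 x) + x 3 • ω.d.1 x := by
  have h1 : HasFDerivAt (fun x : R4 => x 3) (EuclideanSpace.proj (𝕜 := ℝ) (3 : Fin 4)) x :=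
    (EuclideanSpace.proj (𝕜 := ℝ) (3 : Fin 4)).hasFDerivAt
  have h2 := (ω.differentiable x).hasFDerivAt
  have h3 : fderiv ℝ ω.mulCoord.1 x = _ := (h1.smul h2).fderiv
  have h4 : (EuclideanSpace.proj (𝕜 := ℝ) (3 : Fin 4) : R4 →L[ℝ] ℝ) = innerSL ℝ e4 := by
    ext v
    simp [inner_e4]
  rw [d_val, h3, d_val, wedgeInner, ← h4]
  have h5 := map_add (ContinuousAlternatingMap.alternatizeUncurryFinCLM ℝ R4 ℝ (n := k))
    (x 3 • fderiv ℝ ω.1 x) ((EuclideanSpace.proj (𝕜 := ℝ) (3 : Fin 4)).smulRight (ω.1 x))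
  have h6 := map_smul (ContinuousAlternatingMap.alternatizeUncurryFinCLM ℝ R4 ℝ (n := k))
    (x 3) (fderiv ℝ ω.1 x)
  rw [h6] at h5
  exact h5.trans (add_comm _ _)

lemma d_lie_mulCoord (ω : Form k) (x : R4) :
    (ω.mulCoord.lie e4).d.1 x = ω.d.1 x + (ω.lie e4).mulCoord.d.1 x := by
  have h : (ω.mulCoord.lie e4).1 = ω.1 + (ω.lie e4).mulCoord.1 := funext fun x => ω.lie_mulCoord x
  rw [d_val, d_val, d_val, h]
  have h1 := (ω.differentiable x).hasFDerivAt.add ((ω.lie e4).mulCoord.differentiable x).hasFDerivAt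
  rw [h1.fderiv]
  exact map_add (ContinuousAlternatingMap.alternatizeUncurryFinCLM ℝ R4 ℝ (n := k)) _ _

end Form

lemma Cell.toCurrent_congr {k : ℕ} (σ : Cell k) {ω η : Form k}
    (h : ∀ x ∈ σ.carrier, ω.1 x σ.frame = η.1 x σ.frame) : σ.toCurrent ω = σ.toCurrent η :=
  setIntegral_congr_fun σ.measurableSet h

lemma Cell.toCurrent_eq_zero {k : ℕ} (σ : Cell k) {ω : Form k}
    (h : ∀ x ∈ σ.carrier, ω.1 x σ.frame = 0) : σ.toCurrent ω = 0 :=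
  setIntegral_eq_zero_of_forall_eq_zero h

/-- The homomorphism of currents dual to an operator on forms. -/
def dualHom {k l : ℕ} (F : Form l → Form k) : Current k →+ Current l :=
  ⟨⟨fun A ω => A (F ω), rfl⟩, fun _ _ => rfl⟩

/-- The operator on currents dual to the Lie derivative along `e₄`. -/
def dipoleOf {k : ℕ} (A : Current k) : Current k := fun ω => A (ω.lie e4)

lemma massGraph_eq {k : ℕ} {p : Current k × Current (k + 1)} (hp : p ∈ massGraph k) :
    p.2 = massOf p.1 := by
  induction hp using AddSubgroup.closure_induction with
  | mem p hp =>
    obtain ⟨τ, h1, h2⟩ := hp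
    rw [h1, (isMassCell_iff.1 h2).2]
  | zero => rfl
  | add p q _ _ hp hq => exact congrArg₂ (· + ·) hp hq
  | neg p _ hp => exact congrArg Neg.neg hp

lemma Cell.InR3.of_subset_closure {k l : ℕ} {σ : Cell k} (h : σ.InR3) {τ : Cell l}
    (hτ : τ.carrier ⊆ closure σ.carrier) : τ.InR3 := by
  have hc : IsClosed {x : R4 | x 3 = 0} := isClosed_eq (by fun_prop) continuous_const
  exact fun x hx => closure_minimal (fun y hy => h y hy) hc (hτ hx)

lemma Cell.InR3.bdry_mem_massGraph {k : ℕ} {σ : Cell (k + 1)} (h : σ.InR3) :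
    (bdry σ.toCurrent, massOf (bdry σ.toCurrent)) ∈ massGraph k := by
  have hb := σ.bdry_mem
  generalize bdry σ.toCurrent = B at hb ⊢
  induction hb using AddSubgroup.closure_induction with
  | mem A hA =>
    obtain ⟨τ, hτ, rfl⟩ := hA
    exact AddSubgroup.subset_closure ⟨τ, rfl, isMassCell_massOf (h.of_subset_closure hτ)⟩
  | zero => exact AddSubgroup.zero_mem _
  | add A B _ _ hA hB => exact AddSubgroup.add_mem _ hA hB
  | neg A _ hA => exact AddSubgroup.neg_mem _ hA

/-- Cartan's formula `d i + i d = L`, read on currents. -/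
lemma Cell.massOf_bdry_add_bdry_massOf {k : ℕ} (σ : Cell (k + 1)) :
    massOf (bdry σ.toCurrent) + bdry (massOf σ.toCurrent) = dipoleOf σ.toCurrent := by
  funext ω
  change σ.toCurrent (ω.interior e4).d + σ.toCurrent (ω.d.interior e4) = σ.toCurrent (ω.lie e4)
  simp only [Cell.toCurrent_apply]
  rw [← integral_add (σ.integrableOn_form _ _) (σ.integrableOn_form _ _)]
  congr 1
  funext x
  have h := congrArg (fun f => f σ.frame) (ω.cartan e4 x)
  exact (add_comm _ _).trans h

lemma Cell.bdry_massOf {σ : Cell 0} : bdry (massOf σ.toCurrent) = dipoleOf σ.toCurrent :=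
  funext fun ω => σ.toCurrent_congr fun x _ => congrArg (fun f => f σ.frame) (ω.cartan_zero e4 x)

/-- Stokes makes `∂σ` a chain of cells of `ℝ³`, so `μ∂σ` exists, and `massGraph_eq` makes it unique.
Thus every cell of `ℝ³` has exactly one dipole cell, the dual of the Lie derivative. -/
lemma isDipoleCell_iff {k : ℕ} {σ : Cell k} {s : Current k} :
    IsDipoleCell σ s ↔ σ.InR3 ∧ s = dipoleOf σ.toCurrent := by
  cases k with
  | zero =>
    constructor
    · rintro ⟨m, hm, rfl⟩
      obtain ⟨h, rfl⟩ := isMassCell_iff.1 hm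
      exact ⟨h, Cell.bdry_massOf⟩
    · rintro ⟨h, rfl⟩
      exact ⟨_, isMassCell_massOf h, Cell.bdry_massOf.symm⟩
  | succ k =>
    constructor
    · rintro ⟨m, q, hm, hq, rfl⟩
      obtain ⟨h, rfl⟩ := isMassCell_iff.1 hm
      refine ⟨h, ?_⟩
      rw [← σ.massOf_bdry_add_bdry_massOf, ← massGraph_eq hq]
    · rintro ⟨h, rfl⟩
      exact ⟨_, _, isMassCell_massOf h, h.bdry_mem_massGraph, σ.massOf_bdry_add_bdry_massOf.symm⟩

/-! ### Testing mass and dipole cells with `x₄ω` and `d(x₄ω)` -/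

section InR3

variable {k : ℕ} {σ : Cell k}

lemma Cell.InR3.wedgeInner_frame {σ : Cell (k + 1)} (h : σ.InR3) (f : R4 [⋀^Fin k]→L[ℝ] ℝ) :
    wedgeInner e4 f σ.frame = 0 := by
  rw [wedgeInner_apply]
  refine Finset.sum_eq_zero fun i _ => ?_
  rw [inner_e4, h.apply_eq_zero (Submodule.subset_span (Set.mem_range_self i))]
  simp

lemma Cell.InR3.dipoleOf_mulCoord (h : σ.InR3) (ω : Form k) :
    dipoleOf σ.toCurrent ω.mulCoord = σ.toCurrent ω :=
  σ.toCurrent_congr fun x hx => by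
    refine (congrArg (fun f => f σ.frame) (ω.lie_mulCoord x)).trans ?_
    rw [h x hx, zero_smul, add_zero]

lemma Cell.InR3.massOf_mulCoord (h : σ.InR3) (ω : Form (k + 1)) :
    massOf σ.toCurrent ω.mulCoord = 0 :=
  σ.toCurrent_eq_zero fun x hx => by
    change x 3 • _ = (0 : ℝ)
    rw [h x hx, zero_smul]

/-- At points of `ℝ³`, `d(x₄ω) = dx₄ ∧ ω`, whose value on `e₄` followed by a frame tangent to `ℝ³`
is the value of `ω` on that frame. -/
lemma Cell.InR3.massOf_d_mulCoord (h : σ.InR3) (ω : Form k) :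
    massOf σ.toCurrent ω.mulCoord.d = σ.toCurrent ω :=
  σ.toCurrent_congr fun x hx => by
    refine (congrArg (fun f => f (Fin.cons e4 σ.frame : Fin (k + 1) → R4))
      (ω.d_mulCoord x)).trans ?_
    rw [h x hx, zero_smul, add_zero]
    exact wedgeInner_cons h.orthonormal _

/-- Here `L d(x₄ω) = dω + dx₄ ∧ Lω + x₄ d(Lω)`; the second term vanishes on frames tangent to `ℝ³`,
the third at points of `ℝ³`. -/
lemma Cell.InR3.dipoleOf_d_mulCoord {σ : Cell (k + 1)} (h : σ.InR3) (ω : Form k) :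
    dipoleOf σ.toCurrent ω.mulCoord.d = σ.toCurrent ω.d :=
  σ.toCurrent_congr fun x hx => by
    refine (congrArg (fun f => f σ.frame) ((ω.mulCoord.lie_d e4 x).trans
      (ω.d_lie_mulCoord x))).trans ?_
    rw [Form.d_mulCoord, h x hx, zero_smul, add_zero]
    change _ + wedgeInner e4 _ σ.frame = _
    rw [h.wedgeInner_frame, add_zero]
    rfl

lemma Cell.dipoleOf_d_d {σ : Cell (k + 2)} (ω : Form k) :
    dipoleOf σ.toCurrent ω.d.d = 0 :=
  σ.toCurrent_eq_zero fun x _ => by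
    refine (congrArg (fun f => f σ.frame) (ω.d.lie_d e4 x)).trans ?_
    have : (ω.d.lie e4).1 = (ω.lie e4).d.1 := funext fun x => ω.lie_d e4 x
    rw [Form.d_val, this, ← Form.d_val, Form.d_d]
    rfl

lemma Cell.massOf_d_d {σ : Cell (k + 1)} (ω : Form k) :
    massOf σ.toCurrent ω.d.d = 0 :=
  σ.toCurrent_eq_zero fun x _ => by
    rw [Form.interior_apply, Form.d_d]
    rfl

end InR3

/-- Two homomorphisms on currents that agree on dipole cells agree on dipole chains. -/
lemma eqOn_dipoleChains {k l : ℕ} {f g : Current k →+ Current l}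
    (h : ∀ σ : Cell k, σ.InR3 → f (dipoleOf σ.toCurrent) = g (dipoleOf σ.toCurrent))
    {s : Current k} (hs : s ∈ dipoleChains k) : f s = g s := by
  have : dipoleChains k ≤ f.eqLocus g := by
    rw [dipoleChains, AddSubgroup.closure_le]
    rintro _ ⟨σ, hσ⟩
    obtain ⟨h1, rfl⟩ := isDipoleCell_iff.1 hσ
    exact h σ h1
  exact this hs

/-- Two homomorphisms on currents that agree on mass cells agree on mass chains. -/
lemma eqOn_massChains {k l : ℕ} {f g : Current (k + 1) →+ Current l}
    (h : ∀ σ : Cell k, σ.InR3 → f (massOf σ.toCurrent) = g (massOf σ.toCurrent))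
    {t : Current (k + 1)} (ht : t ∈ massChains (k + 1)) : f t = g t := by
  have : massChains (k + 1) ≤ f.eqLocus g := by
    rw [massChains, AddSubgroup.closure_le]
    rintro _ ⟨σ, hσ⟩
    obtain ⟨h1, rfl⟩ := isMassCell_iff.1 hσ
    exact h σ h1
  exact this ht

lemma dualHom_mulCoord_mem {k : ℕ} {s : Current k} (hs : s ∈ dipoleChains k) :
    dualHom Form.mulCoord s ∈ polyChains k := by
  have : dipoleChains k ≤ (polyChains k).comap (dualHom Form.mulCoord) := by
    rw [dipoleChains, AddSubgroup.closure_le]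
    rintro _ ⟨σ, hσ⟩
    obtain ⟨h, rfl⟩ := isDipoleCell_iff.1 hσ
    have h1 : dualHom Form.mulCoord (dipoleOf σ.toCurrent) = σ.toCurrent :=
      funext h.dipoleOf_mulCoord
    change dualHom Form.mulCoord (dipoleOf σ.toCurrent) ∈ polyChains k
    rw [h1]
    exact σ.mem_polyChains
  exact this hs

lemma dualHom_d_mulCoord_mem {k : ℕ} {t : Current (k + 1)} (ht : t ∈ massChains (k + 1)) :
    dualHom (fun ω => ω.mulCoord.d) t ∈ polyChains k := by
  have : massChains (k + 1) ≤ (polyChains k).comap (dualHom fun ω => ω.mulCoord.d) := by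
    rw [massChains, AddSubgroup.closure_le]
    rintro _ ⟨σ, hσ⟩
    obtain ⟨h, rfl⟩ := isMassCell_iff.1 hσ
    have h1 : dualHom (fun ω => ω.mulCoord.d) (massOf σ.toCurrent) = σ.toCurrent :=
      funext h.massOf_d_mulCoord
    change dualHom (fun ω => ω.mulCoord.d) (massOf σ.toCurrent) ∈ polyChains k
    rw [h1]
    exact σ.mem_polyChains
  exact this ht

/-- The homomorphism `δσ ↦ σ`. -/
def dipoleToPoly (k : ℕ) : dipoleChains k →ₗ[ℤ] polyChains k :=
  (((dualHom Form.mulCoord).comp (dipoleChains k).subtype).codRestrict (polyChains k)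
    fun s => dualHom_mulCoord_mem s.2).toIntLinearMap

/-- The homomorphism `μτ ↦ τ`. -/
def massToPoly (k : ℕ) : massChains (k + 1) →ₗ[ℤ] polyChains k :=
  (((dualHom fun ω => ω.mulCoord.d).comp (massChains (k + 1)).subtype).codRestrict (polyChains k)
    fun t => dualHom_d_mulCoord_mem t.2).toIntLinearMap

lemma dipoleToPoly_eq {k : ℕ} {σ : Cell k} {s : dipoleChains k}
    (h : IsDipoleCell σ (s : Current k)) : dipoleToPoly k s = σ.chain := by
  obtain ⟨h1, h2⟩ := isDipoleCell_iff.1 h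
  refine Subtype.ext ?_
  change dualHom Form.mulCoord (s : Current k) = σ.toCurrent
  rw [h2]
  exact funext h1.dipoleOf_mulCoord

lemma massToPoly_eq {k : ℕ} {τ : Cell k} {t : massChains (k + 1)}
    (h : IsMassCell τ (t : Current (k + 1))) : massToPoly k t = τ.chain := by
  obtain ⟨h1, h2⟩ := isMassCell_iff.1 h
  refine Subtype.ext ?_
  change dualHom (fun ω => ω.mulCoord.d) (t : Current (k + 1)) = τ.toCurrent
  rw [h2]
  exact funext h1.massOf_d_mulCoord

lemma apply_d_mulCoord_of_mem_dipoleChains {k : ℕ} {s : Current (k + 1)}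
    (hs : s ∈ dipoleChains (k + 1)) (ω : Form k) : s ω.mulCoord.d = s ω.d.mulCoord :=
  congrFun (eqOn_dipoleChains (f := dualHom fun ω : Form k => ω.mulCoord.d)
    (g := dualHom fun ω : Form k => ω.d.mulCoord) (fun _ hσ => funext fun ω =>
      (hσ.dipoleOf_d_mulCoord ω).trans (hσ.dipoleOf_mulCoord ω.d).symm) hs) ω

lemma apply_mulCoord_of_mem_massChains {k : ℕ} {t : Current k} (ht : t ∈ massChains k)
    (ω : Form k) : t ω.mulCoord = 0 := by
  cases k with
  | zero =>
    rw [massChains, AddSubgroup.mem_bot] at ht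
    rw [ht]
    rfl
  | succ k =>
    exact congrFun (eqOn_massChains (f := dualHom Form.mulCoord) (g := 0)
      (fun _ hσ => funext fun ω => hσ.massOf_mulCoord ω) ht) ω

/-- The dipole part of the boundary of an integral dipolyhedron. -/
lemma dipoleToPoly_of_bdry {k : ℕ} {s : dipoleChains (k + 1)} {t : massChains (k + 1)}
    {s' : dipoleChains k} {t' : massChains k}
    (h : bdry ((s : Current (k + 1)) + (t : Current (k + 1))) = (s' : Current k) + (t' : Current k)) :
    dipoleToPoly k s' = chainBdry k (dipoleToPoly (k + 1) s) + massToPoly k t := by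
  refine Subtype.ext (funext fun ω => ?_)
  -- Both sides are tested with `x₄ω`, which annihilates `t'` and recovers the polyhedral chain of
  -- `s'`.
  have h1 : (s : Current (k + 1)) ω.mulCoord.d + (t : Current (k + 1)) ω.mulCoord.d =
    (s' : Current k) ω.mulCoord + (t' : Current k) ω.mulCoord := congrFun h ω.mulCoord
  rw [apply_mulCoord_of_mem_massChains t'.2, add_zero,
    apply_d_mulCoord_of_mem_dipoleChains s.2] at h1
  exact h1.symm

/-- The mass part of the boundary of an integral dipolyhedron. -/
lemma massToPoly_of_bdry {k : ℕ} {s : dipoleChains (k + 2)} {t : massChains (k + 2)}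
    {s' : dipoleChains (k + 1)} {t' : massChains (k + 1)}
    (h : bdry ((s : Current (k + 2)) + (t : Current (k + 2))) =
      (s' : Current (k + 1)) + (t' : Current (k + 1))) :
    massToPoly k t' = -chainBdry k (dipoleToPoly (k + 1) s') := by
  refine Subtype.ext (funext fun ω => ?_)
  -- The test form is now `d(x₄ω)`: the left side vanishes because `dd = 0`, and on the right `t'`
  -- yields its own polyhedral chain and `s'` the boundary of its one.
  have h1 : (s : Current (k + 2)) ω.mulCoord.d.d + (t : Current (k + 2)) ω.mulCoord.d.d =
    (s' : Current (k + 1)) ω.mulCoord.d + (t' : Current (k + 1)) ω.mulCoord.d :=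
    congrFun h ω.mulCoord.d
  have hs : (s : Current (k + 2)) ω.mulCoord.d.d = 0 :=
    congrFun (eqOn_dipoleChains (f := dualHom fun ω : Form k => ω.d.d) (g := 0)
      (fun _ _ => funext fun ω => Cell.dipoleOf_d_d ω) s.2) ω.mulCoord
  have ht : (t : Current (k + 2)) ω.mulCoord.d.d = 0 :=
    congrFun (eqOn_massChains (f := dualHom fun ω : Form k => ω.d.d) (g := 0)
      (fun _ _ => funext fun ω => Cell.massOf_d_d ω) t.2) ω.mulCoord
  rw [hs, ht, add_zero, apply_d_mulCoord_of_mem_dipoleChains s'.2] at h1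
  change (t' : Current (k + 1)) ω.mulCoord.d = -(s' : Current (k + 1)) ω.d.mulCoord
  linarith

/-! ### Norms defined by nonoverlapping representations -/

section CellNorm

variable {G : Type*} [NormedAddCommGroup G] {k l : ℕ}

/-- The infimum of `∑ ‖gᵢ‖ M(σᵢ)` over the representations `X = ∑ gᵢ mᵢ` by nonoverlapping
cells `σᵢ` with `R σᵢ mᵢ`. -/
def cellNorm (R : Cell k → Current l → Prop) {M : AddSubgroup (Current l)} (X : G ⊗[ℤ] M) : ℝ :=
  sInf {w | ∃ (N : ℕ) (g : Fin N → G) (σ : Fin N → Cell k) (m : Fin N → M),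
    (∀ i, R (σ i) (m i : Current l)) ∧ NonOverlapping σ ∧
      X = ∑ i, g i ⊗ₜ[ℤ] m i ∧ w = ∑ i, ‖g i‖ * (σ i).mass}

/-- `M` is generated by the images under `φ` of the cells in `ℝ³`, and `R` is the graph of `φ` on
these cells. -/
structure IsCellImage (R : Cell k → Current l → Prop) (M : AddSubgroup (Current l))
    (φ : Current k →+ Current l) : Prop where
  iff : ∀ σ m, R σ m ↔ σ.InR3 ∧ m = φ σ.toCurrent
  closure_eq : M = AddSubgroup.closure {m | ∃ σ, R σ m}

/-- `X` is represented by cells, possibly overlapping, of total mass at most `r`. -/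
def HasCellMassLE (R : Cell k → Current l → Prop) {M : AddSubgroup (Current l)} (X : G ⊗[ℤ] M)
    (r : ℝ) : Prop :=
  ∃ (N : ℕ) (g : Fin N → G) (σ : Fin N → Cell k) (m : Fin N → M),
    (∀ i, R (σ i) (m i : Current l)) ∧ X = ∑ i, g i ⊗ₜ[ℤ] m i ∧ ∑ i, ‖g i‖ * (σ i).mass ≤ r

variable {R : Cell k → Current l → Prop} {M : AddSubgroup (Current l)} {φ : Current k →+ Current l}

lemma HasCellMassLE.zero : HasCellMassLE R (0 : G ⊗[ℤ] M) 0 :=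
  ⟨0, Fin.elim0, Fin.elim0, Fin.elim0, fun i => i.elim0, by simp, by simp⟩

lemma HasCellMassLE.add {X Y : G ⊗[ℤ] M} {r s : ℝ} (hX : HasCellMassLE R X r)
    (hY : HasCellMassLE R Y s) : HasCellMassLE R (X + Y) (r + s) := by
  obtain ⟨N, g, σ, m, hR, rfl, h2⟩ := hX
  obtain ⟨N', g', σ', m', hR', rfl, h2'⟩ := hY
  refine ⟨N + N', Fin.append g g', Fin.append σ σ', Fin.append m m', fun i => ?_, ?_, ?_⟩
  · induction i using Fin.addCases with
    | left i => simpa using hR i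
    | right i => simpa using hR' i
  · simp [Fin.sum_univ_add]
  · simp only [Fin.sum_univ_add, Fin.append_left, Fin.append_right]
    exact add_le_add h2 h2'

lemma HasCellMassLE.neg {X : G ⊗[ℤ] M} {r : ℝ} (hX : HasCellMassLE R X r) :
    HasCellMassLE R (-X) r := by
  obtain ⟨N, g, σ, m, hR, rfl, h2⟩ := hX
  exact ⟨N, fun i => -g i, σ, m, hR, by simp [TensorProduct.neg_tmul], by simpa using h2⟩

lemma IsCellImage.exists_hasCellMassLE (h : IsCellImage R M φ) (X : G ⊗[ℤ] M) :
    ∃ r, HasCellMassLE R X r := by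
  induction X using TensorProduct.induction_on with
  | zero => exact ⟨0, HasCellMassLE.zero⟩
  | add X Y hX hY =>
    obtain ⟨r, hr⟩ := hX
    obtain ⟨s, hs⟩ := hY
    exact ⟨_, hr.add hs⟩
  | tmul g m =>
    obtain ⟨m, hm⟩ := m
    have hM := h.closure_eq
    subst hM
    induction hm using AddSubgroup.closure_induction with
    | mem x hx =>
      obtain ⟨σ, hσ⟩ := hx
      exact ⟨_, 1, fun _ => g, fun _ => σ,
        fun _ => ⟨x, AddSubgroup.subset_closure ⟨σ, hσ⟩⟩, fun _ => hσ, by simp, le_rfl⟩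
    | zero => exact ⟨0, by
        have : g ⊗ₜ[ℤ] (0 : AddSubgroup.closure {m | ∃ σ, R σ m}) = 0 := TensorProduct.tmul_zero _ _
        exact this ▸ HasCellMassLE.zero⟩
    | add x y hx hy h1 h2 =>
      obtain ⟨r, hr⟩ := h1
      obtain ⟨s, hs⟩ := h2
      refine ⟨r + s, ?_⟩
      have := hr.add hs
      rw [← TensorProduct.tmul_add] at this
      exact this
    | neg x hx h1 =>
      obtain ⟨r, hr⟩ := h1
      refine ⟨r, ?_⟩
      have := hr.neg
      rw [← TensorProduct.tmul_neg] at this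
      exact this

lemma norm_sum_zsmul_le {N : ℕ} (c : Fin N → ℤ) (g : Fin N → G) :
    ‖∑ i, c i • g i‖ ≤ ∑ i, |(c i : ℝ)| * ‖g i‖ :=
  (norm_sum_le _ _).trans (Finset.sum_le_sum fun i _ => by
    simpa [Int.norm_eq_abs] using norm_zsmul_le (c i) (g i))

/-- Pass to a common refinement and collect the coefficients `∑ᵢ cᵢⱼ gᵢ`. By the triangle inequality
the total mass does not increase, so admitting overlapping representations does not change the
infimum. -/
lemma IsCellImage.exists_nonOverlapping (h : IsCellImage R M φ) {X : G ⊗[ℤ] M} {r : ℝ}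
    (hX : HasCellMassLE R X r) :
    ∃ (N : ℕ) (g : Fin N → G) (σ : Fin N → Cell k) (m : Fin N → M),
      (∀ i, R (σ i) (m i : Current l)) ∧ NonOverlapping σ ∧ X = ∑ i, g i ⊗ₜ[ℤ] m i ∧
        ∑ i, ‖g i‖ * (σ i).mass ≤ r := by
  obtain ⟨N, g, σ, m, hR, rfl, hr⟩ := hX
  obtain ⟨N', τ, c, hτ, h1, h2, h3⟩ := exists_refinement σ
  have hR' : ∀ j, R (τ j) (φ (τ j).toCurrent) := fun j => by
    obtain ⟨i, hi⟩ := h3 j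
    exact (h.iff _ _).2 ⟨fun x hx => ((h.iff _ _).1 (hR i)).1 x (hi hx), rfl⟩
  have hmem : ∀ j, φ (τ j).toCurrent ∈ M := fun j => by
    rw [h.closure_eq]
    exact AddSubgroup.subset_closure ⟨_, hR' j⟩
  have hm : ∀ i, m i = ∑ j, c i j • (⟨φ (τ j).toCurrent, hmem j⟩ : M) := fun i => by
    refine Subtype.ext ?_
    rw [((h.iff _ _).1 (hR i)).2, h1 i, map_sum, AddSubgroup.val_finsetSum]
    exact Finset.sum_congr rfl fun j _ => map_zsmul φ _ _
  refine ⟨N', fun j => ∑ i, c i j • g i, τ, fun j => ⟨φ (τ j).toCurrent, hmem j⟩, hR', hτ, ?_, ?_⟩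
  · simp_rw [TensorProduct.sum_tmul]
    rw [Finset.sum_comm]
    refine Finset.sum_congr rfl fun i _ => ?_
    rw [hm i, TensorProduct.tmul_sum]
    exact Finset.sum_congr rfl fun j _ => (TensorProduct.smul_tmul _ _ _).symm
  · calc ∑ j, ‖∑ i, c i j • g i‖ * (τ j).mass
        ≤ ∑ j, (∑ i, |(c i j : ℝ)| * ‖g i‖) * (τ j).mass :=
          Finset.sum_le_sum fun j _ =>
            mul_le_mul_of_nonneg_right (norm_sum_zsmul_le _ _) (τ j).mass_nonneg
      _ = ∑ i, ‖g i‖ * ∑ j, |(c i j : ℝ)| * (τ j).mass := by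
          simp_rw [Finset.sum_mul, Finset.mul_sum]
          rw [Finset.sum_comm]
          exact Finset.sum_congr rfl fun i _ => Finset.sum_congr rfl fun j _ => by ring
      _ ≤ ∑ i, ‖g i‖ * (σ i).mass :=
          Finset.sum_le_sum fun i _ => mul_le_mul_of_nonneg_left (h2 i) (norm_nonneg _)
      _ ≤ r := hr

lemma cellNorm_set_nonneg (R : Cell k → Current l → Prop) (X : G ⊗[ℤ] M) :
    ∀ w ∈ {w | ∃ (N : ℕ) (g : Fin N → G) (σ : Fin N → Cell k) (m : Fin N → M),
      (∀ i, R (σ i) (m i : Current l)) ∧ NonOverlapping σ ∧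
        X = ∑ i, g i ⊗ₜ[ℤ] m i ∧ w = ∑ i, ‖g i‖ * (σ i).mass}, (0 : ℝ) ≤ w := by
  rintro w ⟨N, g, σ, m, -, -, -, rfl⟩
  exact Finset.sum_nonneg fun i _ => mul_nonneg (norm_nonneg _) (σ i).mass_nonneg

lemma cellNorm_nonneg (R : Cell k → Current l → Prop) (X : G ⊗[ℤ] M) : 0 ≤ cellNorm R X :=
  Real.sInf_nonneg (cellNorm_set_nonneg R X)

namespace IsCellImage

lemma cellNorm_le (h : IsCellImage R M φ) {X : G ⊗[ℤ] M} {r : ℝ} (hX : HasCellMassLE R X r) : cellNorm R X ≤ r := by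
  obtain ⟨N, g, σ, m, hR, hσ, hX, hr⟩ := h.exists_nonOverlapping hX
  exact (csInf_le ⟨0, cellNorm_set_nonneg R X⟩ ⟨N, g, σ, m, hR, hσ, hX, rfl⟩).trans hr

lemma hasCellMassLE (h : IsCellImage R M φ) {X : G ⊗[ℤ] M} {r : ℝ} (hr : cellNorm R X < r) : HasCellMassLE R X r := by
  obtain ⟨s, hs⟩ := h.exists_hasCellMassLE X
  obtain ⟨N, g, σ, m, hR, hσ, hX, -⟩ := h.exists_nonOverlapping hs
  rw [cellNorm] at hr
  obtain ⟨_, ⟨N', g', σ', m', hR', -, hX', rfl⟩, hlt⟩ :=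
    exists_lt_of_csInf_lt (by exact ⟨_, N, g, σ, m, hR, hσ, hX, rfl⟩) hr
  exact ⟨N', g', σ', m', hR', hX', hlt.le⟩

lemma cellNorm_zero (h : IsCellImage R M φ) : cellNorm R (0 : G ⊗[ℤ] M) = 0 :=
  le_antisymm (h.cellNorm_le HasCellMassLE.zero) (cellNorm_nonneg R _)

/-- Nearly optimal representations are concatenated; the result may overlap, which `cellNorm_le`
permits. -/
lemma cellNorm_add_le (h : IsCellImage R M φ) (X Y : G ⊗[ℤ] M) : cellNorm R (X + Y) ≤ cellNorm R X + cellNorm R Y := by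
  refine le_of_forall_pos_le_add fun ε hε => ?_
  refine (h.cellNorm_le ((h.hasCellMassLE (r := cellNorm R X + ε / 2) (by linarith)).add
    (h.hasCellMassLE (r := cellNorm R Y + ε / 2) (by linarith)))).trans (by linarith)

lemma cellNorm_neg_le (h : IsCellImage R M φ) (X : G ⊗[ℤ] M) : cellNorm R (-X) ≤ cellNorm R X :=
  le_of_forall_pos_le_add fun _ hε => h.cellNorm_le (h.hasCellMassLE (by linarith)).neg

/-- In a nonoverlapping representation the coefficients of `X` are also those of its image, and they
all vanish. So `X = 0` already in the tensor product, and injectivity of `ψ.lTensor` is never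
needed. -/
lemma eq_zero_of_flatNull (h : IsCellImage R M φ) {ψ : M →ₗ[ℤ] polyChains k}
    (hψ : ∀ (σ : Cell k) (m : M), R σ (m : Current l) → ψ m = σ.chain) {X : G ⊗[ℤ] M}
    (hX : FlatNull (ψ.lTensor G X)) : X = 0 := by
  obtain ⟨s, hs⟩ := h.exists_hasCellMassLE X
  obtain ⟨N, g, σ, m, hR, hσ, rfl, -⟩ := h.exists_nonOverlapping hs
  rw [map_sum] at hX
  simp only [LinearMap.lTensor_tmul] at hX
  rw [Finset.sum_congr rfl fun i _ => congrArg (g i ⊗ₜ[ℤ] ·) (hψ _ _ (hR i))] at hX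
  refine Finset.sum_eq_zero fun i _ => ?_
  rw [hX.eq_zero_of_nonOverlapping hσ i, TensorProduct.zero_tmul]

lemma hasMassLE (h : IsCellImage R M φ) {ψ : M →ₗ[ℤ] polyChains k}
    (hψ : ∀ (σ : Cell k) (m : M), R σ (m : Current l) → ψ m = σ.chain) {X : G ⊗[ℤ] M} {r : ℝ}
    (hr : cellNorm R X < r) : HasMassLE (ψ.lTensor G X) r := by
  obtain ⟨N, g, σ, m, hR, rfl, h2⟩ := h.hasCellMassLE hr
  refine ⟨N, g, σ, ?_, h2⟩
  rw [map_sum]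
  simp only [LinearMap.lTensor_tmul]
  exact Finset.sum_congr rfl fun i _ => congrArg (g i ⊗ₜ[ℤ] ·) (hψ _ _ (hR i))

end IsCellImage

end CellNorm

/-- `weight`, and `mass` in positive dimension, are definitionally `cellNorm` for the two relations
treated here, so all norm properties transfer at once. -/
lemma isCellImage_dipole (k : ℕ) : IsCellImage (k := k) IsDipoleCell (dipoleChains k)
    (dualHom (Form.lie e4)) :=
  ⟨fun _ _ => isDipoleCell_iff, rfl⟩

lemma isCellImage_mass (k : ℕ) : IsCellImage (k := k) IsMassCell (massChains (k + 1))
    (dualHom (Form.interior e4)) :=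
  ⟨fun _ _ => isMassCell_iff, rfl⟩

/-! ### The flat energy -/

section FlatEnergy

variable {G : Type*} [NormedAddCommGroup G] {k : ℕ}

lemma mass_nonneg (T : MassChain G k) : 0 ≤ mass T := by
  cases k with
  | zero => exact le_rfl
  | succ k => exact cellNorm_nonneg _ _

lemma mass_zero : mass (0 : MassChain G k) = 0 := by
  cases k with
  | zero => rfl
  | succ k => exact (isCellImage_mass k).cellNorm_zero

lemma mass_add_le (T T' : MassChain G k) : mass (T + T') ≤ mass T + mass T' := by
  cases k with
  | zero => exact (add_zero (0 : ℝ)).ge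
  | succ k => exact (isCellImage_mass k).cellNorm_add_le _ _

lemma mass_neg_le (T : MassChain G k) : mass (-T) ≤ mass T := by
  cases k with
  | zero => exact le_rfl
  | succ k => exact (isCellImage_mass k).cellNorm_neg_le _

lemma energy_nonneg (D : Dipolyhedron G k) : 0 ≤ energy D :=
  add_nonneg (cellNorm_nonneg _ _) (mass_nonneg _)

lemma energy_zero : energy (0 : Dipolyhedron G k) = 0 := by
  have h : weight (0 : DipoleChain G k) = 0 := (isCellImage_dipole k).cellNorm_zero
  change weight (0 : DipoleChain G k) + mass (0 : MassChain G k) = 0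
  rw [h, mass_zero, add_zero]

lemma energy_add_le (D D' : Dipolyhedron G k) : energy (D + D') ≤ energy D + energy D' := by
  have h : weight (D.1 + D'.1) ≤ weight D.1 + weight D'.1 :=
    (isCellImage_dipole k).cellNorm_add_le _ _
  have h' := mass_add_le D.2 D'.2
  change weight (D.1 + D'.1) + mass (D.2 + D'.2) ≤ weight D.1 + mass D.2 + (weight D'.1 + mass D'.2)
  linarith

lemma energy_neg_le (D : Dipolyhedron G k) : energy (-D) ≤ energy D :=
  add_le_add ((isCellImage_dipole k).cellNorm_neg_le D.1) (mass_neg_le D.2)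

/-- `D = B + ∂C` with `E(B) + E(C) ≤ r`. -/
def HasFlatEnergyLE (D : Dipolyhedron G k) (r : ℝ) : Prop :=
  ∃ (B : Dipolyhedron G k) (C : Dipolyhedron G (k + 1)) (D' : Dipolyhedron G k),
    IsBoundary C D' ∧ D = B + D' ∧ energy B + energy C ≤ r

lemma HasFlatEnergyLE.flatEnergy_le {D : Dipolyhedron G k} {r : ℝ} (h : HasFlatEnergyLE D r) :
    flatEnergy D ≤ r := by
  obtain ⟨B, C, D', h1, h2, h3⟩ := h
  rw [flatEnergy]
  refine le_trans (csInf_le ⟨0, ?_⟩ ⟨B, C, D', h1, h2, rfl⟩) h3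
  rintro _ ⟨B, C, D', -, -, rfl⟩
  exact add_nonneg (energy_nonneg _) (energy_nonneg _)

lemma hasFlatEnergyLE_of_lt {D : Dipolyhedron G k} {r : ℝ} (h : flatEnergy D < r) :
    HasFlatEnergyLE D r := by
  rw [flatEnergy] at h
  obtain ⟨_, ⟨B, C, D', h1, h2, rfl⟩, hlt⟩ := exists_lt_of_csInf_lt
    (by exact ⟨_, D, 0, 0, AddSubgroup.zero_mem _, (add_zero D).symm, rfl⟩) h
  exact ⟨B, C, D', h1, h2, hlt.le⟩

lemma flatEnergy_nonneg (D : Dipolyhedron G k) : 0 ≤ flatEnergy D := by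
  refine Real.sInf_nonneg ?_
  rintro _ ⟨B, C, D', -, -, rfl⟩
  exact add_nonneg (energy_nonneg _) (energy_nonneg _)

lemma flatEnergy_zero : flatEnergy (0 : Dipolyhedron G k) = 0 := by
  refine le_antisymm (HasFlatEnergyLE.flatEnergy_le ⟨0, 0, 0, AddSubgroup.zero_mem _, ?_, ?_⟩)
    (flatEnergy_nonneg _)
  · rw [add_zero]
  · rw [energy_zero, energy_zero, add_zero]

lemma flatEnergy_add_le (D D' : Dipolyhedron G k) :
    flatEnergy (D + D') ≤ flatEnergy D + flatEnergy D' := by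
  refine le_of_forall_pos_le_add fun ε hε => ?_
  obtain ⟨B, C, E, h1, h2, h3⟩ := hasFlatEnergyLE_of_lt (D := D) (r := flatEnergy D + ε / 2)
    (by linarith)
  obtain ⟨B', C', E', h1', h2', h3'⟩ := hasFlatEnergyLE_of_lt (D := D')
    (r := flatEnergy D' + ε / 2) (by linarith)
  refine HasFlatEnergyLE.flatEnergy_le ⟨B + B', C + C', E + E', AddSubgroup.add_mem _ h1 h1', ?_, ?_⟩
  · rw [h2, h2']; abel
  · linarith [energy_add_le B B', energy_add_le C C']

lemma flatEnergy_neg_le (D : Dipolyhedron G k) : flatEnergy (-D) ≤ flatEnergy D := by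
  refine le_of_forall_pos_le_add fun ε hε => ?_
  obtain ⟨B, C, E, h1, h2, h3⟩ := hasFlatEnergyLE_of_lt (D := D) (r := flatEnergy D + ε)
    (by linarith)
  refine HasFlatEnergyLE.flatEnergy_le ⟨-B, -C, -E, AddSubgroup.neg_mem _ h1, ?_, ?_⟩
  · rw [h2]; abel
  · linarith [energy_neg_le B, energy_neg_le C]

/-- The identity is additive, so it suffices to check the generators of `boundaryGraph`; that this
graph is single-valued plays no role. -/
lemma IsBoundary.dipole_part {C : Dipolyhedron G (k + 1)} {D : Dipolyhedron G k}
    (h : IsBoundary C D) : (dipoleToPoly k).lTensor G D.1 =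
      (chainBdry k).lTensor G ((dipoleToPoly (k + 1)).lTensor G C.1) +
        (massToPoly k).lTensor G C.2 := by
  suffices H : ∀ p ∈ boundaryGraph G k, (dipoleToPoly k).lTensor G p.2.1 =
      (chainBdry k).lTensor G ((dipoleToPoly (k + 1)).lTensor G p.1.1) +
        (massToPoly k).lTensor G p.1.2 from H _ h
  intro p hp
  induction hp using AddSubgroup.closure_induction with
  | mem p hp =>
    obtain ⟨g, s, t, s', t', hb, rfl⟩ := hp
    simp only [LinearMap.lTensor_tmul]
    rw [dipoleToPoly_of_bdry hb, TensorProduct.tmul_add]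
  | zero => simp
  | add p q _ _ hp hq =>
    simp only [Prod.fst_add, Prod.snd_add, map_add, hp, hq]
    abel
  | neg p _ hp =>
    simp only [Prod.fst_neg, Prod.snd_neg, map_neg, hp]
    abel

/-- The relation `t' = -∂s'` on generators is combined with `s' = ∂s + t` and `∂∂ = 0`. Eliminating
`s'` matters: the mass part of `D` is then bounded through `C` alone. -/
lemma IsBoundary.mass_part {C : Dipolyhedron G (k + 2)} {D : Dipolyhedron G (k + 1)}
    (h : IsBoundary C D) : (massToPoly k).lTensor G D.2 =
      -(chainBdry k).lTensor G ((massToPoly (k + 1)).lTensor G C.2) := by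
  have H : ∀ p ∈ boundaryGraph G (k + 1), (massToPoly k).lTensor G p.2.2 =
      -(chainBdry k).lTensor G ((dipoleToPoly (k + 1)).lTensor G p.2.1) := by
    intro p hp
    induction hp using AddSubgroup.closure_induction with
    | mem p hp =>
      obtain ⟨g, s, t, s', t', hb, rfl⟩ := hp
      simp only [LinearMap.lTensor_tmul]
      rw [massToPoly_of_bdry hb, TensorProduct.tmul_neg]
    | zero => simp
    | add p q _ _ hp hq =>
      simp only [Prod.snd_add, Prod.fst_add, map_add, hp, hq]
      abel
    | neg p _ hp => simp only [Prod.snd_neg, Prod.fst_neg, map_neg, hp]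
  have h1 := H _ h
  have h2 : (chainBdry k).lTensor G ((chainBdry (k + 1)).lTensor G
      ((dipoleToPoly (k + 2)).lTensor G C.1)) = 0 := by
    rw [← LinearMap.lTensor_comp_apply, chainBdry_comp, LinearMap.lTensor_zero,
      LinearMap.zero_apply]
  rw [h.dipole_part, map_add, h2, zero_add] at h1
  exact h1

lemma energy_lt {D : Dipolyhedron G k} {r : ℝ} (h : energy D < r) :
    weight D.1 < r ∧ mass D.2 < r := by
  have h1 := mass_nonneg D.2
  have h2 : 0 ≤ weight D.1 := cellNorm_nonneg IsDipoleCell D.1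
  rw [energy] at h
  exact ⟨by linarith, by linarith⟩

/-- The polyhedral chain of `D.1` is those of `B.1` and `C.2`, both of dimension `k`, plus the
boundary of that of `C.1`. All three have small mass. -/
lemma dipole_eq_zero_of_flatEnergy {D : Dipolyhedron G k} (h : flatEnergy D = 0) : D.1 = 0 := by
  refine (isCellImage_dipole k).eq_zero_of_flatNull (ψ := dipoleToPoly k)
    (fun _ _ => dipoleToPoly_eq) fun ε hε => ?_
  -- The bound `ε / 5` leaves room for strict bounds `ε / 4` on three terms, of total `3ε / 4 < ε`.
  obtain ⟨B, C, D', h1, rfl, h3⟩ := hasFlatEnergyLE_of_lt (D := D) (r := ε / 5)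
    (by rw [h]; positivity)
  have hB := energy_lt (D := B) (r := ε / 4) (by linarith [energy_nonneg C])
  have hC := energy_lt (D := C) (r := ε / 4) (by linarith [energy_nonneg B])
  refine ⟨(dipoleToPoly k).lTensor G B.1 + (massToPoly k).lTensor G C.2,
    (dipoleToPoly (k + 1)).lTensor G C.1, ε / 4 + ε / 4, ε / 4,
    ((isCellImage_dipole k).hasMassLE (fun _ _ => dipoleToPoly_eq) hB.1).add
      ((isCellImage_mass k).hasMassLE (fun _ _ => massToPoly_eq) hC.2),
    (isCellImage_dipole (k + 1)).hasMassLE (fun _ _ => dipoleToPoly_eq) hC.1, ?_, by linarith⟩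
  rw [Prod.fst_add, map_add, h1.dipole_part]
  abel

/-- In dimension `0` there are no mass chains. Otherwise the polyhedral chain of `D.2` is that of
`B.2` minus the boundary of that of `C.2`, so it is flat null. -/
lemma mass_eq_zero_of_flatEnergy {D : Dipolyhedron G k} (h : flatEnergy D = 0) : D.2 = 0 := by
  cases k with
  | zero =>
    have : Subsingleton (massChains 0) := by
      change Subsingleton (⊥ : AddSubgroup (Current 0))
      infer_instance
    exact Subsingleton.elim _ _
  | succ k =>
    refine (isCellImage_mass k).eq_zero_of_flatNull (ψ := massToPoly k)
      (fun _ _ => massToPoly_eq) fun ε hε => ?_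
    obtain ⟨B, C, D', h1, rfl, h3⟩ := hasFlatEnergyLE_of_lt (D := D) (r := ε / 4)
      (by rw [h]; positivity)
    have hB := energy_lt (D := B) (r := ε / 3) (by linarith [energy_nonneg C])
    have hC := energy_lt (D := C) (r := ε / 3) (by linarith [energy_nonneg B])
    refine ⟨(massToPoly k).lTensor G B.2, -(massToPoly (k + 1)).lTensor G C.2, ε / 3, ε / 3,
      (isCellImage_mass k).hasMassLE (fun _ _ => massToPoly_eq) hB.2,
      ((isCellImage_mass (k + 1)).hasMassLE (fun _ _ => massToPoly_eq) hC.2).neg, ?_, by linarith⟩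
    rw [Prod.snd_add, map_add, h1.mass_part, map_neg]

/-- The flat energy as a norm on the group of dipolyhedra. -/
def flatEnergyNorm (G : Type*) [NormedAddCommGroup G] (k : ℕ) :
    AddGroupNorm (Dipolyhedron G k) where
  toFun := flatEnergy
  map_zero' := flatEnergy_zero
  add_le' := flatEnergy_add_le
  neg' D := le_antisymm (flatEnergy_neg_le D) (by simpa using flatEnergy_neg_le (-D))
  eq_zero_of_map_eq_zero' _ h :=
    Prod.ext (dipole_eq_zero_of_flatEnergy h) (mass_eq_zero_of_flatEnergy h)

end FlatEnergy

end Dipolyhedra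

end

theorem mainTheorem2 (G : Type*) [NormedAddCommGroup G] [CompleteSpace G] (k : ℕ) :
    ∃ N : AddGroupNorm (Dipolyhedra.Dipolyhedron G k),
      ∀ D : Dipolyhedra.Dipolyhedron G k, N D = Dipolyhedra.flatEnergy D := by
  exact ⟨Dipolyhedra.flatEnergyNorm G k, fun _ => rfl⟩
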